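/- Let $R$ be a (left and right) noetherian ring with identity which is a finitely generated module over its centre $Z(R)$. Notation. $\mathrm{Kdim}$ denotes the Krull dimension of modules in the sense of Rentschler and Gabriel (the deviation of the lattice of submodules), and $\mathrm{Kdim}(R)$ that of the regular module. For a left $R$-module $M$ put $j^{\ell}_R(M)=\min\{i:\mathrm{Ext}^i_R(M,R)\neq 0\}$, or $\infty$ if there is no such $i$; for a right module $j^r_R(M)$ is defined in the same way with $\mathrm{Ext}^i_R(M,R_R)$. For a commutative ring $C$, an ideal $\mathfrak i$ of $C$ and a $C$-module $X$, $G_C(\mathfrak i,X)$ is the length of a maximal regular sequence on $X$ with entries in $\mathfrak i$. The height of a prime (two-sided) ideal of $R$ is the greatest length of a chain of prime ideals descending from it. For a maximal ideal $\mathfrak m$ of $Z(R)$, $R_{\mathfrak m}$ is the localisation of $R$ at $Z(R)\setminus\mathfrak m$. Say that - $R$ is *Krull-Macaulay* if $\mathrm{Kdim}(R)<\infty$ and $\mathrm{Kdim}(R)=\mathrm{Kdim}(M)+j_R(M)$ for all non-zero finitely generated left and all non-zero finitely generated right $R$-modules $M$ (with $j_R=j_R^{\ell}$, resp. $j_R=j_R^{r}$);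 - $R$ is *locally Krull-Macaulay* if $R_{\mathfrak m}$ is Krull-Macaulay for every maximal ideal $\mathfrak m$ of $Z(R)$; - $R$ is *equicodimensional* if all maximal (two-sided) ideals of $R$ have the same height; - $R$ is *$Z(R)$-Macaulay* if it is a maximal Cohen-Macaulay $Z(R)$-module, that is, $G_{Z(R)}(\mathfrak m,R)=\mathrm{Kdim}_{Z(R)_{\mathfrak m}}(R_{\mathfrak m})=\mathrm{Kdim}(Z(R)_{\mathfrak m})$ for all maximal ideals $\mathfrak m$ of $Z(R)$; - $R$ is *grade symmetric* if $j^{\ell}_R(M)=j^r_R(M)$ for every $R$-bimodule $M$ which is finitely generated on both sides and central (that is, $zm=mz$ for all $z\in Z(R)$, $m\in M$). Then the following are equivalent: (i) $R$ is Krull-Macaulay; (ii) $R$ is equicodimensional and locally Krull-Macaulay; (iii) $R$ is $Z(R)$-Macaulay, equicodimensional and grade symmetric; (iv) $G_{Z(R)}(\mathfrak m,R)=\mathrm{Kdim}(R)$ for every maximal ideal $\mathfrak m$ of $Z(R)$, and $R$ is grade symmetric. -/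

import Mathlib

noncomputable section

universe u

namespace CentrallyMacaulay

/-! ### Krull dimension of modules in the sense of Rentschler and Gabriel -/

/-- `DevLT n a b` says that the deviation of the interval `[a, b]` of a partially ordered set is
`< n`. An interval with at most one element has deviation `-∞`, and `[a, b]` has deviation `≤ n`
if in every descending chain `s 0 ≥ s 1 ≥ ⋯` in `[a, b]` all but finitely many of the factors
`[s (i + 1), s i]` have deviation `< n`. So `DevLT 1 a b` is the descending chain condition. -/
def DevLT {L : Type*} [PartialOrder L] : ℕ → L → L → Prop
  | 0, a, b => (Set.Icc a b).Subsingleton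
  | n + 1, a, b => ∀ s : ℕ → L, Antitone s → (∀ i, s i ∈ Set.Icc a b) →
      ∃ N, ∀ i, N ≤ i → DevLT n (s (i + 1)) (s i)

open scoped Classical in
/-- The Krull dimension of an `R`-module `M`: the deviation of its lattice of submodules.
It is `⊥` (that is, `-∞`) for the zero module, a natural number if the deviation is finite, and
`⊤` (that is, `∞`) if the deviation is an infinite ordinal or is not defined. -/
def Kdim (R : Type*) [Ring R] (M : Type*) [AddCommGroup M] [Module R M] : WithBot ℕ∞ :=
  if DevLT 0 (⊥ : Submodule R M) ⊤ then ⊥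
  else ((⨅ (n : ℕ) (_ : DevLT (n + 1) (⊥ : Submodule R M) ⊤), (n : ℕ∞) : ℕ∞) : WithBot ℕ∞)

/-! ### Homological grade. Right `R`-modules are modules over `Rᵐᵒᵖ`. -/

/-- The least `i` with `Ext^i_R(M, N) ≠ 0`, or `∞` if there is none. -/
def extGrade (R : Type u) [Ring R] (M N : Type u) [AddCommGroup M] [Module R M]
    [AddCommGroup N] [Module R N] : ℕ∞ :=
  ⨅ (i : ℕ) (_ : Nontrivial
    (CategoryTheory.Abelian.Ext (ModuleCat.of R M) (ModuleCat.of R N) i)), (i : ℕ∞)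

/-- The left homological grade of a left `R`-module. -/
def leftGrade (R : Type u) [Ring R] (M : Type u) [AddCommGroup M] [Module R M] : ℕ∞ :=
  extGrade R M R

/-- The right homological grade of a right `R`-module; the second argument of `Ext` is the ring
`R` with its right multiplication. -/
def rightGrade (R : Type u) [Ring R] (M : Type u) [AddCommGroup M] [Module Rᵐᵒᵖ M] : ℕ∞ :=
  extGrade Rᵐᵒᵖ M R

/-- `R` is grade symmetric: left and right grades agree on every `R`-bimodule that is finitely
generated on both sides and on which the centre of `R` acts centrally. -/
def IsGradeSymmetric (R : Type u) [Ring R] : Prop :=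
  ∀ (M : Type u) [AddCommGroup M] [Module R M] [Module Rᵐᵒᵖ M] [SMulCommClass R Rᵐᵒᵖ M],
    Module.Finite R M → Module.Finite Rᵐᵒᵖ M →
    (∀ z ∈ Subring.center R, ∀ m : M, z • m = MulOpposite.op z • m) →
    leftGrade R M = rightGrade R M

/-- `R` is Krull-Macaulay: `Kdim R < ∞` and `Kdim R = Kdim M + j(M)` for every non-zero finitely
generated left or right `R`-module `M`. -/
structure IsKrullMacaulay (R : Type u) [Ring R] : Prop where
  left_finite : Kdim R R < ⊤
  right_finite : Kdim Rᵐᵒᵖ R < ⊤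
  left_eq : ∀ (M : Type u) [AddCommGroup M] [Module R M], Module.Finite R M → Nontrivial M →
    Kdim R R = Kdim R M + (leftGrade R M : WithBot ℕ∞)
  right_eq : ∀ (M : Type u) [AddCommGroup M] [Module Rᵐᵒᵖ M], Module.Finite Rᵐᵒᵖ M →
    Nontrivial M → Kdim Rᵐᵒᵖ R = Kdim Rᵐᵒᵖ M + (rightGrade R M : WithBot ℕ∞)

/-- The localisation `R_𝔪` of `R` at the central multiplicative set `Z(R) ∖ 𝔪`, with its ring
structure. -/
abbrev CentralLocalization (R : Type u) [Ring R] (m : Ideal (Subring.center R)) [m.IsPrime] :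
    Type u :=
  LocalizedModule m.primeCompl R

/-- `R` is locally Krull-Macaulay: `R_𝔪` is Krull-Macaulay for every maximal ideal `𝔪` of the
centre. -/
def IsLocallyKrullMacaulay (R : Type u) [Ring R] : Prop :=
  ∀ (m : Ideal (Subring.center R)) [m.IsMaximal], IsKrullMacaulay (CentralLocalization R m)

/-! ### Grade through regular sequences, and Macaulay modules -/

/-- `G_C(I, X)`: the largest length of a regular sequence on `X` with entries in `I`. -/
def seqGrade {C : Type*} [CommRing C] (I : Ideal C) (X : Type*) [AddCommGroup X] [Module C X] :
    ℕ∞ :=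
  ⨆ (rs : List C) (_ : (∀ r ∈ rs, r ∈ I) ∧ RingTheory.Sequence.IsRegular X rs),
    (rs.length : ℕ∞)

/-- `X` is a Cohen-Macaulay `C`-module. -/
def IsCohenMacaulayModule (C : Type*) [CommRing C] (X : Type*) [AddCommGroup X] [Module C X] :
    Prop :=
  ∀ (m : Ideal C) [m.IsMaximal], (seqGrade m X : WithBot ℕ∞) =
    Kdim (Localization.AtPrime m) (LocalizedModule m.primeCompl X)

/-- `X` is a maximal Cohen-Macaulay `C`-module. -/
structure IsMaximalCohenMacaulayModule (C : Type*) [CommRing C] (X : Type*) [AddCommGroup X]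
    [Module C X] : Prop where
  isCohenMacaulay : IsCohenMacaulayModule C X
  maximal : ∀ (m : Ideal C) [m.IsMaximal], (seqGrade m X : WithBot ℕ∞) =
    Kdim (Localization.AtPrime m) (Localization.AtPrime m)

/-- `R` is `Z(R)`-Macaulay. -/
def IsCenterMacaulay (R : Type*) [Ring R] : Prop :=
  IsMaximalCohenMacaulayModule (Subring.center R) R

/-! ### Prime two-sided ideals, height, equicodimensionality -/

/-- A two-sided ideal `P ≠ R` is prime if `IJ ⊆ P` implies `I ⊆ P` or `J ⊆ P`, for two-sided
ideals `I` and `J`. -/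
structure IsPrimeIdeal {R : Type*} [Ring R] (P : TwoSidedIdeal R) : Prop where
  ne_top : P ≠ ⊤
  le_or_le : ∀ I J : TwoSidedIdeal R, (∀ a ∈ I, ∀ b ∈ J, a * b ∈ P) → I ≤ P ∨ J ≤ P

/-- Maximal two-sided ideals are prime. -/
theorem isPrimeIdeal_of_isCoatom {R : Type*} [Ring R] {M : TwoSidedIdeal R} (hM : IsCoatom M) :
    IsPrimeIdeal M := by
  refine ⟨hM.1, fun I J h => ?_⟩
  by_contra hcon
  rw [not_or] at hcon
  have h1 : M ⊔ I = ⊤ := hM.2 _ (lt_of_le_of_ne le_sup_left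
    (fun e => hcon.1 (e ▸ le_sup_right)))
  have h2 : M ⊔ J = ⊤ := hM.2 _ (lt_of_le_of_ne le_sup_left
    (fun e => hcon.2 (e ▸ le_sup_right)))
  have e1 : (1 : R) ∈ M ⊔ I := h1 ▸ trivial
  have e2 : (1 : R) ∈ M ⊔ J := h2 ▸ trivial
  rw [TwoSidedIdeal.mem_sup] at e1 e2
  obtain ⟨m, hm, i, hi, e1⟩ := e1
  obtain ⟨n, hn, j, hj, e2⟩ := e2
  refine hM.1 ((TwoSidedIdeal.one_mem_iff M).1 ?_)
  have : (1 : R) = m * (n + j) + (i * n + i * j) := by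
    rw [← mul_add, ← add_mul, e1, e2, one_mul]
  rw [this]
  exact M.add_mem (M.mul_mem_right _ _ hm) (M.add_mem (M.mul_mem_left _ _ hn) (h i hi j hj))

/-- The prime two-sided ideals of `R`, ordered by inclusion. -/
abbrev PrimeIdeals (R : Type*) [Ring R] := {P : TwoSidedIdeal R // IsPrimeIdeal P}

/-- `R` is equicodimensional: all maximal two-sided ideals of `R` have the same height, where the
height of a prime `P` is the supremum of the lengths of chains of primes descending from `P`. -/
def IsEquicodimensional (R : Type*) [Ring R] : Prop :=
  ∀ (M N : TwoSidedIdeal R) (hM : IsCoatom M) (hN : IsCoatom N),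
    Order.height (⟨M, isPrimeIdeal_of_isCoatom hM⟩ : PrimeIdeals R) =
      Order.height (⟨N, isPrimeIdeal_of_isCoatom hN⟩ : PrimeIdeals R)

end CentrallyMacaulay

end

/-! Let Z be the centre of R. It is Noetherian by an Eakin–Nagata argument
(`isNoetherianRing_of_annihilator_eq_bot`), so everything can be measured over Z. The Krull
dimension of a module that is finite over Z is the dimension of its support in Spec Z, whichever
Z-algebra acts on it (`kdim_eq_supportDim`). As R is faithful over Z, both one-sided Krull
dimensions of R equal dim Z.

Grades are controlled by Rees' change of rings (`ext_of_isWeaklyRegular`): if a central sequence rs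
is regular on R and kills M, then Ext^i(M, R) vanishes for i < |rs|, and Ext^|rs|(M, R) is nonzero
exactly when there is a nonzero map M → R/(rs)R. Suppose that R has depth d = dim Z at every maximal
ideal of Z (`HasDepth`). Then the annihilator of M in Z contains a regular sequence of length d -
dim M, and the Krull–Macaulay equality for M says that this sequence computes the grade. The only
obstruction is the existence of the nonzero map, which is what `HasEnoughHoms` demands. For nonzero
R, being Krull–Macaulay thus amounts to uniform depth d together with enough homomorphisms on both
sides; depth is recovered from the equality for the modules R/mR.

Grade symmetry supplies the homomorphisms (`TensorGradeSymmetric.hasEnoughHoms`). Given a left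
module M, a suitable right submodule N of R/(rs)R makes the bimodule M ⊗ N map nontrivially to
R/(rs)R on the right; symmetry moves this to the left, and fixing an element of N yields a map from
M. Conversely, a Krull–Macaulay ring is grade symmetric because the dimension of a central bimodule
is computed over Z and so is the same on both sides.

Both properties pass to and from the localisations at maximal ideals of Z (section `Maximal`).
Heights of maximal ideals of R are compared with those of Z by incomparability in one direction and
by regular sequences in the other; when depth equals height in Z, equicodimensionality says that all
maximal ideals of Z have the same height, which is dim Z. -/

noncomputable section
universe u
open scoped Pointwise

namespace CentrallyMacaulay

open RingTheory.Sequence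

/-! ### Formal properties of the deviation of posets -/

section Deviation

variable {L L' : Type*} [PartialOrder L] [PartialOrder L']

/-- The factors of a chain map strictly monotonically to the factors of its image, so bounds on the
deviation pull back. The comparisons of submodule lattices below go through this lemma. -/
theorem devLT_of_strictMonoOn (n : ℕ) {f : L → L'} {a b : L} (hf : StrictMonoOn f (Set.Icc a b))
    (h : DevLT n (f a) (f b)) : DevLT n a b := by
  induction n generalizing a b with
  | zero =>
    intro x hx y hy
    by_contra hxy
    have hab : a ≤ b := hx.1.trans hx.2
    have hne : a ≠ b := by
      rintro rfl
      exact hxy ((le_antisymm hx.2 hx.1).trans (le_antisymm hy.2 hy.1).symm)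
    have ha : a ∈ Set.Icc a b := ⟨le_rfl, hab⟩
    have hb : b ∈ Set.Icc a b := ⟨hab, le_rfl⟩
    have hlt := hf ha hb (lt_of_le_of_ne hab hne)
    exact hlt.ne (h ⟨le_rfl, hlt.le⟩ ⟨hlt.le, le_rfl⟩)
  | succ n ih =>
    intro s hs hsI
    have hab : a ≤ b := (hsI 0).1.trans (hsI 0).2
    obtain ⟨N, hN⟩ := h (fun i => f (s i))
      (fun i j hij => hf.monotoneOn (hsI j) (hsI i) (hs hij))
      (fun i => ⟨hf.monotoneOn ⟨le_rfl, hab⟩ (hsI i) (hsI i).1,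
        hf.monotoneOn (hsI i) ⟨hab, le_rfl⟩ (hsI i).2⟩)
    exact ⟨N, fun i hi => ih
      (hf.mono (Set.Icc_subset_Icc (hsI _).1 (hsI _).2)) (hN i hi)⟩

theorem DevLT.mono {n : ℕ} {a b a' b' : L} (h : DevLT n a b) (ha : a ≤ a') (hb : b' ≤ b) :
    DevLT n a' b' := by
  cases n with
  | zero => exact Set.Subsingleton.anti h (Set.Icc_subset_Icc ha hb)
  | succ n => exact fun s hs hsI => h s hs fun i => ⟨ha.trans (hsI i).1, (hsI i).2.trans hb⟩

theorem devLT_self (n : ℕ) (a : L) : DevLT n a a := by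
  induction n generalizing a with
  | zero => simp [DevLT]
  | succ n ih =>
    intro s _ hsI
    have h : ∀ i, s i = a := fun i => le_antisymm (hsI i).2 (hsI i).1
    exact ⟨0, fun i _ => by rw [h, h]; exact ih a⟩

theorem devLT_prod {n : ℕ} {a b : L × L'} (h₁ : DevLT n a.1 b.1) (h₂ : DevLT n a.2 b.2) :
    DevLT n a b := by
  induction n generalizing a b with
  | zero =>
    intro x hx y hy
    exact Prod.ext (h₁ ⟨hx.1.1, hx.2.1⟩ ⟨hy.1.1, hy.2.1⟩) (h₂ ⟨hx.1.2, hx.2.2⟩ ⟨hy.1.2, hy.2.2⟩)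
  | succ n ih =>
    intro s hs hsI
    obtain ⟨N₁, hN₁⟩ := h₁ (fun i => (s i).1) (fun i j hij => (hs hij).1)
      fun i => ⟨(hsI i).1.1, (hsI i).2.1⟩
    obtain ⟨N₂, hN₂⟩ := h₂ (fun i => (s i).2) (fun i j hij => (hs hij).2)
      fun i => ⟨(hsI i).1.2, (hsI i).2.2⟩
    exact ⟨max N₁ N₂, fun i hi =>
      ih (hN₁ i ((le_max_left _ _).trans hi)) (hN₂ i ((le_max_right _ _).trans hi))⟩

/-- In a modular lattice x is determined strictly monotonically by x ⊓ c and x ⊔ c. This is what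
handles short exact sequences of modules. -/
theorem devLT_bot_top_of_modular {L : Type*} [Lattice L] [IsModularLattice L] [BoundedOrder L]
    {n : ℕ} (c : L) (h₁ : DevLT n ⊥ c) (h₂ : DevLT n c ⊤) : DevLT n (⊥ : L) ⊤ := by
  refine devLT_of_strictMonoOn n (f := fun x : L => (x ⊓ c, x ⊔ c))
    (strictMono_inf_prod_sup.strictMonoOn _) (devLT_prod ?_ ?_)
  · simpa using h₁
  · simpa using h₂

end Deviation

/-! ### Dimension of the support -/

section Support

variable {Z : Type*} [CommRing Z] {M : Type*} [AddCommGroup M] [Module Z M]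

/-- The support is closed under specialisation, so a chain of primes that starts in it stays in it.
-/
theorem natCast_le_supportDim_iff {n : ℕ} :
    (n : WithBot ℕ∞) ≤ Module.supportDim Z M ↔
      ∃ p ∈ Module.support Z M, (n : ℕ∞) ≤ Order.coheight p := by
  rw [Module.supportDim, Order.le_krullDim_iff]
  constructor
  · rintro ⟨l, rfl⟩
    exact ⟨l.head.1, l.head.2,
      Order.length_le_coheight (p := l.map Subtype.val fun _ _ h => h) le_rfl⟩
  · rintro ⟨p, hp, hn⟩
    obtain ⟨l, hl, rfl⟩ := Order.exists_series_of_le_coheight p hn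
    refine ⟨⟨l.length, fun i => ⟨l i, Module.mem_support_mono ?_ hp⟩, fun i => l.step i⟩, rfl⟩
    rw [← hl]
    exact l.head_le i

theorem coheight_le_supportDim {p : PrimeSpectrum Z} (hp : p ∈ Module.support Z M) :
    (Order.coheight p : WithBot ℕ∞) ≤ Module.supportDim Z M := by
  by_contra! h
  have hne : Module.supportDim Z M ≠ ⊥ := by
    rw [Ne, Module.supportDim_eq_bot_iff_subsingleton, ← Module.support_eq_empty_iff (R := Z)]
    rintro h
    simp [h] at hp
  obtain ⟨k, hk⟩ := WithBot.ne_bot_iff_exists.mp hne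
  rw [← hk, WithBot.coe_lt_coe] at h
  obtain ⟨n, rfl⟩ := ENat.ne_top_iff_exists.mp (h.ne_top)
  have := natCast_le_supportDim_iff (n := n + 1).mpr ⟨p, hp, Order.add_one_le_of_lt h⟩
  rw [← hk] at this
  have h2 : ((n + 1 : ℕ) : ℕ∞) ≤ n := WithBot.coe_le_coe.mp this
  norm_cast at h2
  omega

theorem supportDim_quotSMulTop_add_one_le [IsNoetherianRing Z] [Module.Finite Z M] {x : Z}
    (hx : IsSMulRegular M x) :
    Module.supportDim Z (QuotSMulTop x M) + 1 ≤ Module.supportDim Z M :=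
  Module.supportDim_quotSMulTop_succ_le_of_notMem_minimalPrimes
    fun _ => hx.notMem_of_mem_minimalPrimes

end Support

/-! ### Quotients by a scalar, over Z and over an algebra -/

section RestrictScalars

variable (Z : Type*) [CommRing Z] {A : Type*} [Ring A] [Algebra Z A]
  {M : Type*} [AddCommGroup M] [Module A M] [Module Z M] [IsScalarTower Z A M]

variable (A M) in
/-- The quotient of an `A`-module `M` by the multiples of a scalar `z`, computed over `Z` or over
the `Z`-algebra `A`. -/
def quotSMulTopEquiv (z : Z) : QuotSMulTop z M ≃ₗ[Z] M ⧸ (z • (⊤ : Submodule A M)) :=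
  (Submodule.quotEquivOfEq _ _ (by
    ext x
    simp [Submodule.mem_smul_pointwise_iff_exists])).trans
      (Submodule.Quotient.restrictScalarsEquiv Z (z • (⊤ : Submodule A M)))

end RestrictScalars

/-! ### Rentschler–Gabriel dimension equals dimension of the support -/

section Comparison

variable {Z : Type*} [CommRing Z] [IsNoetherianRing Z]

/-- Step from p to a larger prime q of the support and pick c in q outside p. All factors of the
chain M ⊇ cM ⊇ c²M ⊇ ⋯ still have q in their support, so by induction none of them has small
deviation. Since c is a central scalar, the chain consists of A-submodules. -/
theorem not_devLT_of_le_coheight {A : Type*} [Ring A] [Algebra Z A] (n : ℕ)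
    {M : Type*} [AddCommGroup M] [Module A M] [Module Z M] [IsScalarTower Z A M]
    [Module.Finite Z M] {p : PrimeSpectrum Z} (hp : p ∈ Module.support Z M)
    (hn : (n : ℕ∞) ≤ Order.coheight p) : ¬ DevLT n (⊥ : Submodule A M) ⊤ := by
  induction n generalizing M p with
  | zero =>
    intro h
    have : Nontrivial M := Module.nonempty_support_iff.mp ⟨p, hp⟩
    exact bot_ne_top (α := Submodule A M) (h ⟨le_rfl, bot_le⟩ ⟨bot_le, le_rfl⟩)
  | succ n ih =>
    have hlt : ¬ Order.coheight p ≤ n := by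
      intro h
      have := hn.trans h
      norm_cast at this
      omega
    rw [Order.coheight_le_coe_iff] at hlt
    push Not at hlt
    obtain ⟨q, hpq, hq⟩ := hlt
    obtain ⟨c, hcq, hcp⟩ := Set.exists_of_ssubset (show (p.asIdeal : Set Z) ⊂ q.asIdeal from hpq)
    intro h
    obtain ⟨N, hN⟩ := h (fun i => c ^ i • (⊤ : Submodule A M))
      (antitone_nat_of_succ_le fun i x hx => by
        rw [Submodule.mem_smul_pointwise_iff_exists] at hx ⊢
        obtain ⟨y, -, rfl⟩ := hx
        exact ⟨c • y, trivial, by rw [← mul_smul, pow_succ]⟩)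
      (fun i => ⟨bot_le, le_top⟩)
    have hN := hN N le_rfl
    set K : Submodule A M := c ^ N • (⊤ : Submodule A M) with hK
    have hfin : Module.Finite Z K :=
      inferInstanceAs (Module.Finite Z (K.restrictScalars Z))
    -- Passing from M to c^N M does not lose p, because c lies outside p.
    have hpK : p ∈ Module.support Z K := by
      rw [Module.mem_support_iff_of_finite] at hp ⊢
      intro t ht
      have : t * c ^ N ∈ p.asIdeal := by
        refine hp (Module.mem_annihilator.mpr fun y => ?_)
        have := Module.mem_annihilator.mp ht
          ⟨c ^ N • y, Submodule.smul_mem_pointwise_smul _ _ _ trivial⟩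
        rw [Subtype.ext_iff] at this
        simpa [mul_smul] using this
      exact (p.isPrime.mem_or_mem this).resolve_right fun h => hcp (p.isPrime.mem_of_pow_mem _ h)
    have hqK : q ∈ Module.support Z (K ⧸ (c • (⊤ : Submodule A K))) := by
      rw [← (quotSMulTopEquiv Z A K c).support_eq, Module.support_quotSMulTop]
      exact ⟨Module.mem_support_mono hpq.le hpK, by simpa using hcq⟩
    have hfin' : Module.Finite Z (K ⧸ (c • (⊤ : Submodule A K))) :=
      Module.Finite.equiv (quotSMulTopEquiv Z A K c)
    refine ih hqK hq ?_
    -- The submodules of K/cK are transported into the interval between c^(N+1) M and c^N M.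
    refine devLT_of_strictMonoOn n (f := fun W : Submodule A (K ⧸ (c • (⊤ : Submodule A K))) =>
      (W.comap (Submodule.mkQ _)).map K.subtype) (StrictMono.strictMonoOn ?_ _) ?_
    · exact (Submodule.map_strictMono_of_injective K.injective_subtype).comp
        (Submodule.comap_strictMono_of_surjective (Submodule.mkQ_surjective _))
    · have e₁ : ((⊥ : Submodule A (K ⧸ (c • (⊤ : Submodule A K)))).comap
          (Submodule.mkQ _)).map K.subtype = c ^ (N + 1) • (⊤ : Submodule A M) := by
        ext x
        simp only [Submodule.comap_bot, Submodule.ker_mkQ, Submodule.mem_map,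
          Submodule.mem_smul_pointwise_iff_exists]
        constructor
        · rintro ⟨_, ⟨⟨y, hy⟩, -, rfl⟩, rfl⟩
          rw [hK, Submodule.mem_smul_pointwise_iff_exists] at hy
          obtain ⟨y, -, rfl⟩ := hy
          exact ⟨y, trivial, by simp [pow_succ', mul_smul]⟩
        · rintro ⟨y, -, rfl⟩
          exact ⟨_, ⟨⟨c ^ N • y, Submodule.smul_mem_pointwise_smul _ _ _ trivial⟩, trivial, rfl⟩,
            by simp [pow_succ', mul_smul]⟩
      have e₂ : ((⊤ : Submodule A (K ⧸ (c • (⊤ : Submodule A K)))).comap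
          (Submodule.mkQ _)).map K.subtype = K := by simp
      simp only [e₁, e₂]
      exact hN

/-- By a prime filtration it suffices to treat Z/p. There every nonzero submodule contains the
multiples of a regular element, so each quotient by a nonzero submodule has smaller dimension, and
the outer induction applies to all the factors of a chain without zero terms. -/
theorem devLT_of_supportDim_lt (n : ℕ) {M : Type*} [AddCommGroup M] [Module Z M]
    [Module.Finite Z M] (hM : Module.supportDim Z M < n) : DevLT n (⊥ : Submodule Z M) ⊤ := by
  induction n generalizing M with
  | zero =>
    have : Subsingleton M := by
      rw [← Module.supportDim_eq_bot_iff_subsingleton Z]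
      by_contra h
      obtain ⟨k, hk⟩ := WithBot.ne_bot_iff_exists.mp h
      rw [← hk] at hM
      have h0 : k < ((0 : ℕ) : ℕ∞) := WithBot.coe_lt_coe.mp hM
      simp at h0
    exact Set.subsingleton_of_subsingleton
  | succ n ih =>
    induction ‹Module.Finite Z M› using
      IsNoetherianRing.induction_on_isQuotientEquivQuotientPrime Z with
    | subsingleton N =>
      rw [Subsingleton.elim (⊥ : Submodule Z N) ⊤]
      exact devLT_self _ _
    | quotient N p e =>
      intro s hs _
      by_cases hbot : ∃ i, s i = ⊥
      · obtain ⟨i, hi⟩ := hbot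
        refine ⟨i, fun j hj => ?_⟩
        have h₁ : s j = ⊥ := le_bot_iff.mp ((hs hj).trans_eq hi)
        have h₂ : s (j + 1) = ⊥ := le_bot_iff.mp ((hs (hj.trans j.le_succ)).trans_eq hi)
        rw [h₁, h₂]
        exact devLT_self _ _
      · push Not at hbot
        refine ⟨0, fun i _ => DevLT.mono (b := ⊤) ?_ le_rfl le_top⟩
        obtain ⟨x, hx, hx0⟩ := (Submodule.ne_bot_iff _).mp (hbot (i + 1))
        -- The nonzero element x of the submodule is itself a scalar a of the domain Z/p, and a N is
        -- contained in Z x.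
        obtain ⟨a, ha⟩ := Ideal.Quotient.mk_surjective (e x)
        have hreg : IsSMulRegular N a := by
          refine (LinearEquiv.isSMulRegular_congr e a).mpr ?_
          rw [isSMulRegular_iff_right_eq_zero_of_smul]
          intro y hy
          rw [Algebra.smul_def] at hy
          exact (mul_eq_zero.mp hy).resolve_left fun h => hx0 (e.injective (by
            rw [map_zero, ← ha]; exact h))
        have hle : a • (⊤ : Submodule Z N) ≤ s (i + 1) := by
          rintro _ ⟨y, -, rfl⟩
          obtain ⟨b, hb⟩ := Ideal.Quotient.mk_surjective (e y)
          have : a • y = b • x := e.injective (by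
            rw [map_smul, map_smul, ← hb, ← ha, Algebra.smul_def, Algebra.smul_def]
            exact mul_comm _ _)
          change a • y ∈ _
          exact this ▸ (s (i + 1)).smul_mem b hx
        have hdim : Module.supportDim Z (N ⧸ s (i + 1)) < n := by
          have h₁ := supportDim_quotSMulTop_add_one_le hreg
          have h₂ : Module.supportDim Z (N ⧸ s (i + 1)) ≤ Module.supportDim Z (QuotSMulTop a N) :=
            Module.supportDim_le_of_surjective (Submodule.factor hle) (Submodule.factor_surjective hle)
          have h₃ := ((add_le_add_left h₂ 1).trans h₁).trans_lt hM
          push_cast at h₃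
          exact lt_of_add_lt_add_right h₃
        have := ih hdim
        refine devLT_of_strictMonoOn n (f := Submodule.map (s (i + 1)).mkQ) ?_ ?_
        · intro W hW W' hW' hlt
          refine lt_of_le_of_ne (Submodule.map_mono hlt.le) fun h => hlt.ne ?_
          have := congrArg (Submodule.comap (s (i + 1)).mkQ) h
          simpa [Submodule.comap_map_mkQ, sup_eq_right.mpr hW.1, sup_eq_right.mpr hW'.1] using this
        · simpa [Submodule.map_top] using this
    | exact N₁ N₂ N₃ f g hf hg hfg ih₁ ih₃ =>
      have d₁ := ih₁ ((Module.supportDim_le_of_injective f hf).trans_lt hM)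
      have d₃ := ih₃ ((Module.supportDim_le_of_surjective g hg).trans_lt hM)
      refine devLT_bot_top_of_modular (LinearMap.range f) ?_ ?_
      · refine devLT_of_strictMonoOn _ (f := Submodule.comap f) ?_ ?_
        · intro W hW W' hW' hlt
          refine lt_of_le_of_ne (Submodule.comap_mono hlt.le) fun h => hlt.ne ?_
          have := congrArg (Submodule.map f) h
          simpa [Submodule.map_comap_eq, inf_eq_right.mpr hW.2, inf_eq_right.mpr hW'.2] using this
        · refine d₁.mono bot_le le_top
      · refine devLT_of_strictMonoOn _ (f := Submodule.map g) ?_ (d₃.mono bot_le le_top)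
        rw [← LinearMap.exact_iff.mp hfg]
        intro W hW W' hW' hlt
        refine lt_of_le_of_ne (Submodule.map_mono hlt.le) fun h => hlt.ne ?_
        have := congrArg (Submodule.comap g) h
        simpa [Submodule.comap_map_eq, sup_eq_left.mpr hW.1, sup_eq_left.mpr hW'.1] using this

/-- The lower bound on the deviation was proved for A-submodules directly; the upper bound over Z
suffices because A-submodules form a subposet of the Z-submodules. Hence the result does not depend
on A. -/
theorem devLT_iff_supportDim_lt {A : Type*} [Ring A] [Algebra Z A] (n : ℕ)
    {M : Type*} [AddCommGroup M] [Module A M] [Module Z M] [IsScalarTower Z A M]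
    [Module.Finite Z M] :
    DevLT n (⊥ : Submodule A M) ⊤ ↔ Module.supportDim Z M < n := by
  constructor
  · intro h
    by_contra! hn
    obtain ⟨p, hp, hpn⟩ := natCast_le_supportDim_iff.mp hn
    exact not_devLT_of_le_coheight n hp hpn h
  · intro h
    exact devLT_of_strictMonoOn n (f := Submodule.restrictScalars Z)
      (StrictMono.strictMonoOn (fun _ _ h => h) _) (devLT_of_supportDim_lt n h)

variable (Z) in
/-- The Krull dimension of a module that is finite over a commutative Noetherian ring of scalars
is the dimension of its support. -/
theorem kdim_eq_supportDim (A : Type*) [Ring A] [Algebra Z A]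
    (M : Type*) [AddCommGroup M] [Module A M] [Module Z M] [IsScalarTower Z A M]
    [Module.Finite Z M] : Kdim A M = Module.supportDim Z M := by
  rw [Kdim]
  simp only [devLT_iff_supportDim_lt (Z := Z)]
  rcases eq_or_ne (Module.supportDim Z M) ⊥ with h | h
  · rw [if_pos (by rw [h]; exact WithBot.bot_lt_coe _), h]
  obtain ⟨k, hk⟩ := WithBot.ne_bot_iff_exists.mp h
  rw [← hk]
  have key : ∀ n : ℕ, (k : WithBot ℕ∞) < ((n : ℕ) : WithBot ℕ∞) ↔ k < (n : ℕ∞) := fun n =>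
    WithBot.coe_lt_coe (b := (n : ℕ∞))
  simp only [key]
  rw [if_neg (by simp)]
  congr 1
  refine le_antisymm ?_ ?_
  · by_cases hk : k = ⊤
    · simp [hk]
    · obtain ⟨n, rfl⟩ := ENat.ne_top_iff_exists.mp hk
      exact iInf₂_le n (by norm_cast; omega)
  · refine le_iInf₂ fun n hn => ?_
    push_cast at hn
    exact Order.le_of_lt_add_one hn

end Comparison

/-! ### Associated primes along regular sequences -/

section Commutative

variable {Z : Type*} [CommRing Z] [IsNoetherianRing Z] {Y : Type*} [AddCommGroup Y] [Module Z Y]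

theorem exists_associatedPrime_le_of_mem_support [Module.Finite Z Y] {m : PrimeSpectrum Z}
    (hm : m ∈ Module.support Z Y) : ∃ q ∈ associatedPrimes Z Y, q ≤ m.asIdeal := by
  obtain ⟨q, hq, hqm⟩ := Ideal.exists_minimalPrimes_le (Module.mem_support_iff_of_finite.mp hm)
  exact ⟨q, Module.associatedPrimes.minimalPrimes_annihilator_subset_associatedPrimes Z Y hq, hqm⟩

theorem annihilator_le_of_mem_associatedPrimes {p : Ideal Z} (hp : p ∈ associatedPrimes Z Y) :
    Module.annihilator Z Y ≤ p := by
  obtain ⟨-, x, hx⟩ := isAssociatedPrime_iff.mp hp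
  intro a ha
  rw [hx, Submodule.mem_colon_singleton, Module.mem_annihilator.mp ha]
  exact Submodule.zero_mem _

theorem notMem_of_isSMulRegular {x : Z} (hx : IsSMulRegular Y x) {p : Ideal Z}
    (hp : p ∈ associatedPrimes Z Y) : x ∉ p := by
  intro h
  have : x ∈ ⋃ p ∈ associatedPrimes Z Y, (p : Set Z) := Set.mem_iUnion₂_of_mem hp h
  rw [biUnion_associatedPrimes_eq_compl_regular] at this
  exact this hx

theorem exists_le_associatedPrime_of_forall_not_isSMulRegular [Module.Finite Z Y] {I : Ideal Z}
    (h : ∀ x ∈ I, ¬ IsSMulRegular Y x) : ∃ p ∈ associatedPrimes Z Y, I ≤ p := by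
  refine (Ideal.subset_union_prime_finite (associatedPrimes.finite Z Y) ⊥ ⊥
    (f := id) fun p hp _ _ => hp.isPrime).mp ?_
  simp only [id]
  rw [biUnion_associatedPrimes_eq_compl_regular]
  exact h

/-- Let U be the submodule of elements killed by p, and W its image in Y/xY. Then m is in the
support of U/xU, hence of W, so W has an associated prime q inside m. It contains p and x, while x
is not in p because x is regular. -/
theorem exists_associatedPrime_quotSMulTop [Module.Finite Z Y] {p m : Ideal Z} [m.IsPrime]
    (hp : p ∈ associatedPrimes Z Y) (hpm : p ≤ m) {x : Z} (hxm : x ∈ m) (hx : IsSMulRegular Y x) :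
    ∃ q ∈ associatedPrimes Z (QuotSMulTop x Y), p < q ∧ q ≤ m := by
  obtain ⟨U, hU⟩ : ∃ U : Submodule Z Y, ∀ y, y ∈ U ↔ ∀ a ∈ p, a • y = 0 :=
    ⟨Submodule.torsionBySet Z Y p, fun y => by simp [Submodule.mem_torsionBySet_iff]⟩
  obtain ⟨W, hW⟩ : ∃ W : Submodule Z (QuotSMulTop x Y), ∀ w, w ∈ W ↔
      ∃ u ∈ U, Submodule.Quotient.mk u = w := ⟨U.map (Submodule.mkQ _), fun w => Iff.rfl⟩
  have hmU : (⟨m, inferInstance⟩ : PrimeSpectrum Z) ∈ Module.support Z U := by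
    rw [Module.mem_support_iff_of_finite]
    obtain ⟨-, u, hu⟩ := isAssociatedPrime_iff.mp hp
    have huU : u ∈ U := (hU u).mpr fun a ha => by
      rw [hu, Submodule.mem_colon_singleton] at ha
      simpa using ha
    intro t ht
    refine hpm ?_
    rw [hu, Submodule.mem_colon_singleton]
    simpa using congrArg Subtype.val (Module.mem_annihilator.mp ht ⟨u, huU⟩)
  have hmQ : (⟨m, inferInstance⟩ : PrimeSpectrum Z) ∈ Module.support Z (QuotSMulTop x U) := by
    rw [Module.support_quotSMulTop]
    exact ⟨hmU, by simpa using hxm⟩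
  have hmW : (⟨m, inferInstance⟩ : PrimeSpectrum Z) ∈ Module.support Z W := by
    rw [Module.mem_support_iff_of_finite] at hmQ ⊢
    refine le_trans ?_ hmQ
    intro t ht
    rw [Module.mem_annihilator] at ht ⊢
    intro y
    obtain ⟨u, rfl⟩ := Submodule.Quotient.mk_surjective _ y
    have h₁ := congrArg Subtype.val (ht ⟨_, (hW _).mpr ⟨u, u.2, rfl⟩⟩)
    have h₂ : t • (u : Y) ∈ x • (⊤ : Submodule Z Y) := by
      rw [← Submodule.Quotient.mk_eq_zero]
      simpa using h₁
    obtain ⟨v, -, hv⟩ := (Submodule.mem_smul_pointwise_iff_exists _ _ _).mp h₂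
    -- U ∩ xY = xU: if x v is killed by p, then so is v, as x is regular. Hence what kills W also
    -- kills U/xU.
    have hvU : v ∈ U := (hU v).mpr fun a ha => hx (by
      change x • a • v = x • 0
      rw [smul_comm, hv, smul_comm, (hU u).mp u.2 a ha, smul_zero, smul_zero])
    rw [← Submodule.Quotient.mk_smul, Submodule.Quotient.mk_eq_zero]
    exact (Submodule.mem_smul_pointwise_iff_exists _ _ _).mpr ⟨⟨v, hvU⟩, trivial, Subtype.ext hv⟩
  obtain ⟨q, hq, hqm⟩ := exists_associatedPrime_le_of_mem_support hmW
  have hann : Module.annihilator Z W ≤ q := annihilator_le_of_mem_associatedPrimes hq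
  refine ⟨q, associatedPrimes.subset_of_injective W.injective_subtype hq, ?_, hqm⟩
  have hpq : p ≤ q := by
    refine fun a ha => hann (Module.mem_annihilator.mpr fun w => Subtype.ext ?_)
    obtain ⟨u, hu, hw⟩ := (hW w).mp w.2
    rw [Submodule.coe_smul, ← hw, ← Submodule.Quotient.mk_smul, (hU u).mp hu a ha]
    simp
  have hxq : x ∈ q := by
    refine hann (Module.mem_annihilator.mpr fun w => Subtype.ext ?_)
    obtain ⟨u, hu, hw⟩ := (hW w).mp w.2
    rw [Submodule.coe_smul, ← hw, ← Submodule.Quotient.mk_smul, Submodule.coe_zero,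
      Submodule.Quotient.mk_eq_zero]
    exact Submodule.smul_mem_pointwise_smul _ _ _ trivial
  refine lt_of_le_of_ne hpq ?_
  rintro rfl
  exact notMem_of_isSMulRegular hx hp hxq

/-- A weakly regular sequence in `m` produces a chain of primes of the same length between any
associated prime contained in `m` and `m`. -/
theorem exists_ltSeries_of_isWeaklyRegular [Module.Finite Z Y] {p m : PrimeSpectrum Z}
    (hp : p.asIdeal ∈ associatedPrimes Z Y) (hpm : p ≤ m) {rs : List Z}
    (hm : ∀ r ∈ rs, r ∈ m.asIdeal) (hrs : IsWeaklyRegular Y rs) :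
    ∃ l : LTSeries (PrimeSpectrum Z), l.head = p ∧ l.last ≤ m ∧ l.length = rs.length := by
  induction rs generalizing Y p with
  | nil => exact ⟨RelSeries.singleton _ p, rfl, hpm, rfl⟩
  | cons x rs ih =>
    rw [isWeaklyRegular_cons_iff] at hrs
    obtain ⟨q, hq, hpq, hqm⟩ := exists_associatedPrime_quotSMulTop hp hpm (hm x (by simp)) hrs.1
    obtain ⟨l, hl, hlm, hlen⟩ := ih (p := ⟨q, hq.isPrime⟩) hq hqm
      (fun r hr => hm r (by simp [hr])) hrs.2
    exact ⟨l.cons p (by rw [hl]; exact hpq), by simp, by simpa using hlm, by simp [hlen]⟩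

theorem supportDim_quotient_ofList_add_length_le [Module.Finite Z Y] {rs : List Z}
    (hrs : IsWeaklyRegular Y rs) :
    Module.supportDim Z (Y ⧸ (Ideal.ofList rs • ⊤ : Submodule Z Y)) + rs.length ≤
      Module.supportDim Z Y := by
  induction rs generalizing Y with
  | nil =>
    simpa using Module.supportDim_le_of_surjective _ (Submodule.mkQ_surjective _)
  | cons x rs ih =>
    rw [isWeaklyRegular_cons_iff] at hrs
    rw [Module.supportDim_eq_of_equiv (Submodule.quotOfListConsSMulTopEquivQuotSMulTopInner Y x rs)]
    refine le_trans ?_ (supportDim_quotSMulTop_add_one_le hrs.1)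
    have := add_le_add_left (ih hrs.2) 1
    simpa [add_assoc] using this

end Commutative

/-! ### Rees' change of rings for Ext -/

section Rees

open CategoryTheory Abelian

variable {Z A : Type u} [CommRing Z] [Ring A] [Algebra Z A]

open scoped ModuleCat.Algebra in
-- Ext over a Z-algebra is Z-bilinear, so a central scalar acts in the same way through either
-- argument.
theorem ext_comp_central {X Y : ModuleCat.{u} A} (z : Z) {f : X ⟶ X} {g : Y ⟶ Y}
    (hf : ∀ x, f.hom x = algebraMap Z A z • x) (hg : ∀ y, g.hom y = algebraMap Z A z • y) {i : ℕ}
    (x : Ext X Y i) : x.comp (Ext.mk₀ g) (add_zero i) = (Ext.mk₀ f).comp x (zero_add i) := by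
  have h₁ : g = z • 𝟙 Y := by
    ext y
    exact hg y
  have h₂ : f = z • 𝟙 X := by
    ext y
    exact hf y
  rw [h₁, h₂, Ext.mk₀_smul, Ext.mk₀_smul, Ext.comp_smul, Ext.comp_mk₀_id, Ext.smul_comp,
    Ext.mk₀_id_comp]

section Step

variable {M Y : Type u} [AddCommGroup M] [Module A M] [Module Z M] [IsScalarTower Z A M]
  [AddCommGroup Y] [Module A Y] [Module Z Y] [IsScalarTower Z A Y]

theorem ext_comp_smul_eq_zero {z : Z} (hz : ∀ x : M, z • x = 0) {i : ℕ}
    (x : Ext (ModuleCat.of A M) (ModuleCat.of A Y) i) :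
    x.comp (Ext.mk₀ (ModuleCat.ofHom (z • (LinearMap.id : Y →ₗ[A] Y)))) (add_zero i) = 0 := by
  rw [ext_comp_central z (f := 0), Ext.mk₀_zero, Ext.zero_comp]
  · intro y
    exact ((algebraMap_smul A z (y : M)).trans (hz y)).symm
  · intro y
    exact (algebraMap_smul A z (y : Y)).symm

/-- Since z kills M, it acts as zero on Ext(M, Y). The long exact sequence of 0 → Y → Y → Y/zY → 0
therefore breaks up into short exact sequences 0 → Ext^i(M, Y) → Ext^i(M, Y/zY) → Ext^(i+1)(M, Y) →
0. -/
theorem ext_step {z : Z} (hz : ∀ x : M, z • x = 0) (hreg : IsSMulRegular Y z) (i : ℕ) :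
    Subsingleton (Ext (ModuleCat.of A M) (ModuleCat.of A (Y ⧸ z • (⊤ : Submodule A Y))) i) ↔
      Subsingleton (Ext (ModuleCat.of A M) (ModuleCat.of A Y) i) ∧
        Subsingleton (Ext (ModuleCat.of A M) (ModuleCat.of A Y) (i + 1)) := by
  have hexact : Function.Exact (z • (LinearMap.id : Y →ₗ[A] Y)) (z • (⊤ : Submodule A Y)).mkQ := by
    intro x
    simp [Submodule.mem_smul_pointwise_iff_exists]
  let S : ShortComplex (ModuleCat.{u} A) :=
    ModuleCat.shortComplexOfCompEqZero _ _ hexact.linearMap_comp_eq_zero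
  have hS : S.ShortExact :=
    { exact := ModuleCat.shortComplex_exact _ hexact
      mono_f := (ModuleCat.mono_iff_injective _).mpr hreg
      epi_g := (ModuleCat.epi_iff_surjective _).mpr (Submodule.mkQ_surjective _) }
  have hzero : ∀ {j : ℕ} (x : Ext (ModuleCat.of A M) (ModuleCat.of A Y) j),
      x.comp (Ext.mk₀ S.f) (add_zero j) = 0 := fun x => ext_comp_smul_eq_zero hz x
  constructor
  · intro h
    constructor
    · refine subsingleton_of_forall_eq 0 fun x => ?_
      obtain ⟨y, rfl⟩ := Ext.covariant_sequence_exact₂ (ModuleCat.of A M) hS x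
        (h.elim _ _)
      exact hzero y
    · refine subsingleton_of_forall_eq 0 fun x => ?_
      obtain ⟨y, rfl⟩ := Ext.covariant_sequence_exact₁ (ModuleCat.of A M) hS x (hzero x) rfl
      have hy : y = 0 := h.elim _ _
      rw [hy, Ext.zero_comp]
  · rintro ⟨h₁, h₂⟩
    refine subsingleton_of_forall_eq 0 fun x => ?_
    obtain ⟨y, rfl⟩ := Ext.covariant_sequence_exact₃ (ModuleCat.of A M) hS x rfl (h₂.elim _ _)
    have hy : y = 0 := h₁.elim _ _
    rw [hy, Ext.zero_comp]

theorem nontrivial_ext_zero_iff :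
    Nontrivial (Ext (ModuleCat.of A M) (ModuleCat.of A Y) 0) ↔ ∃ f : M →ₗ[A] Y, f ≠ 0 := by
  have e : Ext (ModuleCat.of A M) (ModuleCat.of A Y) 0 ≃ (M →ₗ[A] Y) :=
    Ext.addEquiv₀.toEquiv.trans ModuleCat.homAddEquiv.toEquiv
  rw [e.nontrivial_congr, nontrivial_iff_exists_ne 0]

end Step

variable {M : Type u} [AddCommGroup M] [Module A M] [Module Z M] [IsScalarTower Z A M]

/-- Change of rings along a weakly regular sequence annihilating `M`. -/
theorem ext_of_isWeaklyRegular {rs : List Z} (hM : ∀ r ∈ rs, ∀ x : M, r • x = 0)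
    {Y : Type u} [AddCommGroup Y] [Module A Y] [Module Z Y] [IsScalarTower Z A Y]
    (hrs : IsWeaklyRegular Y rs) :
    (∀ i < rs.length, Subsingleton (Ext (ModuleCat.of A M) (ModuleCat.of A Y) i)) ∧
      ∀ {X : Type u} [AddCommGroup X] [Module A X] (π : Y →ₗ[A] X), Function.Surjective π →
        (∀ y, π y = 0 ↔ y ∈ (Ideal.ofList rs • ⊤ : Submodule Z Y)) →
        (Nontrivial (Ext (ModuleCat.of A M) (ModuleCat.of A Y) rs.length) ↔
          ∃ f : M →ₗ[A] X, f ≠ 0) := by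
  induction rs generalizing Y with
  | nil =>
    refine ⟨by simp, fun {X} _ _ π hπ hker => ?_⟩
    have hinj : Function.Injective π := by
      rw [injective_iff_map_eq_zero]
      intro y hy
      simpa using (hker y).mp hy
    let e : Y ≃ₗ[A] X := LinearEquiv.ofBijective π ⟨hinj, hπ⟩
    rw [List.length_nil, nontrivial_ext_zero_iff]
    constructor
    · rintro ⟨f, hf⟩
      exact ⟨e.toLinearMap ∘ₗ f, fun h => hf (by
        ext x; exact e.injective (by simpa using! LinearMap.congr_fun h x))⟩
    · rintro ⟨f, hf⟩
      exact ⟨e.symm.toLinearMap ∘ₗ f, fun h => hf (by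
        ext x; exact e.symm.injective (by simpa using! LinearMap.congr_fun h x))⟩
  | cons z rs ih =>
    rw [isWeaklyRegular_cons_iff] at hrs
    have hz : ∀ x : M, z • x = 0 := hM z (by simp)
    obtain ⟨ih₁, ih₂⟩ := ih (fun r hr => hM r (by simp [hr]))
      (Y := Y ⧸ z • (⊤ : Submodule A Y))
      (((quotSMulTopEquiv Z A Y z).isWeaklyRegular_congr rs).mp hrs.2)
    have h₁ : ∀ i < (z :: rs).length,
        Subsingleton (Ext (ModuleCat.of A M) (ModuleCat.of A Y) i) := by
      intro i hi
      cases i with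
      | zero =>
        rw [← not_nontrivial_iff_subsingleton, nontrivial_ext_zero_iff]
        rintro ⟨f, hf⟩
        refine hf (LinearMap.ext fun x => hrs.1 ?_)
        have h := LinearMap.map_smul_of_tower f z x
        rw [hz, map_zero] at h
        simpa using h.symm
      | succ i => exact ((ext_step hz hrs.1 i).mp (ih₁ i (by simpa using hi))).2
    refine ⟨h₁, fun {X} _ _ π hπ hker => ?_⟩
    -- The target X is known only through the kernel of π, so that it can serve both as a quotient
    -- of Y and, in the induction, as a quotient of Y/zY.
    have hle : z • (⊤ : Submodule A Y) ≤ LinearMap.ker π := by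
      intro y hy
      rw [LinearMap.mem_ker, hker, Ideal.ofList_cons_smul]
      obtain ⟨w, -, rfl⟩ := (Submodule.mem_smul_pointwise_iff_exists _ _ _).mp hy
      exact Submodule.mem_sup_left (Submodule.smul_mem_pointwise_smul _ _ _ trivial)
    have h₂ := ih₂ (Submodule.liftQ _ π hle)
      (fun x => let ⟨y, hy⟩ := hπ x; ⟨Submodule.Quotient.mk y, by simpa using hy⟩) (by
        intro y
        obtain ⟨y, rfl⟩ := Submodule.Quotient.mk_surjective _ y
        rw [Submodule.liftQ_apply, hker, Ideal.ofList_cons_smul]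
        let μ : Y →ₗ[Z] Y ⧸ z • (⊤ : Submodule A Y) :=
          ((z • (⊤ : Submodule A Y)).mkQ).restrictScalars Z
        have hμ : LinearMap.range μ = ⊤ :=
          LinearMap.range_eq_top.mpr (Submodule.mkQ_surjective (z • (⊤ : Submodule A Y)))
        have hμk : LinearMap.ker μ = z • (⊤ : Submodule Z Y) := by
          ext w
          rw [LinearMap.mem_ker]
          change Submodule.Quotient.mk w = 0 ↔ _
          rw [Submodule.Quotient.mk_eq_zero]
          simp [Submodule.mem_smul_pointwise_iff_exists]
        have hmap : Submodule.map μ (Ideal.ofList rs • (⊤ : Submodule Z Y)) =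
            Ideal.ofList rs • ⊤ := by
          rw [Submodule.map_smul'', Submodule.map_top, hμ]
        rw [← hmap, ← hμk, sup_comm, ← Submodule.comap_map_eq]
        exact Iff.rfl)
    rw [← h₂, ← not_iff_not, not_nontrivial_iff_subsingleton, not_nontrivial_iff_subsingleton,
      ext_step hz hrs.1, List.length_cons]
    exact ⟨fun h => ⟨h₁ _ (by simp), h⟩, fun h => h.2⟩

end Rees

/-! ### Exchange property of regular sequences -/

section Exchange

variable {Z : Type u} [CommRing Z] [IsNoetherianRing Z]
  {Y : Type u} [AddCommGroup Y] [Module Z Y] [Module.Finite Z Y]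

/-- A weakly regular sequence in `I` that is shorter than another one can be extended. -/
theorem exists_isSMulRegular_of_length_lt {I : Ideal Z} {rs ss : List Z}
    (hrs : IsWeaklyRegular Y rs) (hrI : ∀ r ∈ rs, r ∈ I)
    (hss : IsWeaklyRegular Y ss) (hsI : ∀ s ∈ ss, s ∈ I) (hlt : rs.length < ss.length) :
    ∃ x ∈ I, IsSMulRegular (Y ⧸ (Ideal.ofList rs • ⊤ : Submodule Z Y)) x := by
  by_contra! h
  -- If no element of I is regular on Y/(rs)Y, then I lies in an associated prime, so Z/I maps
  -- nontrivially to Y/(rs)Y and Ext^|rs|(Z/I, Y) ≠ 0. The longer sequence ss forces the same group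
  -- to vanish.
  obtain ⟨p, hp, hIp⟩ := exists_le_associatedPrime_of_forall_not_isSMulRegular h
  have hkill : ∀ {ts : List Z}, (∀ t ∈ ts, t ∈ I) → ∀ t ∈ ts, ∀ x : Z ⧸ I, t • x = 0 := by
    intro ts hts t ht x
    obtain ⟨x, rfl⟩ := Ideal.Quotient.mk_surjective x
    rw [Algebra.smul_def, Ideal.Quotient.algebraMap_eq, Ideal.Quotient.eq_zero_iff_mem.mpr (hts t ht),
      zero_mul]
  have hsub := (ext_of_isWeaklyRegular (A := Z) (hkill hsI) hss).1 _ hlt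
  refine not_nontrivial_iff_subsingleton.mpr hsub
    (((ext_of_isWeaklyRegular (A := Z) (hkill hrI) hrs).2
      (Submodule.mkQ (Ideal.ofList rs • ⊤ : Submodule Z Y)) (Submodule.mkQ_surjective _)
      (fun y => by simp)).mpr ?_)
  obtain ⟨hprime, x, hx⟩ := isAssociatedPrime_iff.mp hp
  refine ⟨Submodule.liftQ I (LinearMap.toSpanSingleton Z _ x) fun a ha => ?_, fun h0 => ?_⟩
  · have := hIp ha
    rw [hx, Submodule.mem_colon_singleton] at this
    simpa using this
  · have h1 := LinearMap.congr_fun h0 (Submodule.Quotient.mk 1)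
    rw [Submodule.liftQ_apply] at h1
    refine hprime.ne_top (Ideal.eq_top_of_isUnit_mem _ (?_ : (1 : Z) ∈ p) isUnit_one)
    rw [hx, Submodule.mem_colon_singleton]
    simpa using h1

end Exchange

/-! ### The A-submodule I Y -/

section IdealSMulTop

variable {Z : Type*} [CommRing Z] (A : Type*) [Ring A] [Algebra Z A] (I : Ideal Z)
  (Y : Type*) [AddCommGroup Y] [Module A Y] [Module Z Y] [IsScalarTower Z A Y]

/-- The `A`-submodule `I Y` of an `A`-module `Y`, for an ideal `I` of central scalars. -/
def idealSMulTop : Submodule A Y where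
  __ := (I • ⊤ : Submodule Z Y).toAddSubmonoid
  smul_mem' a _ hy := Submodule.smul_top_le_comap_smul_top I (Algebra.lsmul Z Z Y a) hy

variable {A I Y}

theorem mem_idealSMulTop {y : Y} : y ∈ idealSMulTop A I Y ↔ y ∈ (I • ⊤ : Submodule Z Y) := Iff.rfl

variable (A I Y)

/-- The quotient by `I Y`, computed over `Z` or over `A`. -/
def idealSMulTopQuotEquiv : (Y ⧸ (I • ⊤ : Submodule Z Y)) ≃ₗ[Z] Y ⧸ idealSMulTop A I Y :=
  Submodule.Quotient.restrictScalarsEquiv Z (idealSMulTop A I Y)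

end IdealSMulTop

/-! ### Grades from regular sequences -/

section ExtGrade

open CategoryTheory Abelian

variable {Z A : Type u} [CommRing Z] [Ring A] [Algebra Z A]
  {M Y : Type u} [AddCommGroup M] [Module A M] [Module Z M] [IsScalarTower Z A M]
  [AddCommGroup Y] [Module A Y] [Module Z Y] [IsScalarTower Z A Y]

omit [Algebra Z A] [Module Z M] [IsScalarTower Z A M] [Module Z Y] [IsScalarTower Z A Y] in
theorem natCast_le_extGrade_iff {n : ℕ} :
    (n : ℕ∞) ≤ extGrade A M Y ↔
      ∀ i < n, Subsingleton (Ext (ModuleCat.of A M) (ModuleCat.of A Y) i) := by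
  rw [extGrade, le_iInf₂_iff]
  refine forall_congr' fun i => ?_
  rw [← not_nontrivial_iff_subsingleton]
  constructor
  · intro h hi hn
    have := h hn
    norm_cast at this
    omega
  · intro h hn
    norm_cast
    by_contra! hlt
    exact h hlt hn

theorem length_le_extGrade {rs : List Z} (hM : ∀ r ∈ rs, ∀ x : M, r • x = 0)
    (hrs : IsWeaklyRegular Y rs) : (rs.length : ℕ∞) ≤ extGrade A M Y :=
  natCast_le_extGrade_iff.mpr (ext_of_isWeaklyRegular hM hrs).1

theorem nontrivial_ext_length_iff {rs : List Z} (hM : ∀ r ∈ rs, ∀ x : M, r • x = 0)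
    (hrs : IsWeaklyRegular Y rs) :
    Nontrivial (Ext (ModuleCat.of A M) (ModuleCat.of A Y) rs.length) ↔
      ∃ f : M →ₗ[A] Y ⧸ idealSMulTop A (Ideal.ofList rs) Y, f ≠ 0 :=
  (ext_of_isWeaklyRegular hM hrs).2 (Submodule.mkQ _) (Submodule.mkQ_surjective _)
    fun y => by simp [mem_idealSMulTop]

/-- Ext vanishes below degree |rs|, and change of rings identifies nonvanishing in that degree with
the existence of a nonzero homomorphism. Below, this turns statements about grades into statements
about homomorphisms. -/
theorem extGrade_eq_length_iff {rs : List Z} (hM : ∀ r ∈ rs, ∀ x : M, r • x = 0)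
    (hrs : IsWeaklyRegular Y rs) :
    extGrade A M Y = rs.length ↔ ∃ f : M →ₗ[A] Y ⧸ idealSMulTop A (Ideal.ofList rs) Y, f ≠ 0 := by
  rw [← nontrivial_ext_length_iff hM hrs]
  constructor
  · intro h
    by_contra hn
    rw [not_nontrivial_iff_subsingleton] at hn
    have : ((rs.length + 1 : ℕ) : ℕ∞) ≤ extGrade A M Y := natCast_le_extGrade_iff.mpr fun i hi => by
      rcases Nat.lt_succ_iff_lt_or_eq.mp hi with hi | rfl
      · exact (ext_of_isWeaklyRegular hM hrs).1 i hi
      · exact hn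
    rw [h] at this
    norm_cast at this
    omega
  · intro h
    exact le_antisymm (iInf₂_le (f := fun (i : ℕ) (_ : Nontrivial (Ext (ModuleCat.of A M)
      (ModuleCat.of A Y) i)) => (i : ℕ∞)) _ h) (length_le_extGrade hM hrs)

theorem length_add_one_le_extGrade {rs : List Z} (hM : ∀ r ∈ rs, ∀ x : M, r • x = 0)
    (hrs : IsWeaklyRegular Y rs)
    (h : ¬ ∃ f : M →ₗ[A] Y ⧸ idealSMulTop A (Ideal.ofList rs) Y, f ≠ 0) :
    (rs.length : ℕ∞) + 1 ≤ extGrade A M Y :=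
  Order.add_one_le_of_lt (lt_of_le_of_ne (length_le_extGrade hM hrs)
    fun he => h ((extGrade_eq_length_iff hM hrs).mp he.symm))

end ExtGrade

/-! ### Modules of uniform depth -/

section Depth

variable {Z : Type u} [CommRing Z] [IsNoetherianRing Z]
  {Y : Type u} [AddCommGroup Y] [Module Z Y] [Module.Finite Z Y]

variable (Z Y) in
/-- Every maximal ideal of `Z` contains a weakly regular sequence of length `d` on `Y`. -/
def HasDepth (d : ℕ) : Prop :=
  ∀ m : Ideal Z, m.IsMaximal →
    ∃ rs : List Z, rs.length = d ∧ (∀ r ∈ rs, r ∈ m) ∧ IsWeaklyRegular Y rs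

/-- The exchange property appends elements of I to rs until it is as long as ss; the appended part
is regular on the quotient. -/
theorem exists_isWeaklyRegular_quotient {I : Ideal Z} {ss : List Z} (hss : IsWeaklyRegular Y ss)
    (hsI : ∀ s ∈ ss, s ∈ I) {rs : List Z} (hrs : IsWeaklyRegular Y rs) (hrI : ∀ r ∈ rs, r ∈ I) :
    ∃ ts : List Z, ss.length ≤ rs.length + ts.length ∧ (∀ t ∈ ts, t ∈ I) ∧
      IsWeaklyRegular (Y ⧸ (Ideal.ofList rs • ⊤ : Submodule Z Y)) ts := by
  suffices ∀ n, n + rs.length ≤ ss.length → ∃ ts : List Z, ts.length = n ∧ (∀ t ∈ ts, t ∈ I) ∧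
      IsWeaklyRegular Y (rs ++ ts) by
    by_cases h : ss.length ≤ rs.length
    · exact ⟨[], by simpa using h, by simp, by simp⟩
    · obtain ⟨ts, h₁, h₂, h₃⟩ := this (ss.length - rs.length) (by omega)
      exact ⟨ts, by omega, h₂, ((isWeaklyRegular_append_iff Y rs ts).mp h₃).2⟩
  intro n
  induction n with
  | zero => exact fun _ => ⟨[], rfl, by simp, by simpa using hrs⟩
  | succ n ih =>
    intro hn
    obtain ⟨ts, h₁, h₂, h₃⟩ := ih (by omega)
    have hmem : ∀ r ∈ rs ++ ts, r ∈ I := fun r hr =>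
      (List.mem_append.mp hr).elim (hrI r) (h₂ r)
    obtain ⟨x, hxI, hx⟩ := exists_isSMulRegular_of_length_lt h₃ hmem hss hsI
      (by simp only [List.length_append]; omega)
    refine ⟨ts ++ [x], by simp [h₁], ?_, ?_⟩
    · intro t ht
      rcases List.mem_append.mp ht with ht | ht
      · exact h₂ t ht
      · rw [List.mem_singleton.mp ht]; exact hxI
    · rw [← List.append_assoc, isWeaklyRegular_append_iff]
      exact ⟨h₃, (isWeaklyRegular_singleton_iff _ x).mpr hx⟩

omit [IsNoetherianRing Z] [Module.Finite Z Y] in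
theorem ofList_le_annihilator_quotient (rs : List Z) :
    Ideal.ofList rs ≤ Module.annihilator Z (Y ⧸ (Ideal.ofList rs • ⊤ : Submodule Z Y)) := by
  intro a ha
  rw [Module.mem_annihilator]
  intro y
  obtain ⟨y, rfl⟩ := Submodule.Quotient.mk_surjective _ y
  rw [← Submodule.Quotient.mk_smul, Submodule.Quotient.mk_eq_zero]
  exact Submodule.smul_mem_smul ha trivial

theorem HasDepth.exists_ltSeries {d : ℕ} (hd : HasDepth Z Y d) {rs : List Z}
    (hrs : IsWeaklyRegular Y rs) {p m : PrimeSpectrum Z} (hm : m.asIdeal.IsMaximal)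
    (hp : p.asIdeal ∈ associatedPrimes Z (Y ⧸ (Ideal.ofList rs • ⊤ : Submodule Z Y)))
    (hpm : p ≤ m) :
    ∃ l : LTSeries (PrimeSpectrum Z), l.head = p ∧ l.last ≤ m ∧ d ≤ rs.length + l.length := by
  obtain ⟨ss, rfl, hsm, hss⟩ := hd m.asIdeal hm
  have hrm : ∀ r ∈ rs, r ∈ m.asIdeal := fun r hr => hpm
    (annihilator_le_of_mem_associatedPrimes hp (ofList_le_annihilator_quotient rs
      (Ideal.subset_span hr)))
  obtain ⟨ts, hlen, htm, hts⟩ := exists_isWeaklyRegular_quotient hss hsm hrs hrm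
  obtain ⟨l, h₁, h₂, h₃⟩ := exists_ltSeries_of_isWeaklyRegular hp hpm htm hts
  exact ⟨l, h₁, h₂, by rw [h₃]; exact hlen⟩

/-- An unmixedness statement: every associated prime of Y/(rs)Y, embedded or not, has dimension at
least d - |rs|. The part of a sequence that remains regular on the quotient produces a chain of
primes above it. -/
theorem HasDepth.le_length_add_coheight {d : ℕ} (hd : HasDepth Z Y d) {rs : List Z}
    (hrs : IsWeaklyRegular Y rs) {p : PrimeSpectrum Z}
    (hp : p.asIdeal ∈ associatedPrimes Z (Y ⧸ (Ideal.ofList rs • ⊤ : Submodule Z Y))) :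
    (d : ℕ∞) ≤ rs.length + Order.coheight p := by
  obtain ⟨m, hm, hpm⟩ := Ideal.exists_le_maximal p.asIdeal p.isPrime.ne_top
  obtain ⟨l, rfl, -, hl⟩ := hd.exists_ltSeries hrs (m := ⟨m, hm.isPrime⟩) hm hp hpm
  calc (d : ℕ∞) ≤ ((rs.length + l.length : ℕ) : ℕ∞) := by exact_mod_cast hl
    _ ≤ _ := by
      push_cast
      gcongr
      exact Order.length_le_coheight_head

omit [IsNoetherianRing Z] in
theorem mem_support_quotient_ofList (hY : Module.annihilator Z Y = ⊥) {rs : List Z}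
    {p : PrimeSpectrum Z} :
    p ∈ Module.support Z (Y ⧸ (Ideal.ofList rs • ⊤ : Submodule Z Y)) ↔ ∀ r ∈ rs, r ∈ p.asIdeal := by
  rw [Module.support_quotient]
  constructor
  · rintro ⟨-, h⟩ r hr
    exact h (Ideal.subset_span hr)
  · intro h
    refine ⟨Module.mem_support_iff_of_finite.mpr (by simp [hY]), ?_⟩
    rw [PrimeSpectrum.mem_zeroLocus]
    exact Ideal.span_le.mpr h

omit [IsNoetherianRing Z] in
theorem supportDim_eq_ringKrullDim_of_annihilator_eq_bot (hY : Module.annihilator Z Y = ⊥) :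
    Module.supportDim Z Y = ringKrullDim Z := by
  have : Module.support Z Y = Set.univ := by
    ext p
    simp [Module.mem_support_iff_of_finite, hY]
  rw [Module.supportDim, this, ringKrullDim]
  exact Order.krullDim_eq_of_orderIso OrderIso.Set.univ

/-- On a module of depth `d = dim Z` at all maximal ideals, the grade of the annihilator of a
module of dimension `k` is `d - k`. -/
theorem HasDepth.exists_isWeaklyRegular_annihilator {d : ℕ} (hd : HasDepth Z Y d)
    (hdim : ringKrullDim Z = d) (hY : Module.annihilator Z Y = ⊥)
    {M : Type*} [AddCommGroup M] [Module Z M] [Module.Finite Z M] {k : ℕ}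
    (hk : Module.supportDim Z M = k) :
    ∃ rs : List Z, (∀ r ∈ rs, r ∈ Module.annihilator Z M) ∧ IsWeaklyRegular Y rs ∧
      rs.length + k = d ∧ ∃ p ∈ associatedPrimes Z (Y ⧸ (Ideal.ofList rs • ⊤ : Submodule Z Y)),
        Module.annihilator Z M ≤ p := by
  -- The support of M lies in that of Y/(rs)Y, whose dimension is at most d - |rs|.
  have bound : ∀ rs : List Z, (∀ r ∈ rs, r ∈ Module.annihilator Z M) → IsWeaklyRegular Y rs →
      rs.length + k ≤ d := by
    intro rs hrM hrs
    obtain ⟨p, hp, hpk⟩ := natCast_le_supportDim_iff.mp hk.ge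
    have hpY := (mem_support_quotient_ofList hY (rs := rs)).mpr
      fun r hr => Module.mem_support_iff_of_finite.mp hp (hrM r hr)
    have h₁ : (k : WithBot ℕ∞) ≤ _ := natCast_le_supportDim_iff.mpr ⟨p, hpY, hpk⟩
    have h₂ := supportDim_quotient_ofList_add_length_le hrs
    rw [supportDim_eq_ringKrullDim_of_annihilator_eq_bot hY, hdim] at h₂
    have h₃ := (add_le_add_left h₁ (rs.length : WithBot ℕ∞)).trans h₂
    norm_cast at h₃
    omega
  -- By the bound, a sequence of maximal length in the annihilator of M exists.
  obtain ⟨n, ⟨rs, rfl, hrM, hrs⟩, hmax⟩ : ∃ n, (∃ rs : List Z, rs.length = n ∧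
      (∀ r ∈ rs, r ∈ Module.annihilator Z M) ∧ IsWeaklyRegular Y rs) ∧
      ¬ ∃ rs : List Z, rs.length = n + 1 ∧
        (∀ r ∈ rs, r ∈ Module.annihilator Z M) ∧ IsWeaklyRegular Y rs := by
    by_contra! hcon
    have : ∀ n, ∃ rs : List Z, rs.length = n ∧
        (∀ r ∈ rs, r ∈ Module.annihilator Z M) ∧ IsWeaklyRegular Y rs := by
      intro n
      induction n with
      | zero => exact ⟨[], rfl, by simp, by simp⟩
      | succ n ih => exact hcon n ih
    obtain ⟨rs, hlen, h₁, h₂⟩ := this (d + 1)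
    have := bound rs h₁ h₂
    omega
  obtain ⟨p, hp, hMp⟩ : ∃ p ∈ associatedPrimes Z (Y ⧸ (Ideal.ofList rs • ⊤ : Submodule Z Y)),
      Module.annihilator Z M ≤ p := by
    refine exists_le_associatedPrime_of_forall_not_isSMulRegular fun x hxM hx => hmax ?_
    refine ⟨rs ++ [x], by simp, ?_, ?_⟩
    · intro t ht
      rcases List.mem_append.mp ht with ht | ht
      · exact hrM t ht
      · rw [List.mem_singleton.mp ht]; exact hxM
    · exact (isWeaklyRegular_append_iff Y rs [x]).mpr
        ⟨hrs, (isWeaklyRegular_singleton_iff _ x).mpr hx⟩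
  refine ⟨rs, hrM, hrs, le_antisymm (bound rs hrM hrs) ?_, p, hp, hMp⟩
  -- By maximality the annihilator of M lies in an associated prime p of Y/(rs)Y. Unmixedness gives
  -- d - |rs| ≤ dim Z/p, and p lies in the support of M, so dim Z/p ≤ k.
  have h₁ := hd.le_length_add_coheight hrs (p := ⟨p, hp.isPrime⟩) hp
  have h₂ := coheight_le_supportDim (M := M) (p := ⟨p, hp.isPrime⟩)
    (Module.mem_support_iff_of_finite.mpr hMp)
  rw [hk] at h₂
  have h₃ : Order.coheight (⟨p, hp.isPrime⟩ : PrimeSpectrum Z) ≤ (k : ℕ∞) :=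
    WithBot.coe_le_coe.mp h₂
  have h₄ : (d : ℕ∞) ≤ rs.length + k := h₁.trans (by gcongr)
  exact_mod_cast h₄

end Depth

/-! ### The grade formula as depth together with homomorphisms -/

section KrullMacaulay

variable (Z : Type u) [CommRing Z] [IsNoetherianRing Z] (A : Type u) [Ring A] [Algebra Z A]
  [Module.Finite Z A]
  (Y : Type u) [AddCommGroup Y] [Module A Y] [Module Z Y] [IsScalarTower Z A Y] [Module.Finite Z Y]

/-- The modules `M` for which the associated primes of `Y / (rs) Y` permit a nonzero homomorphism
to `Y / (rs) Y` have one. -/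
def HasEnoughHoms : Prop :=
  ∀ (M : Type u) [AddCommGroup M] [Module A M] [Module Z M] [IsScalarTower Z A M],
    Module.Finite A M → ∀ rs : List Z, (∀ r ∈ rs, r ∈ Module.annihilator Z M) →
      IsWeaklyRegular Y rs →
      ∀ p ∈ associatedPrimes Z (Y ⧸ (Ideal.ofList rs • ⊤ : Submodule Z Y)),
        Module.annihilator Z M ≤ p →
          ∃ f : M →ₗ[A] Y ⧸ idealSMulTop A (Ideal.ofList rs) Y, f ≠ 0

/-- The equality of dimensions that defines Krull-Macaulay rings, on one side. -/
def HasGradeFormula (A : Type u) [Ring A] (Y : Type u) [AddCommGroup Y] [Module A Y] : Prop :=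
  ∀ (M : Type u) [AddCommGroup M] [Module A M], Module.Finite A M → Nontrivial M →
    Kdim A Y = Kdim A M + (extGrade A M Y : WithBot ℕ∞)

variable {Z A Y}

omit [IsNoetherianRing Z] in
theorem exists_supportDim_eq_natCast {d : ℕ} (hdim : ringKrullDim Z = d) {M : Type*}
    [AddCommGroup M] [Module Z M] [Nontrivial M] : ∃ k : ℕ, Module.supportDim Z M = k := by
  obtain ⟨k, hk⟩ := WithBot.ne_bot_iff_exists.mp (Module.supportDim_ne_bot_of_nontrivial Z M)
  have h := Module.supportDim_le_ringKrullDim Z M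
  rw [hdim, ← hk] at h
  have h' : k ≤ (d : ℕ∞) := WithBot.coe_le_coe.mp h
  obtain ⟨n, rfl⟩ := ENat.ne_top_iff_exists.mp (ne_top_of_le_ne_top (ENat.natCast_ne_top d) h')
  exact ⟨n, hk.symm⟩

/-- A maximal regular sequence in the annihilator of M has length d - dim M, and enough
homomorphisms make its length equal to the grade of M. -/
theorem hasGradeFormula_of_hasDepth {d : ℕ} (hdim : ringKrullDim Z = d)
    (hY : Module.annihilator Z Y = ⊥) (hd : HasDepth Z Y d) (hom : HasEnoughHoms Z A Y) :
    HasGradeFormula A Y := by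
  intro M _ _ hM _
  let _ : Module Z M := Module.compHom M (algebraMap Z A)
  have : IsScalarTower Z A M := IsScalarTower.of_algebraMap_smul fun _ _ => rfl
  have : Module.Finite Z M := Module.Finite.trans A M
  obtain ⟨k, hk⟩ := exists_supportDim_eq_natCast hdim (M := M)
  obtain ⟨rs, hrM, hrs, hlen, p, hp, hMp⟩ := hd.exists_isWeaklyRegular_annihilator hdim hY hk
  have := (extGrade_eq_length_iff (A := A) (fun r hr => Module.mem_annihilator.mp (hrM r hr))
    hrs).mpr (hom M hM rs hrM hrs p hp hMp)
  rw [this, kdim_eq_supportDim Z, kdim_eq_supportDim Z, hk,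
    supportDim_eq_ringKrullDim_of_annihilator_eq_bot hY, hdim, ← hlen]
  push_cast
  exact add_comm _ _

/-- The module A/mA has dimension 0, hence grade d. If a regular sequence rs in m with |rs| < d
could not be extended inside m, then Y/(rs)Y would contain a nonzero element killed by m; this gives
a nonzero map from A/mA and forces its grade down to |rs|. -/
theorem HasGradeFormula.hasDepth (h : HasGradeFormula A Y) {d : ℕ} (hdim : ringKrullDim Z = d)
    (hY : Module.annihilator Z Y = ⊥) : HasDepth Z Y d := by
  intro m hm
  have hA : Module.annihilator Z A = ⊥ := by
    rw [eq_bot_iff, ← hY]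
    intro z hz
    rw [Module.mem_annihilator] at hz ⊢
    intro y
    rw [← one_smul A y, ← smul_assoc, hz, zero_smul]
  let M := A ⧸ idealSMulTop A m A
  have hmM : m ≤ Module.annihilator Z M := by
    intro a ha
    rw [Module.mem_annihilator]
    intro y
    obtain ⟨y, rfl⟩ := Submodule.Quotient.mk_surjective _ y
    rw [← Submodule.Quotient.mk_smul, Submodule.Quotient.mk_eq_zero, mem_idealSMulTop]
    exact Submodule.smul_mem_smul ha trivial
  have : Module.Finite Z M := Module.Finite.trans A M
  -- Faithfulness of A over Z puts m into the support of A/mA; maximality of m excludes every other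
  -- prime.
  have hsupp : ∀ p, p ∈ Module.support Z M ↔ p = ⟨m, hm.isPrime⟩ := by
    intro p
    rw [← (idealSMulTopQuotEquiv A m A).support_eq, Module.support_quotient]
    constructor
    · rintro ⟨-, hp⟩
      exact PrimeSpectrum.ext (hm.eq_of_le p.isPrime.ne_top hp).symm
    · rintro rfl
      exact ⟨Module.mem_support_iff_of_finite.mpr (by simp [hA]),
        (PrimeSpectrum.mem_zeroLocus _ _).mpr fun _ h => h⟩
  have : Nontrivial M := Module.nonempty_support_iff.mp ⟨_, (hsupp _).mpr rfl⟩
  have hM0 : Module.supportDim Z M = 0 := by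
    obtain ⟨k, hk⟩ := exists_supportDim_eq_natCast hdim (M := M)
    obtain ⟨p, hp, hpk⟩ := natCast_le_supportDim_iff.mp hk.ge
    have hp0 : Order.coheight p = 0 := by
      rw [Order.coheight_eq_zero, (hsupp p).mp hp]
      intro q hq
      exact (hm.eq_of_le q.isPrime.ne_top hq).ge
    rw [hp0] at hpk
    rw [hk]
    simp only [nonpos_iff_eq_zero, Nat.cast_eq_zero] at hpk
    simp [hpk]
  have hgrade : (d : ℕ∞) = extGrade A M Y := by
    have := h M inferInstance inferInstance
    rw [kdim_eq_supportDim Z, kdim_eq_supportDim Z, hM0,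
      supportDim_eq_ringKrullDim_of_annihilator_eq_bot hY, hdim, zero_add] at this
    exact_mod_cast this
  suffices ∀ n ≤ d, ∃ rs : List Z, rs.length = n ∧ (∀ r ∈ rs, r ∈ m) ∧ IsWeaklyRegular Y rs from
    this d le_rfl
  intro n
  induction n with
  | zero => exact fun _ => ⟨[], rfl, by simp, by simp⟩
  | succ n ih =>
    intro hn
    obtain ⟨rs, rfl, hrm, hrs⟩ := ih (by omega)
    have hrM : ∀ r ∈ rs, ∀ x : M, r • x = 0 := fun r hr =>
      Module.mem_annihilator.mp (hmM (hrm r hr))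
    obtain ⟨x, hxm, hx⟩ : ∃ x ∈ m,
        IsSMulRegular (Y ⧸ (Ideal.ofList rs • ⊤ : Submodule Z Y)) x := by
      by_contra! hcon
      obtain ⟨p, hp, hmp⟩ := exists_le_associatedPrime_of_forall_not_isSMulRegular hcon
      rw [LinearEquiv.AssociatedPrimes.eq (idealSMulTopQuotEquiv A (Ideal.ofList rs) Y)] at hp
      obtain ⟨hprime, x, hx⟩ := isAssociatedPrime_iff.mp hp
      have hpx : ∀ z ∈ p, z • x = 0 := fun z hz => by
        rw [hx, Submodule.mem_colon_singleton] at hz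
        simpa using hz
      have hle : idealSMulTop A m A ≤ LinearMap.ker (LinearMap.toSpanSingleton A _ x) := by
        intro a ha
        rw [mem_idealSMulTop] at ha
        refine Submodule.smul_induction_on ha (fun z hz a _ => ?_)
          fun a b ha hb => Submodule.add_mem _ ha hb
        rw [LinearMap.mem_ker, LinearMap.toSpanSingleton_apply, smul_assoc, smul_comm,
          hpx z (hmp hz), smul_zero]
      have hne : ∃ f : M →ₗ[A] Y ⧸ idealSMulTop A (Ideal.ofList rs) Y, f ≠ 0 := by
        refine ⟨Submodule.liftQ _ _ hle, fun h0 => ?_⟩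
        have h1 := LinearMap.congr_fun h0 (Submodule.Quotient.mk 1)
        rw [Submodule.liftQ_apply] at h1
        refine hprime.ne_top (Ideal.eq_top_of_isUnit_mem _ (?_ : (1 : Z) ∈ p) isUnit_one)
        rw [hx, Submodule.mem_colon_singleton]
        simpa using h1
      rw [← extGrade_eq_length_iff hrM hrs, ← hgrade] at hne
      norm_cast at hne
      omega
    refine ⟨rs ++ [x], by simp, ?_, ?_⟩
    · intro t ht
      rcases List.mem_append.mp ht with ht | ht
      · exact hrm t ht
      · rw [List.mem_singleton.mp ht]; exact hxm
    · exact (isWeaklyRegular_append_iff Y rs [x]).mpr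
        ⟨hrs, (isWeaklyRegular_singleton_iff _ x).mpr hx⟩

/-- Without a nonzero map the grade of M exceeds |rs|. Since p lies in the support of M, unmixedness
gives dim M ≥ d - |rs|, so dimension and grade would add up to more than d. -/
theorem HasGradeFormula.hasEnoughHoms (h : HasGradeFormula A Y) {d : ℕ}
    (hdim : ringKrullDim Z = d) (hY : Module.annihilator Z Y = ⊥) : HasEnoughHoms Z A Y := by
  intro M _ _ _ _ hM rs hrM hrs p hp hMp
  by_contra hcon
  have hd := h.hasDepth hdim hY
  have : Module.Finite Z M := Module.Finite.trans A M
  have hpM : (⟨p, hp.isPrime⟩ : PrimeSpectrum Z) ∈ Module.support Z M :=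
    Module.mem_support_iff_of_finite.mpr hMp
  have : Nontrivial M := Module.nonempty_support_iff.mp ⟨_, hpM⟩
  have h₁ := length_add_one_le_extGrade (A := A)
    (fun r hr => Module.mem_annihilator.mp (hrM r hr)) hrs hcon
  have h₂ := hd.le_length_add_coheight hrs (p := ⟨p, hp.isPrime⟩) hp
  have h₃ := coheight_le_supportDim hpM
  obtain ⟨k, hk⟩ := exists_supportDim_eq_natCast hdim (M := M)
  have h₄ := h M hM inferInstance
  rw [kdim_eq_supportDim Z, kdim_eq_supportDim Z, hk,
    supportDim_eq_ringKrullDim_of_annihilator_eq_bot hY, hdim] at h₄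
  have h₅ : (d : ℕ∞) = k + extGrade A M Y := by exact_mod_cast h₄
  rw [hk] at h₃
  have h₆ : Order.coheight (⟨p, hp.isPrime⟩ : PrimeSpectrum Z) ≤ (k : ℕ∞) :=
    WithBot.coe_le_coe.mp h₃
  have h₇ : (d : ℕ∞) ≤ rs.length + k := h₂.trans (by gcongr)
  have h₈ : ((k + (rs.length + 1) : ℕ) : ℕ∞) ≤ d := by
    rw [h₅]
    push_cast
    gcongr
  norm_cast at h₇ h₈
  omega

end KrullMacaulay

/-! ### Enough homomorphisms from grade symmetry -/

section GradeSymmetry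

open scoped TensorProduct

variable {Z A B : Type u} [CommRing Z] [Ring A] [Algebra Z A] [Ring B] [Algebra Z B]

section Tensor

variable (Z A B)
variable (M N : Type u) [AddCommGroup M] [Module A M] [Module Z M] [IsScalarTower Z A M]
  [AddCommGroup N] [Module B N] [Module Z N] [IsScalarTower Z B N]

/-- The action of a `Z`-algebra on the second factor of a tensor product over `Z`. -/
abbrev tensorRightModule : Module B (M ⊗[Z] N) :=
  Module.compHom _
    ((Module.End.lTensorAlgHom Z N M).comp (Algebra.lsmul Z Z N : B →ₐ[Z] Module.End Z N)).toRingHom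

variable {Z A B M N}

theorem tensorRight_smul_tmul (b : B) (x : M) (y : N) :
    letI := tensorRightModule Z B M N
    b • (x ⊗ₜ[Z] y) = x ⊗ₜ[Z] (b • y) := rfl

theorem tensorRight_isScalarTower :
    letI := tensorRightModule Z B M N
    IsScalarTower Z B (M ⊗[Z] N) :=
  letI := tensorRightModule Z B M N
  { smul_assoc := fun z b t => by
      induction t with
      | zero => simp
      | tmul x y => rw [tensorRight_smul_tmul, tensorRight_smul_tmul, smul_assoc,
          TensorProduct.tmul_smul]
      | add s t hs ht => rw [smul_add, smul_add, hs, ht, smul_add] }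

theorem tensorRight_smulCommClass :
    letI := tensorRightModule Z B M N
    SMulCommClass A B (M ⊗[Z] N) :=
  letI := tensorRightModule Z B M N
  { smul_comm := fun a b t => by
      induction t with
      | zero => simp
      | tmul x y => rw [tensorRight_smul_tmul, TensorProduct.smul_tmul', TensorProduct.smul_tmul',
          tensorRight_smul_tmul]
      | add s t hs ht => simp only [smul_add, hs, ht] }

theorem finite_tensor_left [Module.Finite Z M] [Module.Finite Z N] :
    Module.Finite A (M ⊗[Z] N) :=
  Module.Finite.of_restrictScalars_finite Z A _

theorem finite_tensor_right [Module.Finite Z M] [Module.Finite Z N] :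
    letI := tensorRightModule Z B M N
    Module.Finite B (M ⊗[Z] N) :=
  letI := tensorRightModule Z B M N
  have : IsScalarTower Z B (M ⊗[Z] N) := tensorRight_isScalarTower
  Module.Finite.of_restrictScalars_finite Z B _

theorem tensor_algebraMap_smul (z : Z) (t : M ⊗[Z] N) :
    letI := tensorRightModule Z B M N
    algebraMap Z A z • t = algebraMap Z B z • t := by
  let _ := tensorRightModule Z B M N
  have : IsScalarTower Z B (M ⊗[Z] N) := tensorRight_isScalarTower
  change algebraMap Z A z • t = algebraMap Z B z • t
  rw [algebraMap_smul, algebraMap_smul]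

end Tensor

variable (Z A B) in
/-- The grades over `A` and `B` of the tensor products over `Z` of finite `A`- and `B`-modules
agree. -/
def TensorGradeSymmetric (Y : Type u) [AddCommGroup Y] [Module A Y] [Module B Y] : Prop :=
  ∀ (M N : Type u) [AddCommGroup M] [Module A M] [Module Z M] [IsScalarTower Z A M]
    [AddCommGroup N] [Module B N] [Module Z N] [IsScalarTower Z B N],
    Module.Finite A M → Module.Finite B N →
      extGrade A (M ⊗[Z] N) Y = @extGrade B _ (M ⊗[Z] N) Y _ (tensorRightModule Z B M N) _ _

variable {Y : Type u} [AddCommGroup Y] [Module A Y] [Module B Y] [Module Z Y]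
  [IsScalarTower Z A Y] [IsScalarTower Z B Y]

/-- Let N be the B-submodule of Y/(rs)Y killed by p. A nonzero Z-linear map φ from M to Z/p gives
the nonzero B-linear map m ⊗ n ↦ φ(m) n from M ⊗ N to Y/(rs)Y, so the B-grade of M ⊗ N is |rs|. By
symmetry its A-grade is also |rs|, which provides a nonzero A-linear map g from M ⊗ N; then m ↦ g(m
⊗ n) is the required map for some n. -/
theorem TensorGradeSymmetric.hasEnoughHoms [IsNoetherianRing Z] [Module.Finite Z A]
    [Module.Finite Z Y] (h : TensorGradeSymmetric Z A B Y) :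
    HasEnoughHoms Z A Y := by
  intro M _ _ _ _ hM rs hrM hrs p hp hMp
  have : Module.Finite Z M := Module.Finite.trans A M
  let X := Y ⧸ idealSMulTop B (Ideal.ofList rs) Y
  rw [LinearEquiv.AssociatedPrimes.eq (idealSMulTopQuotEquiv B (Ideal.ofList rs) Y)] at hp
  obtain ⟨hprime, x, hx⟩ := isAssociatedPrime_iff.mp hp
  have hx : ∀ z : Z, z ∈ p ↔ z • x = 0 := fun z => by
    rw [hx, Submodule.mem_colon_singleton, Submodule.mem_bot]
  let N : Submodule B X :=
    { carrier := {y | ∀ z ∈ p, z • y = 0}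
      zero_mem' := by simp
      add_mem' := fun ha hb z hz => by rw [smul_add, ha z hz, hb z hz, add_zero]
      smul_mem' := fun b y hy z hz => by rw [smul_comm, hy z hz, smul_zero] }
  have hxN : x ∈ N := fun z hz => (hx z).mp hz
  have : Module.Finite Z X :=
    Module.Finite.equiv (idealSMulTopQuotEquiv B (Ideal.ofList rs) Y)
  have : Module.Finite Z N := inferInstanceAs (Module.Finite Z (N.restrictScalars Z))
  have hN : Module.Finite B N := Module.Finite.of_restrictScalars_finite Z B N
  -- If Hom(M, Z/p) were zero, some element annihilating M would be regular on Z/p, that is, outside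
  -- p; but p contains the annihilator of M.
  obtain ⟨φ, hφ⟩ : ∃ φ : M →ₗ[Z] Z ⧸ p, φ ≠ 0 := by
    by_contra! hcon
    obtain ⟨r, hr, hreg⟩ := IsSMulRegular.subsingleton_linearMap_iff.mp
      (subsingleton_of_forall_eq (0 : M →ₗ[Z] Z ⧸ p) hcon)
    have h1 : r • (1 : Z ⧸ p) = r • 0 := by
      rw [smul_zero, Algebra.smul_def, mul_one]
      exact Ideal.Quotient.eq_zero_iff_mem.mpr (hMp hr)
    have := hreg h1
    rw [← map_one (Ideal.Quotient.mk p), Ideal.Quotient.eq_zero_iff_mem] at this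
    exact hprime.ne_top (Ideal.eq_top_of_isUnit_mem _ this isUnit_one)
  obtain ⟨m₀, hm₀⟩ : ∃ m, φ m ≠ 0 := by
    by_contra! hcon
    exact hφ (LinearMap.ext hcon)
  let act : Z ⧸ p →ₗ[Z] N →ₗ[Z] N :=
    Submodule.liftQ (M₂ := N →ₗ[Z] N) (τ₁₂ := RingHom.id Z) p (LinearMap.lsmul Z N) fun z hz =>
      LinearMap.ext fun y => Subtype.ext (y.2 z hz)
  have hact : ∀ z : Z, ∀ y : N, act (Submodule.Quotient.mk z) y = z • y := fun z y => rfl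
  have hact_smul : ∀ (w : Z ⧸ p) (b : B) (y : N), act w (b • y) = b • act w y := by
    intro w b y
    obtain ⟨z, rfl⟩ := Submodule.Quotient.mk_surjective _ w
    rw [hact, hact, smul_comm]
  let _ := tensorRightModule Z B M N
  have : IsScalarTower Z B (M ⊗[Z] N) := tensorRight_isScalarTower
  let ψ₀ : M ⊗[Z] N →ₗ[Z] N := TensorProduct.lift (act ∘ₗ φ)
  let ψ : M ⊗[Z] N →ₗ[B] X :=
    { toFun := fun t => (ψ₀ t : X)
      map_add' := fun s t => by simp
      map_smul' := fun b t => by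
        rw [RingHom.id_apply, ← Submodule.coe_smul]
        congr 1
        induction t with
        | zero => simp
        | tmul m n =>
          rw [tensorRight_smul_tmul, TensorProduct.lift.tmul, TensorProduct.lift.tmul]
          exact hact_smul _ _ _
        | add s t hs ht => rw [smul_add, map_add, map_add, smul_add, hs, ht] }
  have hψ : ψ ≠ 0 := by
    -- x has annihilator exactly p, so a nonzero scalar φ(m₀) of Z/p does not kill it.
    intro h0
    have h1 : ((act (φ m₀) ⟨x, hxN⟩ : N) : X) = 0 := LinearMap.congr_fun h0 (m₀ ⊗ₜ ⟨x, hxN⟩)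
    obtain ⟨z, hz⟩ := Submodule.Quotient.mk_surjective _ (φ m₀)
    rw [← hz, hact] at h1
    refine hm₀ ?_
    rw [← hz]
    exact Ideal.Quotient.eq_zero_iff_mem.mpr ((hx z).mpr h1)
  have hkill : ∀ r ∈ rs, ∀ t : M ⊗[Z] N, r • t = 0 := by
    intro r hr t
    induction t with
    | zero => simp
    | tmul m n => rw [TensorProduct.smul_tmul', Module.mem_annihilator.mp (hrM r hr),
        TensorProduct.zero_tmul]
    | add s t hs ht => rw [smul_add, hs, ht, add_zero]
  have hB := (extGrade_eq_length_iff (A := B) hkill hrs).mpr ⟨ψ, hψ⟩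
  rw [← h M N hM hN] at hB
  obtain ⟨g, hg⟩ := (extGrade_eq_length_iff (A := A) hkill hrs).mp hB
  obtain ⟨m, n, hmn⟩ : ∃ m n, g (m ⊗ₜ n) ≠ 0 := by
    by_contra! hcon
    refine hg (LinearMap.ext fun t => ?_)
    induction t with
    | zero => simp
    | tmul m n => exact hcon m n
    | add s t hs ht => rw [map_add, hs, ht, map_add]
  refine ⟨{ toFun := fun m => g (m ⊗ₜ n)
            map_add' := fun a b => by rw [TensorProduct.add_tmul, map_add]
            map_smul' := fun a b => by rw [← TensorProduct.smul_tmul', map_smul]; rfl },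
    fun h0 => hmn (LinearMap.congr_fun h0 m)⟩

end GradeSymmetry

/-! ### Specialisation to the centre, on both sides -/

section Center

variable {R : Type u} [Ring R] [Module.Finite (Subring.center R) R]

theorem IsGradeSymmetric.tensorGradeSymmetric_left (h : IsGradeSymmetric R) :
    TensorGradeSymmetric (Subring.center R) R Rᵐᵒᵖ R := by
  intro M N _ _ _ _ _ _ _ _ hM hN
  have : Module.Finite (Subring.center R) M := Module.Finite.trans R M
  have : Module.Finite (Subring.center R) N := Module.Finite.trans Rᵐᵒᵖ N
  exact @h _ _ _ (tensorRightModule (Subring.center R) Rᵐᵒᵖ M N) tensorRight_smulCommClass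
    finite_tensor_left finite_tensor_right fun z hz t =>
      tensor_algebraMap_smul (A := R) (B := Rᵐᵒᵖ) (⟨z, hz⟩ : Subring.center R) t

theorem IsGradeSymmetric.tensorGradeSymmetric_right (h : IsGradeSymmetric R) :
    TensorGradeSymmetric (Subring.center R) Rᵐᵒᵖ R R := by
  intro M N _ _ _ _ _ _ _ _ hM hN
  have : Module.Finite (Subring.center R) M := Module.Finite.trans Rᵐᵒᵖ M
  have : Module.Finite (Subring.center R) N := Module.Finite.trans R N
  let _ := tensorRightModule (Subring.center R) R M N
  have : SMulCommClass Rᵐᵒᵖ R (TensorProduct (Subring.center R) M N) := tensorRight_smulCommClass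
  exact (@h _ _ (tensorRightModule (Subring.center R) R M N) _ (SMulCommClass.symm _ _ _)
    finite_tensor_right finite_tensor_left
    fun z hz t => (tensor_algebraMap_smul (A := Rᵐᵒᵖ) (B := R)
      (⟨z, hz⟩ : Subring.center R) t).symm).symm

end Center

/-! ### Localised algebras -/

section LocalizedAlgebra

variable {Z : Type*} [CommRing Z] (S : Submonoid Z) (R : Type*) [Ring R] [Algebra Z R]

/-- The localisation of a `Z`-algebra as an algebra over the localisation of `Z`. -/
abbrev localizedAlgebra : Algebra (Localization S) (LocalizedModule S R) :=
  Algebra.ofModule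
    (fun x a b => by
      induction x with | _ x
      induction a with | _ a s
      induction b with | _ b t
      rw [LocalizedModule.mk_smul_mk, LocalizedModule.mk_mul_mk, LocalizedModule.mk_mul_mk,
        LocalizedModule.mk_smul_mk, smul_mul_assoc, mul_assoc])
    (fun x a b => by
      induction x with | _ x
      induction a with | _ a s
      induction b with | _ b t
      rw [LocalizedModule.mk_smul_mk, LocalizedModule.mk_mul_mk, LocalizedModule.mk_mul_mk,
        LocalizedModule.mk_smul_mk, mul_smul_comm, mul_left_comm])

end LocalizedAlgebra

/-! ### Prime two-sided ideals and their heights -/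

section PrimeIdeals

variable {R : Type*} [Ring R]

/-- The elements x with x R b ⊆ P form a two-sided ideal I, and those killed by I on the left modulo
P form another one; their product lies in P. -/
theorem IsPrimeIdeal.mem_or_mem {P : TwoSidedIdeal R} (hP : IsPrimeIdeal P) {a b : R}
    (h : ∀ r, a * r * b ∈ P) : a ∈ P ∨ b ∈ P := by
  let I : TwoSidedIdeal R := TwoSidedIdeal.mk' {x | ∀ r, x * r * b ∈ P}
    (fun r => by simp)
    (fun {x y} hx hy r => by rw [add_mul, add_mul]; exact P.add_mem (hx r) (hy r))
    (fun {x} hx r => by rw [neg_mul, neg_mul]; exact P.neg_mem (hx r))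
    (fun {x y} hy r => by rw [mul_assoc, mul_assoc, ← mul_assoc y]; exact P.mul_mem_left _ _ (hy r))
    (fun {x y} hx r => by rw [mul_assoc x]; exact hx _)
  have hI : ∀ x, x ∈ I ↔ ∀ r, x * r * b ∈ P := fun x => by simp [I, TwoSidedIdeal.mem_mk']
  let J : TwoSidedIdeal R := TwoSidedIdeal.mk' {y | ∀ x ∈ I, x * y ∈ P}
    (fun r _ => by simp)
    (fun {x y} hx hy r hr => by rw [mul_add]; exact P.add_mem (hx r hr) (hy r hr))
    (fun {x} hx r hr => by rw [mul_neg]; exact P.neg_mem (hx r hr))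
    (fun {x y} hy r hr => by rw [← mul_assoc]; exact hy _ (I.mul_mem_right _ _ hr))
    (fun {x y} hx r hr => by rw [← mul_assoc]; exact P.mul_mem_right _ _ (hx r hr))
  have hJ : ∀ y, y ∈ J ↔ ∀ x ∈ I, x * y ∈ P := fun y => by simp [J, TwoSidedIdeal.mem_mk']
  rcases hP.le_or_le I J fun x hx y hy => (hJ y).mp hy x hx with h' | h'
  · exact Or.inl (h' ((hI a).mpr h))
  · exact Or.inr (h' ((hJ b).mpr fun x hx => by simpa using (hI x).mp hx 1))

theorem IsPrimeIdeal.mem_or_mem_of_central {P : TwoSidedIdeal R} (hP : IsPrimeIdeal P) {Z : Type*}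
    [CommRing Z] [Algebra Z R] {z : Z} {b : R} (h : algebraMap Z R z * b ∈ P) :
    algebraMap Z R z ∈ P ∨ b ∈ P :=
  hP.mem_or_mem fun r => by
    rw [Algebra.commutes, mul_assoc]
    exact P.mul_mem_left _ _ h

theorem wellFoundedGT_twoSidedIdeal [IsNoetherianRing R] : WellFoundedGT (TwoSidedIdeal R) :=
  StrictMono.wellFoundedGT (f := (TwoSidedIdeal.asIdeal : TwoSidedIdeal R →o Ideal R))
    fun _ _ h => h

/-- Below a prime containing a central element `c`, and above an ideal modulo which `c` is regular,
there is a prime that does not contain `c`. -/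
theorem exists_isPrimeIdeal_lt [IsNoetherianRing R] {J Q : TwoSidedIdeal R} (hQ : IsPrimeIdeal Q)
    (hJQ : J ≤ Q) {c : R} (hc : ∀ r, c * r = r * c) (hcQ : c ∈ Q)
    (hreg : ∀ x, c * x ∈ J → x ∈ J) :
    ∃ P : TwoSidedIdeal R, IsPrimeIdeal P ∧ J ≤ P ∧ P < Q := by
  have := wellFoundedGT_twoSidedIdeal (R := R)
  -- P is maximal among the ideals between J and Q modulo which c is regular. It differs from Q
  -- because it cannot contain c.
  obtain ⟨P, ⟨hJP, hPQ, hsat⟩, hmax⟩ := exists_maximal_of_wellFoundedGT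
    (fun I : TwoSidedIdeal R => J ≤ I ∧ I ≤ Q ∧ ∀ x, c * x ∈ I → x ∈ I) ⟨J, le_rfl, hJQ, hreg⟩
  have hcP : c ∉ P := fun h => hQ.ne_top (by
    rw [← TwoSidedIdeal.one_mem_iff]
    exact hPQ (hsat 1 (by simpa using h)))
  refine ⟨P, ⟨fun h => hcP (h ▸ trivial), fun A B hAB => ?_⟩, hJP,
    lt_of_le_of_ne hPQ fun h => hcP (h ▸ hcQ)⟩
  -- L is the left annihilator of B modulo P, and N the right annihilator of L modulo P. Both
  -- contain P and have c regular modulo them. Since L N ⊆ P ⊆ Q, one of them lies in Q and by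
  -- maximality equals P.
  let L : TwoSidedIdeal R := TwoSidedIdeal.mk' {x | ∀ b ∈ B, x * b ∈ P}
    (fun r _ => by simp)
    (fun {x y} hx hy b hb => by rw [add_mul]; exact P.add_mem (hx b hb) (hy b hb))
    (fun {x} hx b hb => by rw [neg_mul]; exact P.neg_mem (hx b hb))
    (fun {x y} hy b hb => by rw [mul_assoc]; exact P.mul_mem_left _ _ (hy b hb))
    (fun {x y} hx b hb => by rw [mul_assoc]; exact hx _ (B.mul_mem_left _ _ hb))
  have hL : ∀ x, x ∈ L ↔ ∀ b ∈ B, x * b ∈ P := fun x => by simp [L, TwoSidedIdeal.mem_mk']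
  let N : TwoSidedIdeal R := TwoSidedIdeal.mk' {y | ∀ x ∈ L, x * y ∈ P}
    (fun r _ => by simp)
    (fun {x y} hx hy r hr => by rw [mul_add]; exact P.add_mem (hx r hr) (hy r hr))
    (fun {x} hx r hr => by rw [mul_neg]; exact P.neg_mem (hx r hr))
    (fun {x y} hy r hr => by rw [← mul_assoc]; exact hy _ (L.mul_mem_right _ _ hr))
    (fun {x y} hx r hr => by rw [← mul_assoc]; exact P.mul_mem_right _ _ (hx r hr))
  have hN : ∀ y, y ∈ N ↔ ∀ x ∈ L, x * y ∈ P := fun y => by simp [N, TwoSidedIdeal.mem_mk']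
  have hPL : P ≤ L := fun x hx => (hL x).mpr fun b _ => P.mul_mem_right _ _ hx
  have hPN : P ≤ N := fun x hx => (hN x).mpr fun b _ => P.mul_mem_left _ _ hx
  rcases hQ.le_or_le L N fun x hx y hy => hPQ ((hN y).mp hy x hx) with h | h
  · left
    have hLP : L ≤ P := hmax ⟨hJP.trans hPL, h, fun x hx => (hL x).mpr fun b hb =>
      hsat _ (by rw [← mul_assoc]; exact (hL _).mp hx b hb)⟩ hPL
    exact fun a ha => hLP ((hL a).mpr fun b hb => hAB a ha b hb)
  · right
    have hNP : N ≤ P := hmax ⟨hJP.trans hPN, h, fun y hy => (hN y).mpr fun x hx =>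
      hsat _ (by rw [← mul_assoc, hc, mul_assoc]; exact (hN _).mp hy x hx)⟩ hPN
    exact fun b hb => hNP ((hN b).mpr fun x hx => (hL x).mp hx b hb)

variable {Z : Type*} [CommRing Z] [Algebra Z R]

/-- The two-sided ideal `I R` generated by an ideal of central scalars. -/
def extendedIdeal (I : Ideal Z) : TwoSidedIdeal R :=
  TwoSidedIdeal.mk' (I • ⊤ : Submodule Z R) (Submodule.zero_mem _) (Submodule.add_mem _)
    (Submodule.neg_mem _)
    (fun {x _} hy => Submodule.smul_top_le_comap_smul_top I (LinearMap.mulLeft Z x) hy)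
    (fun {_ y} hx => Submodule.smul_top_le_comap_smul_top I (LinearMap.mulRight Z y) hx)

theorem mem_extendedIdeal {I : Ideal Z} {x : R} :
    x ∈ (extendedIdeal I : TwoSidedIdeal R) ↔ x ∈ (I • ⊤ : Submodule Z R) := by
  unfold extendedIdeal
  exact TwoSidedIdeal.mem_mk' _ _ _ _ _ _ _

theorem extendedIdeal_le {I : Ideal Z} {P : TwoSidedIdeal R} :
    extendedIdeal I ≤ P ↔ ∀ z ∈ I, algebraMap Z R z ∈ P := by
  constructor
  · intro h z hz
    refine h (mem_extendedIdeal.mpr ?_)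
    rw [Algebra.algebraMap_eq_smul_one]
    exact Submodule.smul_mem_smul hz trivial
  · intro h x hx
    refine Submodule.smul_induction_on (mem_extendedIdeal.mp hx) (fun z hz r _ => ?_)
      fun x y hx hy => P.add_mem hx hy
    rw [Algebra.smul_def]
    exact P.mul_mem_right _ _ (h z hz)

/-- The last element is regular modulo the ideal generated by the preceding ones, so there is a
strictly smaller prime that still contains these. Induction on the length then builds the descending
chain. -/
theorem length_le_height [IsNoetherianRing R] {rs : List Z} (hrs : IsWeaklyRegular R rs)
    (Q : PrimeIdeals R) (hQ : ∀ r ∈ rs, algebraMap Z R r ∈ Q.1) :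
    (rs.length : ℕ∞) ≤ Order.height Q := by
  induction rs using List.reverseRecOn generalizing Q with
  | nil => simp
  | append_singleton ts c ih =>
    rw [isWeaklyRegular_append_iff, isWeaklyRegular_singleton_iff] at hrs
    have hle : (extendedIdeal (Ideal.ofList ts) : TwoSidedIdeal R) ≤ Q.1 := by
      refine extendedIdeal_le.mpr fun z hz => ?_
      have : Ideal.ofList ts ≤ (TwoSidedIdeal.asIdeal (Q.1.comap (algebraMap Z R))) :=
        Ideal.span_le.mpr fun r hr => by
          simpa [TwoSidedIdeal.mem_comap] using hQ r (List.mem_append_left _ hr)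
      simpa [TwoSidedIdeal.mem_comap] using this hz
    obtain ⟨P, hP, hJP, hPQ⟩ := exists_isPrimeIdeal_lt Q.2 hle (Algebra.commutes c)
      (hQ c (by simp)) (fun x hx => by
        rw [mem_extendedIdeal] at hx ⊢
        rw [← Submodule.Quotient.mk_eq_zero] at hx ⊢
        refine hrs.2 ?_
        change c • Submodule.Quotient.mk x = c • _
        rw [smul_zero, ← hx, ← Algebra.smul_def, Submodule.Quotient.mk_smul])
    have h₁ := ih hrs.1 ⟨P, hP⟩ fun r hr => extendedIdeal_le.mp hJP r (Ideal.subset_span hr)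
    have h₂ : Order.height (⟨P, hP⟩ : PrimeIdeals R) + 1 ≤ Order.height Q :=
      Order.height_add_one_le hPQ
    calc ((ts ++ [c]).length : ℕ∞) = ts.length + 1 := by simp
      _ ≤ _ := by gcongr
      _ ≤ _ := h₂

variable (Z) in
/-- The contraction of a prime of `R` to the scalars. -/
def contraction (P : PrimeIdeals R) : PrimeSpectrum Z where
  asIdeal := TwoSidedIdeal.asIdeal (P.1.comap (algebraMap Z R))
  isPrime :=
    { ne_top' := fun h => P.2.ne_top (by
        rw [← TwoSidedIdeal.one_mem_iff, ← map_one (algebraMap Z R)]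
        exact (TwoSidedIdeal.mem_comap (f := algebraMap Z R)).mp
          (TwoSidedIdeal.mem_asIdeal.mp (h ▸ Submodule.mem_top)))
      mem_or_mem' := fun {x y} h => by
        simp only [TwoSidedIdeal.mem_asIdeal, TwoSidedIdeal.mem_comap, map_mul] at h ⊢
        exact P.2.mem_or_mem_of_central h }

theorem mem_contraction {P : PrimeIdeals R} {z : Z} :
    z ∈ (contraction Z P).asIdeal ↔ algebraMap Z R z ∈ P.1 := by
  simp [contraction, TwoSidedIdeal.mem_comap]

end PrimeIdeals

/-! ### Incomparability and lying over for central scalars -/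

section Incomparability

/-- A nonzero two-sided ideal of a prime Artinian ring is everything. -/
theorem eq_top_of_prime_of_isArtinianRing {A : Type*} [Ring A] [IsArtinianRing A]
    (hA : ∀ a b : A, (∀ r, a * r * b = 0) → a = 0 ∨ b = 0) (I : Ideal A) [I.IsTwoSided]
    (hI : I ≠ ⊥) : I = ⊤ := by
  have hjac : Ring.jacobson A = ⊥ := by
    obtain ⟨n, hn⟩ := IsArtinianRing.isNilpotent_jacobson_bot (R := A)
    rw [Ideal.jacobson_bot] at hn
    by_contra hne
    obtain ⟨b, hb, hb0⟩ := (Submodule.ne_bot_iff _).mp hne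
    -- If the power k + 1 of the radical vanishes, then a r b = 0 for all a in the power k, and
    -- primeness with b ≠ 0 makes the power k vanish. Descending to the power 0, this contradicts b
    -- ≠ 0, whereas the radical is nilpotent.
    have : ∀ k, ¬ ∀ a ∈ Ring.jacobson A ^ k, a = 0 := by
      intro k
      induction k with
      | zero =>
        intro h
        refine hb0 ?_
        rw [← mul_one b, h 1 (by rw [Submodule.pow_zero, Ideal.one_eq_top]; trivial), mul_zero]
      | succ k ih =>
        intro h
        refine ih fun a ha => ?_
        refine (hA a b fun r => ?_).resolve_right hb0
        refine h _ ?_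
        rw [Submodule.pow_succ, mul_assoc]
        exact Ideal.mul_mem_mul ha (Ideal.mul_mem_left _ _ hb)
    exact this n fun a ha => by rw [hn] at ha; simpa using ha
  have := IsArtinianRing.isSemisimpleRing_iff_jacobson.mpr hjac
  -- I J lies in I ∩ J = 0, so a complement J of the nonzero ideal I is zero by primeness.
  obtain ⟨J, hJ⟩ := exists_isCompl I
  obtain ⟨a, ha, ha0⟩ := (Submodule.ne_bot_iff _).mp hI
  have : J = ⊥ := by
    rw [eq_bot_iff]
    intro b hb
    refine (hA a b fun r => ?_).resolve_left ha0
    have : a * r * b ∈ I ⊓ J := ⟨I.mul_mem_right _ (I.mul_mem_right _ ha),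
      J.mul_mem_left _ hb⟩
    rw [hJ.inf_eq_bot] at this
    simpa using this
  rw [← hJ.sup_eq_top, this, sup_bot_eq]

/-- Dimension at most 0 means deviation at most 0, which is the descending chain condition. -/
theorem isArtinianRing_of_supportDim_lt_one {Z A : Type*} [CommRing Z] [IsNoetherianRing Z]
    [Ring A] [Algebra Z A] [Module.Finite Z A] (h : Module.supportDim Z A < (1 : ℕ)) :
    IsArtinianRing A := by
  have hdev := (devLT_iff_supportDim_lt (A := A) (M := A) 1).mpr h
  refine (monotone_stabilizes_iff_artinian (R := A) (M := A)).mp fun f => ?_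
  obtain ⟨N, hN⟩ := hdev (fun i => OrderDual.ofDual (f i)) (fun i j hij => f.monotone hij)
    fun i => ⟨bot_le, le_top⟩
  have hstep : ∀ i, N ≤ i → f (i + 1) = f i := fun i hi => by
    have hle : OrderDual.ofDual (f (i + 1)) ≤ OrderDual.ofDual (f i) := f.monotone i.le_succ
    exact hN i hi ⟨le_rfl, hle⟩ ⟨hle, le_rfl⟩
  refine ⟨N, fun k hk => ?_⟩
  induction k, hk using Nat.le_induction with
  | base => rfl
  | succ k hk ih => rw [ih, hstep k hk]

variable {Z : Type*} [CommRing Z] [IsNoetherianRing Z] {R : Type*} [Ring R] [Algebra Z R]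
  [Module.Finite Z R]

/-- Suppose P < Q have the same contraction p. The localisation of R/P at p is a prime ring, and it
is Artinian because its support over the local ring of Z at p is the closed point. Hence its nonzero
two-sided ideals are trivial, the ideal coming from Q contains 1, and clearing denominators puts a
scalar outside p into Q. -/
theorem contraction_strictMono : StrictMono (contraction Z : PrimeIdeals R → PrimeSpectrum Z) := by
  intro P Q hPQ
  have hle : (contraction Z P) ≤ contraction Z Q := fun z hz =>
    mem_contraction.mpr (hPQ.le (mem_contraction.mp hz))
  refine lt_of_le_of_ne hle fun heq => ?_
  set p := contraction Z P with hp
  let S := p.asIdeal.primeCompl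
  have hS : ∀ z, z ∈ S ↔ algebraMap Z R z ∉ P.1 := fun z => not_congr mem_contraction
  let T := R ⧸ P.1.asIdeal
  let π : R →+* T := Ideal.Quotient.mk P.1.asIdeal
  have hπ : ∀ x, π x = 0 ↔ x ∈ P.1 := fun x => by
    rw [Ideal.Quotient.eq_zero_iff_mem, TwoSidedIdeal.mem_asIdeal]
  have hπz : ∀ (z : Z) (x : R), z • π x = π (algebraMap Z R z * x) := fun z x => by
    rw [Algebra.smul_def, map_mul]; rfl
  let _ := localizedAlgebra S T
  let A := LocalizedModule S T
  have hzero : ∀ (x : R) (s : S), (LocalizedModule.mk (π x) s : A) = 0 ↔ x ∈ P.1 := by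
    intro x s
    rw [← LocalizedModule.zero_mk s, LocalizedModule.mk_eq]
    constructor
    · rintro ⟨u, hu⟩
      rw [smul_zero, smul_zero, smul_smul, Submonoid.smul_def, hπz, hπ] at hu
      exact (P.2.mem_or_mem_of_central hu).resolve_left ((hS _).mp (u * s).2)
    · intro hx
      exact ⟨1, by rw [(hπ x).mpr hx]⟩
  have hprime : ∀ a b : A, (∀ r, a * r * b = 0) → a = 0 ∨ b = 0 := by
    intro a b h
    induction a using LocalizedModule.induction_on with | _ a s
    induction b using LocalizedModule.induction_on with | _ b t
    obtain ⟨a, rfl⟩ := Ideal.Quotient.mk_surjective a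
    obtain ⟨b, rfl⟩ := Ideal.Quotient.mk_surjective b
    have := P.2.mem_or_mem (a := a) (b := b) fun r => by
      have := h (LocalizedModule.mk (π r) 1)
      rw [LocalizedModule.mk_mul_mk, LocalizedModule.mk_mul_mk] at this
      exact (hzero (a * r * b) _).mp this
    exact this.imp (hzero a s).mpr (hzero b t).mpr
  have hann : ∀ z ∈ p.asIdeal, ∀ x : T, z • x = 0 := by
    intro z hz x
    obtain ⟨x, rfl⟩ := Ideal.Quotient.mk_surjective x
    change z • π x = 0
    rw [hπz, hπ]
    exact P.1.mul_mem_right _ _ (mem_contraction.mp hz)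
  have hfin : Module.Finite Z T := Module.Finite.of_surjective
    (Ideal.Quotient.mkₐ Z P.1.asIdeal).toLinearMap Ideal.Quotient.mk_surjective
  -- As p kills R/P, every prime of the support contains the maximal ideal of the local ring.
  have hdim : Module.supportDim (Localization S) A < (1 : ℕ) := by
    by_contra! hcon
    obtain ⟨q, hq, hq1⟩ := natCast_le_supportDim_iff.mp hcon
    have hmax : IsLocalRing.maximalIdeal (Localization.AtPrime p.asIdeal) ≤ q.asIdeal := by
      rw [← Localization.AtPrime.map_eq_maximalIdeal, Ideal.map_le_iff_le_comap]
      intro z hz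
      refine Module.mem_support_iff_of_finite.mp hq (Module.mem_annihilator.mpr fun x => ?_)
      induction x using LocalizedModule.induction_on with | _ x s
      rw [← Localization.mk_one_eq_algebraMap, LocalizedModule.mk_smul_mk, hann z hz,
        LocalizedModule.zero_mk]
    have : IsMax q := fun q' hq' =>
      ((IsLocalRing.eq_maximalIdeal ((IsLocalRing.maximalIdeal.isMaximal _).eq_of_le
        q.isPrime.ne_top hmax ▸ IsLocalRing.maximalIdeal.isMaximal _ : q.asIdeal.IsMaximal)).symm ▸
        IsLocalRing.le_maximalIdeal q'.isPrime.ne_top : q'.asIdeal ≤ q.asIdeal)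
    rw [Order.coheight_eq_zero.mpr this] at hq1
    simp at hq1
  have : IsArtinianRing A := isArtinianRing_of_supportDim_lt_one hdim
  let I : Ideal A :=
    { carrier := {a | ∃ x ∈ Q.1, ∃ s : S, LocalizedModule.mk (π x) s = a}
      zero_mem' := ⟨0, Q.1.zero_mem, 1, by simp⟩
      add_mem' := by
        rintro _ _ ⟨x, hx, s, rfl⟩ ⟨y, hy, t, rfl⟩
        refine ⟨algebraMap Z R t * x + algebraMap Z R s * y,
          Q.1.add_mem (Q.1.mul_mem_left _ _ hx) (Q.1.mul_mem_left _ _ hy), s * t, ?_⟩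
        rw [LocalizedModule.mk_add_mk, map_add, ← hπz, ← hπz]
        rfl
      smul_mem' := by
        rintro a _ ⟨x, hx, s, rfl⟩
        induction a using LocalizedModule.induction_on with | _ a t
        obtain ⟨a, rfl⟩ := Ideal.Quotient.mk_surjective a
        exact ⟨a * x, Q.1.mul_mem_left _ _ hx, t * s, by
          rw [smul_eq_mul, LocalizedModule.mk_mul_mk]; rfl⟩ }
  have hI : I.IsTwoSided := ⟨by
    rintro _ b ⟨x, hx, s, rfl⟩
    induction b using LocalizedModule.induction_on with | _ b t
    obtain ⟨b, rfl⟩ := Ideal.Quotient.mk_surjective b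
    exact ⟨x * b, Q.1.mul_mem_right _ _ hx, s * t, by rw [LocalizedModule.mk_mul_mk]; rfl⟩⟩
  have hI0 : I ≠ ⊥ := by
    obtain ⟨x, hxQ, hxP⟩ := Set.exists_of_ssubset (show (P.1 : Set R) ⊂ Q.1 from hPQ)
    intro h
    have : LocalizedModule.mk (π x) (1 : S) ∈ I := ⟨x, hxQ, 1, rfl⟩
    rw [h] at this
    exact hxP ((hzero x 1).mp (by simpa using this))
  have h1 : (1 : A) ∈ I := by
    rw [eq_top_of_prime_of_isArtinianRing hprime I hI0]
    trivial
  obtain ⟨x, hx, s, hxs⟩ := h1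
  have h1' : (1 : A) = LocalizedModule.mk (π 1) (1 : S) := by
    rw [map_one]
    exact OreLocalization.one_def
  rw [h1', LocalizedModule.mk_eq] at hxs
  obtain ⟨u, hu⟩ := hxs
  rw [one_smul, smul_smul, Submonoid.smul_def, Submonoid.smul_def, hπz, hπz, ← sub_eq_zero,
    ← map_sub, hπ, mul_one] at hu
  have hus : algebraMap Z R ((u * s : S) : Z) ∈ Q.1 := by
    have := Q.1.sub_mem (Q.1.mul_mem_left (algebraMap Z R u) _ hx) (hPQ.le hu)
    simpa using this
  have : ((u * s : S) : Z) ∈ (contraction Z Q).asIdeal := mem_contraction.mpr hus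
  rw [← heq] at this
  exact (u * s).2 this

theorem height_le_height_contraction (P : PrimeIdeals R) :
    Order.height P ≤ Order.height (contraction Z P) :=
  Order.height_le_height_apply_of_strictMono _ contraction_strictMono P

omit [IsNoetherianRing Z] in
-- Let m be a maximal ideal above the contraction p. If m R were not inside P, then R = P + m R, and
-- Nakayama's lemma for R/P would give z in p with z - 1 in m, which is absurd as p ⊆ m.
theorem isMaximal_contraction {P : TwoSidedIdeal R} (hP : IsCoatom P) :
    (contraction Z ⟨P, isPrimeIdeal_of_isCoatom hP⟩).asIdeal.IsMaximal := by
  set p := contraction Z ⟨P, isPrimeIdeal_of_isCoatom hP⟩ with hp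
  obtain ⟨m, hm, hpm⟩ := Ideal.exists_le_maximal p.asIdeal p.isPrime.ne_top
  have hmP : (extendedIdeal m : TwoSidedIdeal R) ≤ P := by
    by_contra hcon
    have htop : P ⊔ extendedIdeal m = ⊤ := hP.2 _ (left_lt_sup.mpr hcon)
    have hle : (⊤ : Submodule Z (R ⧸ P.asIdeal)) ≤ m • ⊤ := by
      rintro x -
      obtain ⟨x, rfl⟩ := Ideal.Quotient.mk_surjective x
      have hx : x ∈ P ⊔ extendedIdeal m := htop ▸ trivial
      obtain ⟨a, ha, b, hb, rfl⟩ := TwoSidedIdeal.mem_sup.mp hx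
      rw [map_add, Ideal.Quotient.eq_zero_iff_mem.mpr (TwoSidedIdeal.mem_asIdeal.mpr ha), zero_add]
      exact Submodule.smul_top_le_comap_smul_top m
        (Ideal.Quotient.mkₐ Z P.asIdeal).toLinearMap (mem_extendedIdeal.mp hb)
    have hfin : Module.Finite Z (R ⧸ P.asIdeal) := Module.Finite.of_surjective
      (Ideal.Quotient.mkₐ Z P.asIdeal).toLinearMap Ideal.Quotient.mk_surjective
    obtain ⟨z, hz, hz0⟩ := Submodule.exists_sub_one_mem_and_smul_eq_zero_of_fg_of_le_smul m ⊤
      Module.Finite.fg_top hle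
    have h1 := hz0 (Ideal.Quotient.mk P.asIdeal 1) trivial
    rw [Algebra.smul_def, map_one, mul_one] at h1
    have hzp : z ∈ p.asIdeal := mem_contraction.mpr
      (TwoSidedIdeal.mem_asIdeal.mp (Ideal.Quotient.eq_zero_iff_mem.mp h1))
    exact hm.ne_top (Ideal.eq_top_of_isUnit_mem _
      (by simpa using m.sub_mem (hpm hzp) hz : (1 : Z) ∈ m) isUnit_one)
  have : m ≤ p.asIdeal := fun z hz => mem_contraction.mpr (extendedIdeal_le.mp hmP z hz)
  rwa [le_antisymm hpm this]

omit [IsNoetherianRing Z] in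
-- By Nakayama's lemma and faithfulness m R is proper; any maximal two-sided ideal above it
-- contracts to m.
theorem exists_isCoatom_contraction_eq [IsNoetherianRing R]
    (hR : Module.annihilator Z R = ⊥) (m : Ideal Z) [hm : m.IsMaximal] :
    ∃ (P : TwoSidedIdeal R) (hP : IsCoatom P),
      contraction Z ⟨P, isPrimeIdeal_of_isCoatom hP⟩ = ⟨m, hm.isPrime⟩ := by
  have hne : (extendedIdeal m : TwoSidedIdeal R) ≠ ⊤ := by
    intro h
    have hle : (⊤ : Submodule Z R) ≤ m • ⊤ := fun x _ =>
      mem_extendedIdeal.mp (h ▸ trivial : x ∈ (extendedIdeal m : TwoSidedIdeal R))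
    obtain ⟨z, hz, hz0⟩ := Submodule.exists_sub_one_mem_and_smul_eq_zero_of_fg_of_le_smul m ⊤
      Module.Finite.fg_top hle
    have : z = 0 := by
      have : z ∈ Module.annihilator Z R := Module.mem_annihilator.mpr fun x => hz0 x trivial
      rwa [hR] at this
    rw [this, zero_sub] at hz
    exact hm.ne_top (Ideal.eq_top_of_isUnit_mem _ (by simpa using m.neg_mem hz : (1 : Z) ∈ m)
      isUnit_one)
  have := wellFoundedGT_twoSidedIdeal (R := R)
  obtain ⟨P, hP, hmP⟩ := (eq_top_or_exists_le_coatom (extendedIdeal m : TwoSidedIdeal R)).resolve_left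
    hne
  exact ⟨P, hP, PrimeSpectrum.ext (hm.eq_of_le (contraction Z _).isPrime.ne_top
    fun z hz => mem_contraction.mpr (extendedIdeal_le.mp hmP z hz)).symm⟩

end Incomparability

/-! ### Homomorphisms and localisation at central elements -/

section CentralLocalization

variable {Z : Type*} [CommRing Z] {S : Submonoid Z} {A A' : Type*} [Ring A] [Ring A']
  [Algebra Z A] [Algebra Z A'] (φ : A →ₐ[Z] A') [IsLocalizedModule S φ.toLinearMap]

theorem bijective_smul_of_isLocalization (Z' : Type*) [CommRing Z'] [Algebra Z Z']
    [IsLocalization S Z'] {N : Type*} [AddCommGroup N] [Module Z N] [Module Z' N]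
    [IsScalarTower Z Z' N] (s : S) : Function.Bijective fun x : N => (s : Z) • x := by
  have hs := IsLocalization.map_units Z' s
  have : (fun x : N => (s : Z) • x) = fun x => hs.unit • x := by
    ext x
    rw [Units.smul_def, IsUnit.unit_spec, algebraMap_smul]
  rw [this]
  exact MulAction.bijective _

theorem isUnit_algebraMap_end_of_bijective {N : Type*} [AddCommGroup N] [Module Z N]
    (hN : ∀ s : S, Function.Bijective fun x : N => (s : Z) • x) (s : S) :
    IsUnit (algebraMap Z (Module.End Z N) s) :=
  (Module.End.isUnit_iff _).mpr (hN s)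

variable {N X : Type*} [AddCommGroup N] [Module A' N] [Module Z N] [IsScalarTower Z A' N]
  [AddCommGroup X] [Module A' X] [Module Z X] [IsScalarTower Z A' X]
  (hX : ∀ s : S, Function.Bijective fun x : X => (s : Z) • x)

include hX in
-- Every element of A' becomes some φ b after multiplication by an element of S, and S acts
-- injectively on X, so linearity over A' can be tested on the image of φ.
theorem exists_linearMap_of_map_smul (f : N →ₗ[Z] X) (hf : ∀ a n, f (φ a • n) = φ a • f n) :
    ∃ F : N →ₗ[A'] X, ∀ n, F n = f n := by
  refine ⟨{ toFun := f, map_add' := map_add f, map_smul' := fun a n => ?_ }, fun n => rfl⟩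
  obtain ⟨⟨b, s⟩, hs⟩ := IsLocalizedModule.surj S φ.toLinearMap a
  have hs' : (s : Z) • a = φ b := hs
  refine (hX s).1 ?_
  change (s : Z) • f (a • n) = (s : Z) • a • f n
  rw [← map_smul, ← smul_assoc, ← smul_assoc, hs', hf]

variable {M : Type*} [AddCommGroup M] [Module A M] [Module Z M] [IsScalarTower Z A M]

omit [IsScalarTower Z A M] in
include hX in
theorem exists_linearMap_extension (ι : M →ₗ[Z] N) [IsLocalizedModule S ι]
    (hι : ∀ a x, ι (a • x) = φ a • ι x) (f : M →ₗ[Z] X) (hf : ∀ a x, f (a • x) = φ a • f x) :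
    ∃ F : N →ₗ[A'] X, ∀ x, F (ι x) = f x := by
  let G := IsLocalizedModule.lift S ι f (isUnit_algebraMap_end_of_bijective hX)
  have hG : ∀ x, G (ι x) = f x := IsLocalizedModule.lift_apply S ι f _
  obtain ⟨F, hF⟩ := exists_linearMap_of_map_smul φ hX G fun a n => by
    obtain ⟨⟨x, s⟩, hs⟩ := IsLocalizedModule.surj S ι n
    have hs' : (s : Z) • n = ι x := hs
    refine (hX s).1 ?_
    change (s : Z) • G (φ a • n) = (s : Z) • φ a • G n
    rw [smul_comm (s : Z) (φ a) (G n), ← map_smul, ← map_smul, smul_comm, hs', ← hι, hG, hG, hf]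
  exact ⟨F, fun x => by rw [hF, hG]⟩

omit [IsLocalizedModule S φ.toLinearMap] [IsScalarTower Z A M] in
/-- Homomorphisms to a localisation come, up to a unit, from homomorphisms to the module. -/
theorem exists_linearMap_clearing_denominators [IsNoetherianRing Z] [Module.Finite A M]
    {V : Type*} [AddCommGroup V] [Module A V] [Module Z V] [IsScalarTower Z A V] [Module.Finite Z V]
    (h : V →ₗ[Z] X) [IsLocalizedModule S h] (hh : ∀ a v, h (a • v) = φ a • h v)
    (f : M →ₗ[Z] X) (hf : ∀ a x, f (a • x) = φ a • f x) :
    ∃ (F : M →ₗ[A] V) (s : S), ∀ x, h (F x) = (s : Z) • f x := by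
  classical
  -- A common denominator for the images of finitely many generators of M.
  obtain ⟨s, hs⟩ : ∃ s : S, ∀ x, ∃ v, h v = (s : Z) • f x := by
    obtain ⟨G, hG⟩ := Module.Finite.fg_top (R := A) (M := M)
    choose v hv using fun x => IsLocalizedModule.surj S h (f x)
    refine ⟨∏ x ∈ G, (v x).2, fun x => ?_⟩
    have hx : x ∈ Submodule.span A (G : Set M) := hG ▸ trivial
    induction hx using Submodule.span_induction with
    | mem x hx =>
      refine ⟨((∏ y ∈ G.erase x, (v y).2 : S) : Z) • (v x).1, ?_⟩
      rw [map_smul, ← hv, Submonoid.smul_def, smul_smul, ← Submonoid.coe_mul,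
        Finset.prod_erase_mul _ _ hx]
    | zero => exact ⟨0, by simp⟩
    | add x y _ _ hx hy =>
      obtain ⟨a, ha⟩ := hx
      obtain ⟨b, hb⟩ := hy
      exact ⟨a + b, by rw [map_add, ha, hb, map_add, smul_add]⟩
    | smul a x _ hx =>
      obtain ⟨b, hb⟩ := hx
      exact ⟨a • b, by rw [hh, hb, hf, smul_comm]⟩
  obtain ⟨t, ht⟩ : ∃ t : S, ∀ v, h v = 0 → (t : Z) • v = 0 := by
    obtain ⟨G, hG⟩ := (IsNoetherian.noetherian (LinearMap.ker h) : (LinearMap.ker h).FG)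
    have : ∀ v : V, ∃ c : S, h v = 0 → (c : Z) • v = 0 := fun v => by
      by_cases hv : h v = 0
      · obtain ⟨c, hc⟩ := IsLocalizedModule.exists_of_eq (S := S) (f := h) (hv.trans (map_zero h).symm)
        exact ⟨c, fun _ => by simpa [Submonoid.smul_def] using hc⟩
      · exact ⟨1, fun h => absurd h hv⟩
    choose c hc using this
    refine ⟨∏ x ∈ G, c x, fun v hv => ?_⟩
    have hv' : v ∈ Submodule.span Z (G : Set V) := hG ▸ hv
    induction hv' using Submodule.span_induction with
    | mem x hx =>
      rw [← Finset.prod_erase_mul _ _ hx, Submonoid.coe_mul, mul_smul, hc x hv, smul_zero]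
    | zero => simp
    | add x y hx hy hx' hy' =>
      have h1 : h x = 0 := by rw [hG] at hx; exact hx
      have h2 : h y = 0 := by rw [hG] at hy; exact hy
      rw [smul_add, hx' h1, hy' h2, add_zero]
    | smul a x hx hx' =>
      have h1 : h x = 0 := by rw [hG] at hx; exact hx
      rw [smul_comm, hx' h1, smul_zero]
  choose v hv using hs
  -- The chosen lifts v are additive and A-linear only modulo the kernel of h; multiplication by t
  -- kills that kernel.
  refine ⟨{ toFun := fun x => (t : Z) • v x, map_add' := fun x y => ?_, map_smul' := fun a x => ?_ },
    t * s, fun x => ?_⟩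
  · rw [← sub_eq_zero, ← smul_add, ← smul_sub]
    refine ht _ ?_
    rw [map_sub, map_add, hv, hv, hv, map_add, smul_add, sub_self]
  · rw [RingHom.id_apply, smul_comm a, ← sub_eq_zero, ← smul_sub]
    refine ht _ ?_
    rw [map_sub, hh, hv, hv, hf, smul_comm, sub_self]
  · change h ((t : Z) • v x) = _
    rw [map_smul, hv, smul_smul, Submonoid.coe_mul]

/-- An algebra homomorphism that inverts `S` factors through the localisation. -/
theorem exists_algHom_lift {B : Type*} [Ring B] [Algebra Z B] (ψ : A →ₐ[Z] B)
    (hB : ∀ s : S, Function.Bijective fun x : B => (s : Z) • x) :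
    ∃ Ψ : A' →ₐ[Z] B, ∀ a, Ψ (φ a) = ψ a := by
  let G := IsLocalizedModule.lift S φ.toLinearMap ψ.toLinearMap
    (isUnit_algebraMap_end_of_bijective hB)
  have hG : ∀ a, G (φ a) = ψ a := IsLocalizedModule.lift_apply S φ.toLinearMap ψ.toLinearMap _
  refine ⟨AlgHom.ofLinearMap G ?_ fun a b => ?_, hG⟩
  · rw [← map_one φ, hG, map_one]
  · obtain ⟨⟨x, s⟩, hs⟩ := IsLocalizedModule.surj S φ.toLinearMap a
    obtain ⟨⟨y, t⟩, ht⟩ := IsLocalizedModule.surj S φ.toLinearMap b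
    have hs' : (s : Z) • a = φ x := hs
    have ht' : (t : Z) • b = φ y := ht
    refine (hB s).1 ((hB t).1 ?_)
    change (t : Z) • (s : Z) • G (a * b) = (t : Z) • (s : Z) • (G a * G b)
    rw [← map_smul, ← map_smul, ← smul_mul_assoc, ← mul_smul_comm, hs', ht', ← map_mul, hG,
      map_mul, ← smul_mul_assoc, ← mul_smul_comm, ← map_smul, ← map_smul, hs', ht', hG, hG]

theorem exists_smul_mem_annihilator [Module.Finite Z M] {M' : Type*} [AddCommGroup M'] [Module Z M']
    (g : M →ₗ[Z] M') [IsLocalizedModule S g] {z : Z} (hz : ∀ x : M', z • x = 0) :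
    ∃ t : S, (t : Z) * z ∈ Module.annihilator Z M := by
  classical
  obtain ⟨G, hG⟩ := Module.Finite.fg_top (R := Z) (M := M)
  have : ∀ x : M, ∃ c : S, (c : Z) • z • x = 0 := fun x => by
    have : g (z • x) = g 0 := by rw [map_smul, hz, map_zero]
    obtain ⟨c, hc⟩ := IsLocalizedModule.exists_of_eq (S := S) (f := g) this
    exact ⟨c, by simpa [Submonoid.smul_def] using hc⟩
  choose c hc using this
  refine ⟨∏ x ∈ G, c x, Module.mem_annihilator.mpr fun v => ?_⟩
  have hv : v ∈ Submodule.span Z (G : Set M) := hG ▸ trivial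
  induction hv using Submodule.span_induction with
  | mem x hx =>
    rw [← Finset.prod_erase_mul _ _ hx, Submonoid.coe_mul, mul_assoc, mul_smul, mul_smul, hc x,
      smul_zero]
  | zero => simp
  | add x y _ _ hx hy => rw [smul_add, hx, hy, add_zero]
  | smul a x _ hx => rw [smul_comm, hx, smul_zero]

end CentralLocalization

/-! ### Passage to and from the localisation at a maximal ideal -/

section Maximal

variable {Z : Type u} [CommRing Z] [IsNoetherianRing Z] {m : Ideal Z} [m.IsMaximal]
  {Z' : Type u} [CommRing Z'] [Algebra Z Z'] [IsLocalization.AtPrime Z' m]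
  {A A' : Type u} [Ring A] [Ring A'] [Algebra Z A] [Module.Finite Z A] [Algebra Z A']
  [Algebra Z' A'] [IsScalarTower Z Z' A'] [Module.Finite Z' A']
  {Y Y' : Type u} [AddCommGroup Y] [Module A Y] [Module Z Y] [IsScalarTower Z A Y]
  [Module.Finite Z Y] [AddCommGroup Y'] [Module A' Y'] [Module Z Y'] [Module Z' Y']
  [IsScalarTower Z A' Y'] [IsScalarTower Z' A' Y'] [IsScalarTower Z Z' Y'] [Module.Finite Z' Y']
  (φ : A →ₐ[Z] A') [IsLocalizedModule m.primeCompl φ.toLinearMap]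
  (g : Y →ₗ[Z] Y') [IsLocalizedModule m.primeCompl g] (hg : ∀ a y, g (a • y) = φ a • g y)

variable (Z') in
omit [IsNoetherianRing Z] [Module.Finite Z Y] [Module.Finite Z' Y'] in
theorem localized'_ideal_smul_top (I : Ideal Z) :
    (I • ⊤ : Submodule Z Y).localized' Z' m.primeCompl g = I.map (algebraMap Z Z') • ⊤ := by
  refine Submodule.restrictScalars_injective Z _ _ ?_
  rw [Ideal.smul_restrictScalars, Submodule.restrictScalars_localized', Submodule.localized₀_smul,
    Submodule.localized₀_top, Submodule.restrictScalars_top]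

omit [IsNoetherianRing Z] [Module.Finite Z' Y'] in
include g m in
variable (Z') in
theorem annihilator_eq_bot_of_isLocalizedModule (hY : Module.annihilator Z Y = ⊥) :
    Module.annihilator Z' Y' = ⊥ := by
  rw [eq_bot_iff]
  intro z' hz'
  obtain ⟨z, s, rfl⟩ := IsLocalization.exists_mk'_eq m.primeCompl z'
  rw [Module.mem_annihilator] at hz'
  obtain ⟨t, ht⟩ := exists_smul_mem_annihilator (S := m.primeCompl) g (z := z) fun x => by
    have := hz' x
    rw [← algebraMap_smul Z', ← IsLocalization.mk'_spec' Z' z s, mul_smul, this, smul_zero]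
  rw [hY] at ht
  exact (IsLocalization.mk'_eq_zero_iff z s).mpr ⟨t, ht⟩

theorem length_le_height_of_isWeaklyRegular (hY : Module.annihilator Z Y = ⊥) {rs : List Z}
    (hrs : IsWeaklyRegular Y rs) (hm : ∀ r ∈ rs, r ∈ m) : (rs.length : ℕ∞) ≤ m.height := by
  obtain ⟨p, hp, hpm⟩ := exists_associatedPrime_le_of_mem_support (Z := Z) (Y := Y)
    (m := ⟨m, inferInstance⟩) (Module.mem_support_iff_of_finite.mpr (by simp [hY]))
  obtain ⟨l, -, h₂, h₃⟩ := exists_ltSeries_of_isWeaklyRegular (p := ⟨p, hp.isPrime⟩)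
    (m := ⟨m, inferInstance⟩) hp hpm hm hrs
  rw [← h₃]
  exact (Order.length_le_height h₂).trans_eq (PrimeSpectrum.height_eq_orderHeight ⟨m, _⟩).symm

theorem HasDepth.height_eq {d : ℕ} (hd : HasDepth Z Y d)
    (hdim : ringKrullDim Z = d) (hY : Module.annihilator Z Y = ⊥) : m.height = d := by
  refine le_antisymm ?_ ?_
  · have := Ideal.height_le_ringKrullDim_of_ne_top (I := m) Ideal.IsPrime.ne_top'
    rw [hdim] at this
    exact WithBot.coe_le_coe.mp this
  · obtain ⟨ss, rfl, hsm, hss⟩ := hd m inferInstance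
    exact length_le_height_of_isWeaklyRegular hY hss hsm

variable (Z') in
omit [IsNoetherianRing Z] [Module.Finite Z A] [IsScalarTower Z Z' A'] [Module.Finite Z' A']
  [Module.Finite Z Y] [Module.Finite Z' Y'] [IsLocalizedModule m.primeCompl φ.toLinearMap] in
include Z' hg in
-- Exactness of localisation, with the map kept compatible with the actions of A and A'.
theorem exists_isLocalizedModule_quotient (I : Ideal Z) :
    ∃ h : (Y ⧸ idealSMulTop A I Y) →ₗ[Z] Y' ⧸ idealSMulTop A' I Y',
      IsLocalizedModule m.primeCompl h ∧ ∀ a x, h (a • x) = φ a • h x := by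
  have hle : (I • ⊤ : Submodule Z Y) ≤ (I • ⊤ : Submodule Z Y').comap g :=
    Submodule.smul_top_le_comap_smul_top I g
  let h : (Y ⧸ idealSMulTop A I Y) →ₗ[Z] Y' ⧸ idealSMulTop A' I Y' :=
    (idealSMulTopQuotEquiv A' I Y').toLinearMap ∘ₗ Submodule.mapQ _ _ g hle ∘ₗ
      (idealSMulTopQuotEquiv A I Y).symm.toLinearMap
  have hh : ∀ y, h (Submodule.Quotient.mk y) = Submodule.Quotient.mk (g y) := fun y => rfl
  refine ⟨h, ⟨?_, fun x' => ?_, fun {x₁ x₂} he => ?_⟩, fun a x => ?_⟩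
  · have : IsScalarTower Z Z' (Y' ⧸ idealSMulTop A' I Y') := inferInstance
    exact isUnit_algebraMap_end_of_bijective (bijective_smul_of_isLocalization Z')
  · obtain ⟨y', rfl⟩ := Submodule.Quotient.mk_surjective _ x'
    obtain ⟨⟨y, s⟩, hs⟩ := IsLocalizedModule.surj m.primeCompl g y'
    refine ⟨⟨Submodule.Quotient.mk y, s⟩, ?_⟩
    change _ = h (Submodule.Quotient.mk y)
    rw [hh, ← hs]
    rfl
  · obtain ⟨y₁, rfl⟩ := Submodule.Quotient.mk_surjective _ x₁
    obtain ⟨y₂, rfl⟩ := Submodule.Quotient.mk_surjective _ x₂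
    rw [hh, hh, Submodule.Quotient.eq, mem_idealSMulTop, ← map_sub,
      ← Submodule.localized₀_top m.primeCompl g, ← Submodule.localized₀_smul] at he
    obtain ⟨y, hy, s, hs⟩ := he
    rw [IsLocalizedModule.mk'_eq_iff, Submonoid.smul_def, ← map_smul] at hs
    obtain ⟨c, hc⟩ := IsLocalizedModule.exists_of_eq (S := m.primeCompl) (f := g) hs
    refine ⟨c * s, ?_⟩
    rw [Submonoid.smul_def, Submonoid.smul_def, ← Submodule.Quotient.mk_smul,
      ← Submodule.Quotient.mk_smul,
      Submodule.Quotient.eq, mem_idealSMulTop, ← smul_sub, Submonoid.coe_mul, mul_smul]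
    rw [Submonoid.smul_def, Submonoid.smul_def] at hc
    rw [← hc]
    exact Submodule.smul_mem _ _ hy
  · obtain ⟨y, rfl⟩ := Submodule.Quotient.mk_surjective _ x
    rw [← Submodule.Quotient.mk_smul, hh, hh, hg, Submodule.Quotient.mk_smul]

include m φ hg in
-- N is the localisation of a finite A-module M all of whose associated primes lie in m. For a
-- maximal sequence rs in the annihilator of M, a nonzero map from M to Y/(rs)Y survives
-- localisation, so N has grade |rs|. The exchange property and p' then force the given sequence rs'
-- to have the same length, hence to compute the grade of N as well.
theorem HasEnoughHoms.localization {d : ℕ} (hd : HasDepth Z Y d) (hdim : ringKrullDim Z = d)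
    (hY : Module.annihilator Z Y = ⊥) (hom : HasEnoughHoms Z A Y) : HasEnoughHoms Z' A' Y' := by
  intro N _ _ _ _ hN rs' hrN hrs' p' hp' hNp'
  have : IsNoetherianRing Z' := IsLocalization.isNoetherianRing m.primeCompl Z' inferInstance
  have : Module.Finite Z' N := Module.Finite.trans A' N
  let _ : Module Z N := Module.compHom N (algebraMap Z Z')
  have : IsScalarTower Z Z' N := IsScalarTower.of_algebraMap_smul fun _ _ => rfl
  have : IsScalarTower Z A' N := IsScalarTower.of_algebraMap_smul fun z n => by
    rw [IsScalarTower.algebraMap_apply Z Z' A', algebraMap_smul, algebraMap_smul]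
  let _ : Module A N := Module.compHom N φ.toRingHom
  have hφN : ∀ (a : A) (n : N), a • n = φ a • n := fun _ _ => rfl
  have : IsScalarTower Z A N := IsScalarTower.of_algebraMap_smul fun z n => by
    rw [hφN, AlgHom.commutes, algebraMap_smul]
  have hbij := bijective_smul_of_isLocalization (S := m.primeCompl) Z' (N := N)
  obtain ⟨T, hT⟩ := Module.Finite.fg_top (R := A') (M := N)
  have hTtop : ∀ n, n ∈ Submodule.span A' (T : Set N) := fun n => hT ▸ trivial
  -- The A-span of finitely many A'-generators of N. Being a submodule of N, it has only regular
  -- scalars outside m.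
  let M : Submodule A N := Submodule.span A (T : Set N)
  have hMfin : Module.Finite A M := Module.Finite.span_of_finite A T.finite_toSet
  have hMZ : Module.Finite Z M := Module.Finite.trans A M
  let ι : M →ₗ[Z] N := M.subtype.restrictScalars Z
  have hιloc : IsLocalizedModule m.primeCompl ι := by
    refine ⟨isUnit_algebraMap_end_of_bijective hbij, fun n => ?_, fun {x y} h => ⟨1, by
      rw [Subtype.ext h]⟩⟩
    suffices ∃ s : m.primeCompl, (s : Z) • n ∈ M by
      obtain ⟨s, hs⟩ := this
      exact ⟨⟨⟨_, hs⟩, s⟩, rfl⟩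
    induction hTtop n using Submodule.span_induction with
    | mem x hx => exact ⟨1, by simpa using Submodule.subset_span hx⟩
    | zero => exact ⟨1, by simp⟩
    | add x y _ _ hx hy =>
      obtain ⟨s, hs⟩ := hx
      obtain ⟨t, ht⟩ := hy
      refine ⟨s * t, ?_⟩
      rw [smul_add, Submonoid.coe_mul]
      refine M.add_mem ?_ ?_
      · rw [mul_comm, mul_smul]
        exact M.smul_of_tower_mem _ hs
      · rw [mul_smul]
        exact M.smul_of_tower_mem _ ht
    | smul a x _ hx =>
      obtain ⟨s, hs⟩ := hx
      obtain ⟨⟨b, t⟩, ht⟩ := IsLocalizedModule.surj m.primeCompl φ.toLinearMap a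
      have ht' : (t : Z) • a = φ b := ht
      refine ⟨s * t, ?_⟩
      rw [Submonoid.coe_mul, mul_smul, ← smul_assoc (t : Z) a x, ht', smul_comm, ← hφN]
      exact M.smul_mem _ hs
  have hann : ∀ z ∈ Module.annihilator Z M, ∀ n : N, z • n = 0 := by
    intro z hz n
    obtain ⟨⟨x, s⟩, hs⟩ := IsLocalizedModule.surj m.primeCompl ι n
    have hs' : (s : Z) • n = x := hs
    refine (hbij s).1 ?_
    change (s : Z) • z • n = (s : Z) • (0 : N)
    rw [smul_comm, hs', smul_zero, ← Submodule.coe_smul_of_tower, Module.mem_annihilator.mp hz]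
    rfl
  have hass : ∀ q ∈ associatedPrimes Z M, q ≤ m := by
    intro q hq z hz
    by_contra hzm
    refine notMem_of_isSMulRegular (Y := M) (x := z) (fun x y hxy => Subtype.ext ?_) hq hz
    exact (hbij ⟨z, hzm⟩).1 (congrArg Subtype.val hxy)
  have hNnt : Nontrivial N := Module.nonempty_support_iff.mp
    ⟨⟨p', hp'.isPrime⟩, Module.mem_support_iff_of_finite.mpr hNp'⟩
  have hMnt : Nontrivial M := by
    by_contra hcon
    rw [not_nontrivial_iff_subsingleton] at hcon
    refine not_subsingleton N ((subsingleton_iff_forall_eq 0).mpr fun n => ?_)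
    have := hann 1 (Module.mem_annihilator.mpr fun x => Subsingleton.elim _ _) n
    rwa [one_smul] at this
  obtain ⟨k, hk⟩ := exists_supportDim_eq_natCast hdim (M := M)
  obtain ⟨rs, hrM, hrs, hlen, p, hp, hMp⟩ := hd.exists_isWeaklyRegular_annihilator hdim hY hk
  obtain ⟨f, hf⟩ := hom M hMfin rs hrM hrs p hp hMp
  obtain ⟨h, hloc, hh⟩ := exists_isLocalizedModule_quotient (m := m) Z' φ g hg (Ideal.ofList rs)
  -- Otherwise each element of the image K of f is killed by a scalar outside m. This contradicts
  -- the existence of an associated prime q of K, once q ⊆ m is known.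
  have hfh : ∃ x, h (f x) ≠ 0 := by
    by_contra! hcon
    let K : Submodule Z (Y ⧸ idealSMulTop A (Ideal.ofList rs) Y) :=
      LinearMap.range (f.restrictScalars Z)
    have hK : Nontrivial K := by
      obtain ⟨x, hx⟩ : ∃ x, f x ≠ 0 := by
        by_contra! h0
        exact hf (LinearMap.ext h0)
      exact ⟨⟨⟨f x, x, rfl⟩, 0, fun h => hx (congrArg Subtype.val h)⟩⟩
    obtain ⟨q, hq⟩ := associatedPrimes.nonempty Z K
    have hqX := associatedPrimes.subset_of_injective (f := K.subtype) K.injective_subtype hq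
    rw [← LinearEquiv.AssociatedPrimes.eq (idealSMulTopQuotEquiv A (Ideal.ofList rs) Y)] at hqX
    have hMq : Module.annihilator Z M ≤ q := by
      refine le_trans (fun z hz => ?_) (annihilator_le_of_mem_associatedPrimes hq)
      rw [Module.mem_annihilator] at hz ⊢
      rintro ⟨_, x, rfl⟩
      refine Subtype.ext ?_
      change z • f x = 0
      rw [← LinearMap.map_smul_of_tower, hz, map_zero]
    have hcoh := hd.le_length_add_coheight hrs (p := ⟨q, hq.isPrime⟩) hqX
    -- Unmixedness gives dim Z/q ≥ d - |rs| = dim M, so q, which contains the annihilator of M, is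
    -- minimal over it. Hence q is an associated prime of M and lies in m.
    have hqm : q ≤ m := by
      have := hq.isPrime
      obtain ⟨r, hr, hrq⟩ := Ideal.exists_minimalPrimes_le (J := q) hMq
      have hrM' := Module.associatedPrimes.minimalPrimes_annihilator_subset_associatedPrimes Z M hr
      rcases hrq.eq_or_lt with rfl | hlt
      · exact hass _ hrM'
      exfalso
      have h₁ : Order.coheight (⟨q, hq.isPrime⟩ : PrimeSpectrum Z) + 1 ≤
          Order.coheight (⟨r, hrM'.isPrime⟩ : PrimeSpectrum Z) := Order.coheight_add_one_le hlt
      have h₂ := coheight_le_supportDim (M := M) (p := ⟨r, hrM'.isPrime⟩)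
        (Module.mem_support_iff_of_finite.mpr hr.1.2)
      rw [hk] at h₂
      have h₃ : Order.coheight (⟨r, hrM'.isPrime⟩ : PrimeSpectrum Z) ≤ (k : ℕ∞) :=
        WithBot.coe_le_coe.mp h₂
      have h₄ : ((d + 1 : ℕ) : ℕ∞) ≤ (rs.length + k : ℕ) := by
        push_cast
        calc (d : ℕ∞) + 1 ≤ _ := add_le_add_left hcoh 1
          _ = _ := add_assoc _ _ _
          _ ≤ _ := by gcongr; exact h₁.trans h₃
      norm_cast at h₄
      omega
    obtain ⟨-, x, hx⟩ := isAssociatedPrime_iff.mp hq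
    obtain ⟨_, y, rfl⟩ := x
    obtain ⟨c, hc⟩ := IsLocalizedModule.exists_of_eq (S := m.primeCompl) (f := h)
      ((hcon y).trans (map_zero h).symm)
    refine c.2 (hqm ?_)
    rw [hx, Submodule.mem_colon_singleton, Submodule.mem_bot]
    refine Subtype.ext ?_
    rw [smul_zero] at hc
    exact hc
  obtain ⟨x, hx⟩ := hfh
  obtain ⟨F, hF⟩ := exists_linearMap_extension φ (S := m.primeCompl)
    (bijective_smul_of_isLocalization Z') ι (fun a x => rfl) (h ∘ₗ f.restrictScalars Z)
    (fun a x => by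
      change h (f (a • x)) = _
      rw [map_smul, hh]
      rfl)
  have hrsY : IsWeaklyRegular Y' rs := (isWeaklyRegular_map_algebraMap_iff Z' Y' rs).mp
    (hrs.of_isLocalizedModule Z' m.primeCompl g)
  have hgrade : extGrade A' N Y' = rs.length :=
    (extGrade_eq_length_iff (fun r hr => hann r (hrM r hr)) hrsY).mpr
      ⟨F, fun h0 => hx (by rw [h0] at hF; exact (hF x).symm)⟩
  have hrN' : ∀ r ∈ rs', ∀ x : N, r • x = 0 := fun r hr => Module.mem_annihilator.mp (hrN r hr)
  have hle : rs'.length ≤ rs.length := by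
    have := length_le_extGrade (A := A') hrN' hrs'
    rw [hgrade] at this
    exact_mod_cast this
  rw [← extGrade_eq_length_iff hrN' hrs', hgrade]
  refine congrArg _ (le_antisymm ?_ hle)
  -- If rs' were shorter, the exchange property would give an element of the annihilator of N
  -- regular on Y'/(rs')Y'; but that annihilator lies in the associated prime p'.
  by_contra! hlt
  obtain ⟨z, hz, hreg⟩ := exists_isSMulRegular_of_length_lt hrs' hrN
    ((isWeaklyRegular_map_algebraMap_iff Z' Y' rs).mpr hrsY) (fun r hr => by
      obtain ⟨r, hr', rfl⟩ := List.mem_map.mp hr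
      refine Module.mem_annihilator.mpr fun n => ?_
      rw [algebraMap_smul, hann r (hrM r hr')]) (by simpa using hlt)
  exact notMem_of_isSMulRegular hreg hp' (hNp' hz)

omit [IsNoetherianRing Z] [Module.Finite Z Y] [Module.Finite Z' Y'] in
include m g in
variable (Z') in
theorem HasDepth.localization {d : ℕ} (hd : HasDepth Z Y d) : HasDepth Z' Y' d := by
  intro m' hm'
  obtain ⟨rs, hlen, hrm, hrs⟩ := hd m inferInstance
  have := IsLocalization.AtPrime.isLocalRing Z' m
  refine ⟨rs.map (algebraMap Z Z'), by simpa using hlen, fun r hr => ?_,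
    hrs.of_isLocalizedModule Z' m.primeCompl g⟩
  obtain ⟨r, hr', rfl⟩ := List.mem_map.mp hr
  rw [IsLocalRing.eq_maximalIdeal hm', IsLocalization.AtPrime.to_map_mem_maximal_iff Z' m]
  exact hrm r hr'

include Z' m φ hg in
theorem HasGradeFormula.localization {d : ℕ} (hd : HasDepth Z Y d) (hdim : ringKrullDim Z = d)
    (hY : Module.annihilator Z Y = ⊥) (hom : HasEnoughHoms Z A Y) : HasGradeFormula A' Y' := by
  have : IsNoetherianRing Z' := IsLocalization.isNoetherianRing m.primeCompl Z' inferInstance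
  refine hasGradeFormula_of_hasDepth (Z := Z') (d := d) ?_
    (annihilator_eq_bot_of_isLocalizedModule (m := m) Z' g hY) (hd.localization (m := m) Z' g)
    (hom.localization (m := m) φ g hg hd hdim hY)
  rw [IsLocalization.AtPrime.ringKrullDim_eq_height m, hd.height_eq hdim hY]
  rfl

omit [IsNoetherianRing Z] [Module.Finite Z Y] [Module.Finite Z' Y'] in
include g in
theorem mem_associatedPrimes_localization {I : Ideal Z} {p : Ideal Z} (hpm : p ≤ m)
    (hp : p ∈ associatedPrimes Z (Y ⧸ (I • ⊤ : Submodule Z Y))) :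
    p.map (algebraMap Z Z') ∈
      associatedPrimes Z' (Y' ⧸ (I.map (algebraMap Z Z') • ⊤ : Submodule Z' Y')) := by
  rw [← localized'_ideal_smul_top (m := m) Z' g]
  refine Module.associatedPrimes.mem_associatedPrimes_of_comap_mem_associatedPrimes_of_isLocalizedModule
    m.primeCompl (Submodule.toLocalizedQuotient' Z' m.primeCompl g (I • ⊤ : Submodule Z Y)) _ ?_
  have hdisj : Disjoint (m.primeCompl : Set Z) p :=
    Set.disjoint_left.mpr fun x hx hxp => hx (hpm hxp)
  have := IsLocalization.under_map_of_isPrime_disjoint m.primeCompl Z' hp.isPrime hdisj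
  rw [Ideal.under] at this
  rwa [this]

omit [Algebra Z A'] [IsScalarTower Z Z' A'] [IsScalarTower Z A' Y'] in
include Z' m g in
-- Localisation gives a sequence of length d in the maximal ideal of Z'. If a shorter rs in m were
-- not extendable, m would be associated to Y/(rs)Y, hence so would its extension to Z' after
-- localising, contrary to the exchange property there.
theorem HasGradeFormula.exists_isWeaklyRegular {d : ℕ} (h : HasGradeFormula A' Y')
    (hY : Module.annihilator Z Y = ⊥) (hd : m.height = d) :
    ∃ rs : List Z, rs.length = d ∧ (∀ r ∈ rs, r ∈ m) ∧ IsWeaklyRegular Y rs := by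
  have : IsNoetherianRing Z' := IsLocalization.isNoetherianRing m.primeCompl Z' inferInstance
  have := IsLocalization.AtPrime.isLocalRing Z' m
  have hdim : ringKrullDim Z' = d := by
    rw [IsLocalization.AtPrime.ringKrullDim_eq_height m, hd]
    rfl
  obtain ⟨ss, hslen, hsm, hss⟩ := h.hasDepth (Z := Z') hdim
    (annihilator_eq_bot_of_isLocalizedModule (m := m) Z' g hY) (IsLocalRing.maximalIdeal Z')
    (IsLocalRing.maximalIdeal.isMaximal Z')
  suffices ∀ n ≤ d, ∃ rs : List Z, rs.length = n ∧ (∀ r ∈ rs, r ∈ m) ∧ IsWeaklyRegular Y rs from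
    this d le_rfl
  intro n
  induction n with
  | zero => exact fun _ => ⟨[], rfl, by simp, by simp⟩
  | succ n ih =>
    intro hn
    obtain ⟨rs, rfl, hrm, hrs⟩ := ih (by omega)
    obtain ⟨x, hxm, hx⟩ : ∃ x ∈ m,
        IsSMulRegular (Y ⧸ (Ideal.ofList rs • ⊤ : Submodule Z Y)) x := by
      by_contra! hcon
      obtain ⟨p, hp, hmp⟩ := exists_le_associatedPrime_of_forall_not_isSMulRegular hcon
      obtain rfl : m = p := Ideal.IsMaximal.eq_of_le inferInstance hp.isPrime.ne_top hmp
      have hass := mem_associatedPrimes_localization (Z' := Z') g le_rfl hp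
      rw [IsLocalization.AtPrime.map_eq_maximalIdeal m Z', Ideal.map_ofList] at hass
      obtain ⟨z, hz, hreg⟩ := exists_isSMulRegular_of_length_lt
        (hrs.of_isLocalizedModule Z' m.primeCompl g) (fun r hr => by
          obtain ⟨r, hr', rfl⟩ := List.mem_map.mp hr
          exact (IsLocalization.AtPrime.to_map_mem_maximal_iff Z' m r).mpr (hrm r hr')) hss hsm
        (by rw [List.length_map]; omega)
      exact notMem_of_isSMulRegular hreg hass hz
    refine ⟨rs ++ [x], by simp, ?_, ?_⟩
    · intro t ht
      rcases List.mem_append.mp ht with ht | ht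
      · exact hrm t ht
      · rw [List.mem_singleton.mp ht]; exact hxm
    · exact (isWeaklyRegular_append_iff Y rs [x]).mpr
        ⟨hrs, (isWeaklyRegular_singleton_iff _ x).mpr hx⟩

include Z' φ hg in
-- Because p ⊆ m, the hypotheses survive localisation at m. The local ring has enough homomorphisms,
-- and a nonzero one descends to M after clearing denominators.
theorem HasGradeFormula.exists_linearMap {d : ℕ} (h : HasGradeFormula A' Y')
    (hY : Module.annihilator Z Y = ⊥) (hd : m.height = d) {M : Type u} [AddCommGroup M]
    [Module A M] [Module Z M] [IsScalarTower Z A M] [Module.Finite A M] {rs : List Z}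
    (hrM : ∀ r ∈ rs, r ∈ Module.annihilator Z M) (hrs : IsWeaklyRegular Y rs) {p : Ideal Z}
    (hp : p ∈ associatedPrimes Z (Y ⧸ (Ideal.ofList rs • ⊤ : Submodule Z Y)))
    (hMp : Module.annihilator Z M ≤ p) (hpm : p ≤ m) :
    ∃ f : M →ₗ[A] Y ⧸ idealSMulTop A (Ideal.ofList rs) Y, f ≠ 0 := by
  have : IsNoetherianRing Z' := IsLocalization.isNoetherianRing m.primeCompl Z' inferInstance
  have hdim : ringKrullDim Z' = d := by
    rw [IsLocalization.AtPrime.ringKrullDim_eq_height m, hd]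
    rfl
  have hom := h.hasEnoughHoms (Z := Z') hdim
    (annihilator_eq_bot_of_isLocalizedModule (m := m) Z' g hY)
  have : Module.Finite Z M := Module.Finite.trans A M
  let N := LocalizedModule m.primeCompl M
  let ι : M →ₗ[Z] N := LocalizedModule.mkLinearMap m.primeCompl M
  have hι : IsLocalizedModule m.primeCompl ι := inferInstance
  have hN : ∀ s : m.primeCompl, Function.Bijective fun x : N => (s : Z) • x := fun s =>
    (Module.End.isUnit_iff _).mp (IsLocalizedModule.map_units ι s)
  -- A acts on the localisation N of M, and scalars outside m act invertibly, so the action extends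
  -- to A'.
  let ψ : A →ₐ[Z] Module.End Z N := AlgHom.ofLinearMap
    (IsLocalizedModule.map m.primeCompl ι ι ∘ₗ (Algebra.lsmul Z Z M).toLinearMap)
    (by
      refine IsLocalizedModule.ext m.primeCompl ι (IsLocalizedModule.map_units ι) ?_
      ext x
      simp)
    (fun a b => by
      refine IsLocalizedModule.ext m.primeCompl ι (IsLocalizedModule.map_units ι) ?_
      ext x
      simp)
  have hψ : ∀ a x, ψ a (ι x) = ι (a • x) := fun a x => by simp [ψ]
  obtain ⟨Ψ, hΨ⟩ := exists_algHom_lift (S := m.primeCompl) φ ψ fun s => by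
    obtain ⟨w, hw⟩ := IsLocalizedModule.map_units (S := m.primeCompl) ι s
    simp_rw [Algebra.smul_def, ← hw]
    exact Units.mulLeft_bijective w
  let _ : Module A' N := Module.compHom N Ψ.toRingHom
  have hΨN : ∀ (a : A') (n : N), a • n = Ψ a n := fun _ _ => rfl
  have : IsScalarTower Z A' N := IsScalarTower.of_algebraMap_smul fun z n => by
    rw [hΨN, AlgHom.commutes, Module.algebraMap_end_apply]
  let _ : Module Z' N := Module.compHom N (algebraMap Z' A')
  have : IsScalarTower Z' A' N := IsScalarTower.of_algebraMap_smul fun _ _ => rfl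
  have : IsScalarTower Z Z' N := IsScalarTower.of_algebraMap_smul fun z n => by
    change algebraMap Z' A' (algebraMap Z Z' z) • n = z • n
    rw [← IsScalarTower.algebraMap_apply, algebraMap_smul]
  have hφι : ∀ a x, ι (a • x) = φ a • ι x := fun a x => by rw [hΨN, hΨ, hψ]
  have : Module.Finite Z' N := Module.Finite.of_isLocalizedModule m.primeCompl ι
  have : Module.Finite A' N := Module.Finite.of_restrictScalars_finite Z' A' N
  have hass := mem_associatedPrimes_localization (Z' := Z') (Y' := Y') g hpm hp
  rw [Ideal.map_ofList] at hass
  have hex := hom N inferInstance (rs.map (algebraMap Z Z')) (fun r hr => by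
      obtain ⟨r, hr', rfl⟩ := List.mem_map.mp hr
      refine Module.mem_annihilator.mpr fun n => ?_
      obtain ⟨⟨x, s⟩, hs⟩ := IsLocalizedModule.surj m.primeCompl ι n
      refine (hN s).1 ?_
      have hs' : (s : Z) • n = ι x := hs
      change (s : Z) • algebraMap Z Z' r • n = (s : Z) • (0 : N)
      rw [algebraMap_smul, smul_comm, hs', ← map_smul, Module.mem_annihilator.mp (hrM r hr'),
        map_zero, smul_zero])
    (hrs.of_isLocalizedModule Z' m.primeCompl g) _ hass (fun z' hz' => by
      obtain ⟨z, s, rfl⟩ := IsLocalization.exists_mk'_eq m.primeCompl z'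
      rw [Module.mem_annihilator] at hz'
      obtain ⟨t, ht⟩ := exists_smul_mem_annihilator (S := m.primeCompl) ι (z := z) fun x => by
        have := hz' x
        rw [← algebraMap_smul Z', ← IsLocalization.mk'_spec' Z' z s, mul_smul, this, smul_zero]
      have hzp : z ∈ p := (hp.isPrime.mem_or_mem (hMp ht)).resolve_left fun h => t.2 (hpm h)
      rw [IsLocalization.mk'_eq_mul_mk'_one]
      exact Ideal.mul_mem_right _ _ (Ideal.mem_map_of_mem _ hzp))
  have hI : idealSMulTop A' (Ideal.ofList (rs.map (algebraMap Z Z'))) Y' =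
      idealSMulTop A' (Ideal.ofList rs) Y' := by
    ext y
    rw [mem_idealSMulTop, mem_idealSMulTop, ← Ideal.map_ofList,
      ← Submodule.restrictScalars_mem Z, Ideal.smul_restrictScalars, Submodule.restrictScalars_top]
  rw [hI] at hex
  obtain ⟨F, hF⟩ := hex
  obtain ⟨x, hx⟩ : ∃ x, F (ι x) ≠ 0 := by
    by_contra! hcon
    refine hF (LinearMap.ext fun n => ?_)
    obtain ⟨⟨x, s⟩, hs⟩ := IsLocalizedModule.surj m.primeCompl ι n
    have hs' : (s : Z) • n = ι x := hs
    refine (bijective_smul_of_isLocalization (S := m.primeCompl) Z' s).1 ?_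
    change (s : Z) • F n = (s : Z) • (0 : Y' ⧸ idealSMulTop A' (Ideal.ofList rs) Y')
    rw [← LinearMap.map_smul_of_tower, hs', hcon, smul_zero]
  obtain ⟨v, hloc, hv⟩ := exists_isLocalizedModule_quotient (m := m) Z' φ g hg (Ideal.ofList rs)
  have : Module.Finite Z (Y ⧸ idealSMulTop A (Ideal.ofList rs) Y) :=
    Module.Finite.of_surjective _ (idealSMulTopQuotEquiv A (Ideal.ofList rs) Y).surjective
  obtain ⟨f, s, hf⟩ := exists_linearMap_clearing_denominators (S := m.primeCompl) φ v hv
    (F.restrictScalars Z ∘ₗ ι) fun a x => by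
      change F (ι (a • x)) = φ a • F (ι x)
      rw [hφι, map_smul]
  refine ⟨f, fun h0 => hx ?_⟩
  refine (bijective_smul_of_isLocalization (S := m.primeCompl) Z' s).1 ?_
  change (s : Z) • F (ι x) = (s : Z) • (0 : Y' ⧸ idealSMulTop A' (Ideal.ofList rs) Y')
  have := hf x
  rw [h0, LinearMap.zero_apply, map_zero] at this
  rw [smul_zero]
  exact this.symm

end Maximal

/-! ### The centre is Noetherian (Eakin–Nagata) -/

section EakinNagata

variable {Z : Type*} [CommRing Z]

/-- Formanek's argument: pass to a quotient Q/N that is as small as possible with the same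
annihilator as Q. It is Noetherian, and Z modulo the annihilator embeds into a finite power of it.
-/
theorem isNoetherian_of_isNoetherian_quotient_smul {Q : Type*} [AddCommGroup Q] [Module Z Q]
    [Module.Finite Z Q]
    (h : ∀ z : Z, (∀ q : Q, z • q = 0) ∨ IsNoetherian Z (Q ⧸ (z • ⊤ : Submodule Z Q))) :
    IsNoetherian Z Q := by
  have hfg : ∀ z : Z, (z • ⊤ : Submodule Z Q).FG := fun z => Module.Finite.fg_top.map _
  have hle : ∀ (z : Z) (N : Submodule Z Q), (z • ⊤ : Submodule Z Q) ≤ N ↔ ∀ q, z • q ∈ N :=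
    fun z N => ⟨fun h q => h (Submodule.smul_mem_pointwise_smul q z ⊤ trivial), fun h => by
      rintro _ ⟨q, -, rfl⟩
      exact h q⟩
  -- Zorn's lemma applies because each z Q is finitely generated: if it lies in the union of a
  -- chain, it lies in a member.
  obtain ⟨N, -, hN⟩ := zorn_le_nonempty₀
    {N : Submodule Z Q | ∀ z : Z, (∀ q, z • q ∈ N) → ∀ q : Q, z • q = 0}
    (fun c hc hchain N hNc => ⟨sSup c, fun z hz => by
      obtain ⟨N', hN', hzN'⟩ := (CompleteLattice.isCompactElement_iff_le_of_directed_sSup_le _ _).mp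
        ((Submodule.fg_iff_compact _).mp (hfg z)) c ⟨N, hNc⟩ hchain.directedOn
        ((hle z _).mpr hz)
      exact hc hN' z ((hle z _).mp hzN'), fun N hN => le_sSup hN⟩)
    ⊥ (fun z hz q => by simpa using hz q)
  -- A submodule strictly above N contains some nonzero z Q, by maximality of N; it is finitely
  -- generated since z Q is and Q/zQ is Noetherian.
  have hQN : IsNoetherian Z (Q ⧸ N) := by
    refine ⟨fun W => ?_⟩
    by_cases hW : W.comap N.mkQ = N
    · rw [← Submodule.map_comap_eq_of_surjective N.mkQ_surjective W, hW, Submodule.mkQ_map_self]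
      exact Submodule.fg_bot
    · have hNW : N ≤ W.comap N.mkQ := by
        intro x hx
        rw [Submodule.mem_comap, Submodule.mkQ_apply, (Submodule.Quotient.mk_eq_zero N).mpr hx]
        exact W.zero_mem
      obtain ⟨z, hz, hz0⟩ : ∃ z : Z, (∀ q, z • q ∈ W.comap N.mkQ) ∧ ¬ ∀ q : Q, z • q = 0 := by
        by_contra! hcon
        exact hW (le_antisymm (hN.2 (fun z hz q => hcon z hz q) hNW) hNW)
      have := (h z).resolve_left hz0
      have hfgW : (W.comap N.mkQ).FG := by
        refine Submodule.fg_of_fg_map_of_fg_inf_ker (z • ⊤ : Submodule Z Q).mkQ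
          (IsNoetherian.noetherian _) ?_
        rw [Submodule.ker_mkQ, inf_eq_right.mpr ((hle z _).mpr hz)]
        exact hfg z
      rw [← Submodule.map_comap_eq_of_surjective N.mkQ_surjective W]
      exact hfgW.map _
  obtain ⟨n, x, hx⟩ := Module.Finite.exists_fin (R := Z) (M := Q)
  let e : Z →ₗ[Z] (Fin n → Q ⧸ N) :=
    LinearMap.pi fun i => LinearMap.toSpanSingleton Z _ (N.mkQ (x i))
  have hann : LinearMap.ker e ≤ Module.annihilator Z Q := by
    intro z hz
    refine Module.mem_annihilator.mpr (hN.1 z fun q => ?_)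
    have hq : q ∈ Submodule.span Z (Set.range x) := hx ▸ trivial
    induction hq using Submodule.span_induction with
    | mem q hq =>
      obtain ⟨i, rfl⟩ := hq
      have := congrFun (LinearMap.mem_ker.mp hz) i
      rw [← Submodule.Quotient.mk_eq_zero]
      simpa [e] using this
    | zero => simp
    | add a b _ _ ha hb => rw [smul_add]; exact N.add_mem ha hb
    | smul c a _ ha => rw [smul_comm]; exact N.smul_mem _ ha
  have hker : IsNoetherian Z (Z ⧸ LinearMap.ker e) :=
    isNoetherian_of_linearEquiv e.quotKerEquivRange.symm
  let t : (Fin n → Z ⧸ LinearMap.ker e) →ₗ[Z] Q :=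
    LinearMap.lsum Z _ Z fun i => (LinearMap.ker e).liftQ (LinearMap.toSpanSingleton Z Q (x i))
      fun z hz => by
        rw [LinearMap.mem_ker, LinearMap.toSpanSingleton_apply]
        exact Module.mem_annihilator.mp (hann hz) _
  refine isNoetherian_of_surjective t ?_
  rw [eq_top_iff, ← hx, Submodule.span_le]
  rintro _ ⟨i, rfl⟩
  refine ⟨Pi.single i (Submodule.Quotient.mk 1), ?_⟩
  rw [LinearMap.lsum_piSingle, Submodule.liftQ_apply, LinearMap.toSpanSingleton_apply, one_smul]

/-- Scalars over which a Noetherian ring is a finite faithful algebra form a Noetherian ring. -/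
theorem isNoetherianRing_of_annihilator_eq_bot {R : Type*} [Ring R] [Algebra Z R]
    [IsNoetherianRing R] [Module.Finite Z R] (hR : Module.annihilator Z R = ⊥) :
    IsNoetherianRing Z := by
  have key : ∀ I : Ideal Z, IsNoetherian Z (R ⧸ (I • ⊤ : Submodule Z R)) := by
    -- Noetherian induction on the left ideal I R of R: a scalar z not killing R/IR makes (I + (z))R
    -- strictly larger, so R/(I + (z))R is already Noetherian over Z.
    suffices ∀ (J : Ideal R) (I : Ideal Z), idealSMulTop R I R = J →
        IsNoetherian Z (R ⧸ (I • ⊤ : Submodule Z R)) from fun I => this _ I rfl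
    intro J
    induction J using WellFoundedGT.induction with | _ J ih
    rintro I rfl
    refine isNoetherian_of_isNoetherian_quotient_smul fun z => ?_
    by_cases hz : ∀ q : R ⧸ (I • ⊤ : Submodule Z R), z • q = 0
    · exact Or.inl hz
    right
    have hle : idealSMulTop R I R ≤ idealSMulTop R (I ⊔ Ideal.span {z}) R := by
      intro x hx
      rw [mem_idealSMulTop] at hx ⊢
      exact Submodule.smul_mono_left (le_sup_left : I ≤ I ⊔ Ideal.span {z}) hx
    have hlt : idealSMulTop R I R < idealSMulTop R (I ⊔ Ideal.span {z}) R := by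
      refine lt_of_le_of_ne hle fun he => hz fun q => ?_
      obtain ⟨r, rfl⟩ := Submodule.Quotient.mk_surjective _ q
      rw [← Submodule.Quotient.mk_smul, Submodule.Quotient.mk_eq_zero, ← mem_idealSMulTop (A := R),
        he, mem_idealSMulTop]
      exact Submodule.smul_mem_smul (Ideal.mem_sup_right (Ideal.mem_span_singleton_self z)) trivial
    have hnoeth := ih _ hlt (I ⊔ Ideal.span {z}) rfl
    let W : Submodule Z (R ⧸ (I • ⊤ : Submodule Z R)) := z • ⊤
    have hker : ((I ⊔ Ideal.span {z}) • ⊤ : Submodule Z R) ≤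
        LinearMap.ker (W.mkQ ∘ₗ (I • ⊤ : Submodule Z R).mkQ) := by
      rw [Submodule.sup_smul, sup_le_iff]
      constructor
      · intro x hx
        rw [LinearMap.mem_ker, LinearMap.comp_apply, Submodule.mkQ_apply _ x,
          (Submodule.Quotient.mk_eq_zero _).mpr hx, map_zero]
      · rw [Submodule.ideal_span_singleton_smul]
        rintro _ ⟨x, -, rfl⟩
        change W.mkQ ((I • ⊤ : Submodule Z R).mkQ (z • x)) = 0
        rw [map_smul, Submodule.mkQ_apply W, Submodule.Quotient.mk_eq_zero]
        exact Submodule.smul_mem_pointwise_smul _ _ _ trivial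
    refine isNoetherian_of_surjective (Submodule.liftQ _ _ hker) (LinearMap.range_eq_top.mpr ?_)
    refine Function.Surjective.of_comp (g := (Submodule.mkQ _)) ?_
    rw [← LinearMap.coe_comp, Submodule.liftQ_mkQ, LinearMap.coe_comp]
    exact (Submodule.mkQ_surjective _).comp (Submodule.mkQ_surjective _)
  have hRZ : IsNoetherian Z R := by
    have := key ⊥
    rw [Submodule.bot_smul] at this
    exact isNoetherian_of_linearEquiv (Submodule.quotEquivOfEqBot _ rfl)
  refine isNoetherian_of_injective (Algebra.linearMap Z R) ((injective_iff_map_eq_zero _).mpr ?_)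
  intro z hz
  have : z ∈ Module.annihilator Z R := Module.mem_annihilator.mpr fun r => by
    rw [Algebra.smul_def]
    change Algebra.linearMap Z R z * r = 0
    rw [hz, zero_mul]
  rwa [hR] at this

end EakinNagata

/-! ### The grade by regular sequences in a maximal ideal -/

section SeqGrade

variable {Z : Type u} [CommRing Z] [IsNoetherianRing Z] {Y : Type u} [AddCommGroup Y] [Module Z Y]
  [Module.Finite Z Y] {m : Ideal Z} [m.IsMaximal]

omit [IsNoetherianRing Z] in
-- For faithful finite Y the ideal m stays in the support of Y/(rs)Y, so properness is automatic.
theorem IsWeaklyRegular.isRegular_of_mem (hY : Module.annihilator Z Y = ⊥) {rs : List Z}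
    (hrs : IsWeaklyRegular Y rs) (hm : ∀ r ∈ rs, r ∈ m) : IsRegular Y rs := by
  refine ⟨hrs, fun h => ?_⟩
  have hmem : (⟨m, inferInstance⟩ : PrimeSpectrum Z) ∈
      Module.support Z (Y ⧸ (Ideal.ofList rs • ⊤ : Submodule Z Y)) :=
    (mem_support_quotient_ofList hY).mpr hm
  have : Nontrivial (Y ⧸ (Ideal.ofList rs • ⊤ : Submodule Z Y)) :=
    Module.nonempty_support_iff.mp ⟨_, hmem⟩
  exact Submodule.Quotient.nontrivial_iff.mp this h.symm

omit [IsNoetherianRing Z] in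
theorem natCast_le_seqGrade_iff (hY : Module.annihilator Z Y = ⊥) {n : ℕ} :
    (n : ℕ∞) ≤ seqGrade m Y ↔
      ∃ rs : List Z, rs.length = n ∧ (∀ r ∈ rs, r ∈ m) ∧ IsWeaklyRegular Y rs := by
  constructor
  · intro h
    cases n with
    | zero => exact ⟨[], rfl, by simp, by simp⟩
    | succ n =>
      have hlt : (n : ℕ∞) < seqGrade m Y := lt_of_lt_of_le (by exact_mod_cast n.lt_succ_self) h
      rw [seqGrade] at hlt
      simp only [lt_iSup_iff] at hlt
      obtain ⟨rs, ⟨hrm, hrs⟩, hlen⟩ := hlt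
      have hlen' : n + 1 ≤ rs.length := by exact_mod_cast hlen
      have hw : IsWeaklyRegular Y (rs.take (n + 1) ++ rs.drop (n + 1)) := by
        rw [List.take_append_drop]
        exact hrs.toIsWeaklyRegular
      exact ⟨rs.take (n + 1), by simpa using hlen', fun r hr => hrm r (List.mem_of_mem_take hr),
        ((isWeaklyRegular_append_iff Y _ _).mp hw).1⟩
  · rintro ⟨rs, rfl, hrm, hrs⟩
    exact le_iSup₂ (f := fun (rs : List Z) (_ : (∀ r ∈ rs, r ∈ m) ∧ IsRegular Y rs) =>
      (rs.length : ℕ∞)) rs ⟨hrm, IsWeaklyRegular.isRegular_of_mem hY hrs hrm⟩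

theorem seqGrade_le_height (hY : Module.annihilator Z Y = ⊥) : seqGrade m Y ≤ m.height :=
  iSup₂_le fun _ h => length_le_height_of_isWeaklyRegular hY h.2.toIsWeaklyRegular h.1

theorem HasDepth.seqGrade_eq {d : ℕ} (hd : HasDepth Z Y d) (hdim : ringKrullDim Z = d)
    (hY : Module.annihilator Z Y = ⊥) : seqGrade m Y = d :=
  le_antisymm ((seqGrade_le_height hY).trans_eq (hd.height_eq hdim hY))
    ((natCast_le_seqGrade_iff hY).mpr (hd m inferInstance))

omit m [m.IsMaximal] in
-- Finiteness of dim Z comes for free: the grade is bounded by the height of m, which is finite in a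
-- Noetherian ring.
theorem exists_hasDepth_of_seqGrade_eq [Nontrivial Z] (hY : Module.annihilator Z Y = ⊥)
    (h : ∀ m : Ideal Z, m.IsMaximal → (seqGrade m Y : WithBot ℕ∞) = ringKrullDim Z) :
    ∃ d : ℕ, ringKrullDim Z = d ∧ HasDepth Z Y d := by
  obtain ⟨m, hm⟩ := Ideal.exists_maximal Z
  have hlt : seqGrade m Y ≠ ⊤ := ne_top_of_le_ne_top
    (Ideal.height_ne_top hm.ne_top) (seqGrade_le_height hY)
  obtain ⟨d, hd⟩ := ENat.ne_top_iff_exists.mp hlt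
  have hdim : ringKrullDim Z = d := by
    rw [← h m hm, ← hd]
    rfl
  refine ⟨d, hdim, fun m hm => (natCast_le_seqGrade_iff hY).mp ?_⟩
  have := h m hm
  rw [hdim] at this
  exact (WithBot.coe_inj.mp this).ge

end SeqGrade

/-! ### Heights of maximal ideals of R and of Z -/

section Equicodimensional

variable {Z : Type u} [CommRing Z] [IsNoetherianRing Z] {R : Type u} [Ring R] [IsNoetherianRing R]
  [Algebra Z R] [Module.Finite Z R]

/-- Incomparability bounds the height of P by that of its contraction m. Conversely, a regular
sequence in m of length equal to the height of m produces a chain of primes of R below P. -/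
theorem height_eq_height_contraction_of_le {P : TwoSidedIdeal R} (hP : IsCoatom P)
    (hR : Module.annihilator Z R = ⊥)
    (h : ∀ m : Ideal Z, m.IsMaximal → m.height ≤ seqGrade m R) :
    Order.height (⟨P, isPrimeIdeal_of_isCoatom hP⟩ : PrimeIdeals R) =
      (contraction Z ⟨P, isPrimeIdeal_of_isCoatom hP⟩).asIdeal.height := by
  set p := contraction Z ⟨P, isPrimeIdeal_of_isCoatom hP⟩ with hp
  have hpm : p.asIdeal.IsMaximal := isMaximal_contraction hP
  rw [PrimeSpectrum.height_eq_orderHeight]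
  refine le_antisymm (height_le_height_contraction _) ?_
  rw [← PrimeSpectrum.height_eq_orderHeight]
  obtain ⟨n, hn⟩ := ENat.ne_top_iff_exists.mp (Ideal.height_ne_top hpm.ne_top)
  have hle := h p.asIdeal hpm
  rw [← hn] at hle ⊢
  obtain ⟨rs, rfl, hrm, hrs⟩ := (natCast_le_seqGrade_iff hR).mp hle
  exact length_le_height hrs _ fun r hr => mem_contraction.mp (hrm r hr)

theorem HasDepth.isEquicodimensional {d : ℕ} (hd : HasDepth Z R d) (hdim : ringKrullDim Z = d)
    (hR : Module.annihilator Z R = ⊥) : IsEquicodimensional R := by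
  have key : ∀ (P : TwoSidedIdeal R) (hP : IsCoatom P),
      Order.height (⟨P, isPrimeIdeal_of_isCoatom hP⟩ : PrimeIdeals R) = d := by
    intro P hP
    have hpm := isMaximal_contraction (Z := Z) hP
    rw [height_eq_height_contraction_of_le hP hR fun m hm => by
      rw [hd.height_eq hdim hR, hd.seqGrade_eq hdim hR], hd.height_eq hdim hR]
  intro M N hM hN
  rw [key M hM, key N hN]

/-- By lying over, every maximal ideal of Z is a contraction, so equality of heights passes from R
to Z; the common height is then dim Z. -/
theorem IsEquicodimensional.exists_hasDepth [Nontrivial Z] (hE : IsEquicodimensional R)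
    (hR : Module.annihilator Z R = ⊥)
    (h : ∀ m : Ideal Z, m.IsMaximal → m.height ≤ seqGrade m R) :
    ∃ d : ℕ, ringKrullDim Z = d ∧ HasDepth Z R d := by
  have hheight : ∀ m n : Ideal Z, m.IsMaximal → n.IsMaximal → m.height = n.height := by
    intro m n hm hn
    obtain ⟨P, hP, hPm⟩ := exists_isCoatom_contraction_eq hR m
    obtain ⟨Q, hQ, hQn⟩ := exists_isCoatom_contraction_eq hR n
    have h₁ := height_eq_height_contraction_of_le hP hR h
    have h₂ := height_eq_height_contraction_of_le hQ hR h
    rw [hPm] at h₁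
    rw [hQn] at h₂
    rw [← h₁, ← h₂, hE P Q hP hQ]
  obtain ⟨m, hm⟩ := Ideal.exists_maximal Z
  obtain ⟨d, hd⟩ := ENat.ne_top_iff_exists.mp (Ideal.height_ne_top hm.ne_top)
  refine ⟨d, le_antisymm ?_ ?_, fun n hn => (natCast_le_seqGrade_iff hR).mp ?_⟩
  · rw [← Ideal.sup_isMaximal_height_eq_ringKrullDim]
    exact WithBot.coe_le_coe.mpr (iSup₂_le fun n hn => (hheight n m hn hm).trans hd.symm |>.le)
  · have := Ideal.height_le_ringKrullDim_of_ne_top hm.ne_top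
    rwa [← hd] at this
  · rw [hd, hheight m n hm hn]
    exact h n hn

end Equicodimensional

/-! ### The localisation map and its opposite -/

section LocalizationAlgHom

theorem isLocalizedModule_op {Z : Type*} [CommRing Z] (S : Submonoid Z) {A A' : Type*} [Ring A]
    [Ring A'] [Algebra Z A] [Algebra Z A'] (φ : A →ₐ[Z] A') [IsLocalizedModule S φ.toLinearMap] :
    IsLocalizedModule S (AlgHom.op φ).toLinearMap := by
  have : (AlgHom.op φ).toLinearMap = (MulOpposite.opLinearEquiv Z).toLinearMap ∘ₗ
      φ.toLinearMap ∘ₗ (MulOpposite.opLinearEquiv Z).symm.toLinearMap := by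
    ext x
    rfl
  rw [this]
  infer_instance

/-- The canonical homomorphism from an algebra to its localisation. -/
def localizationAlgHom {Z : Type*} [CommRing Z] (S : Submonoid Z) (A : Type*) [Ring A]
    [Algebra Z A] : A →ₐ[Z] LocalizedModule S A :=
  { LocalizedModule.numeratorRingHom with
    commutes' := fun _ => rfl }

instance {Z : Type*} [CommRing Z] (S : Submonoid Z) (A : Type*) [Ring A] [Algebra Z A] :
    IsLocalizedModule S (localizationAlgHom S A).toLinearMap :=
  localizedModuleIsLocalizedModule (M := A) S

end LocalizationAlgHom

/-! ### The equivalences -/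

section Assembly

theorem extGrade_eq_top_of_subsingleton (A : Type u) [Ring A] (M Y : Type u) [AddCommGroup M]
    [Module A M] [AddCommGroup Y] [Module A Y] [Subsingleton M] : extGrade A M Y = ⊤ := by
  rw [extGrade, iInf₂_eq_top]
  intro i hi
  exfalso
  have h0 := ModuleCat.isZero_of_subsingleton (ModuleCat.of A M)
  refine not_subsingleton (CategoryTheory.Abelian.Ext (ModuleCat.of A M) (ModuleCat.of A Y) i)
    ⟨fun x y => ?_⟩
  rw [← CategoryTheory.Abelian.Ext.mk₀_id_comp x, ← CategoryTheory.Abelian.Ext.mk₀_id_comp y,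
    h0.eq_of_src (CategoryTheory.CategoryStruct.id _) 0]
  simp

variable {R : Type u} [Ring R]

theorem annihilator_center_eq_bot : Module.annihilator (Subring.center R) R = ⊥ := by
  rw [eq_bot_iff]
  intro z hz
  have := Module.mem_annihilator.mp hz 1
  rw [Algebra.smul_def, mul_one] at this
  exact Subtype.ext this

variable [Module.Finite (Subring.center R) R]

section Noetherian

variable [IsNoetherianRing (Subring.center R)]

theorem kdim_eq_ringKrullDim_center : Kdim R R = ringKrullDim (Subring.center R) := by
  rw [kdim_eq_supportDim (Subring.center R),
    supportDim_eq_ringKrullDim_of_annihilator_eq_bot (annihilator_center_eq_bot (R := R))]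

theorem kdim_op_eq_ringKrullDim_center : Kdim Rᵐᵒᵖ R = ringKrullDim (Subring.center R) := by
  rw [kdim_eq_supportDim (Subring.center R),
    supportDim_eq_ringKrullDim_of_annihilator_eq_bot (annihilator_center_eq_bot (R := R))]

theorem IsKrullMacaulay.exists_hasDepth [Nontrivial R] (h : IsKrullMacaulay R) :
    ∃ d : ℕ, ringKrullDim (Subring.center R) = d ∧ HasDepth (Subring.center R) R d ∧
      HasEnoughHoms (Subring.center R) R R ∧ HasEnoughHoms (Subring.center R) Rᵐᵒᵖ R := by
  have hfin := h.left_finite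
  rw [kdim_eq_ringKrullDim_center] at hfin
  obtain ⟨k, hk⟩ := WithBot.ne_bot_iff_exists.mp (ne_bot_of_le_ne_bot WithBot.coe_ne_bot
    (ringKrullDim_nonneg_of_nontrivial (R := Subring.center R)))
  rw [← hk] at hfin
  obtain ⟨d, rfl⟩ := ENat.ne_top_iff_exists.mp (WithBot.coe_lt_coe.mp hfin).ne
  have hl : HasGradeFormula R R := h.left_eq
  have hr : HasGradeFormula Rᵐᵒᵖ R := h.right_eq
  exact ⟨d, hk.symm, hl.hasDepth hk.symm annihilator_center_eq_bot,
    hl.hasEnoughHoms hk.symm annihilator_center_eq_bot,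
    hr.hasEnoughHoms hk.symm annihilator_center_eq_bot⟩

theorem isKrullMacaulay_of_hasDepth {d : ℕ} (hdim : ringKrullDim (Subring.center R) = d)
    (hd : HasDepth (Subring.center R) R d) (hl : HasEnoughHoms (Subring.center R) R R)
    (hr : HasEnoughHoms (Subring.center R) Rᵐᵒᵖ R) : IsKrullMacaulay R where
  left_finite := by
    rw [kdim_eq_ringKrullDim_center, hdim]
    exact WithBot.coe_lt_coe.mpr (ENat.natCast_lt_top d)
  right_finite := by
    rw [kdim_op_eq_ringKrullDim_center, hdim]
    exact WithBot.coe_lt_coe.mpr (ENat.natCast_lt_top d)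
  left_eq := hasGradeFormula_of_hasDepth hdim annihilator_center_eq_bot hd hl
  right_eq := hasGradeFormula_of_hasDepth hdim annihilator_center_eq_bot hd hr

theorem IsKrullMacaulay.isGradeSymmetric (h : IsKrullMacaulay R) : IsGradeSymmetric R := by
  intro M _ _ _ _ hM hM' hcen
  -- The grade formula says nothing about the zero module, whose grades are both infinite.
  rcases subsingleton_or_nontrivial M with hs | hn
  · rw [leftGrade, rightGrade, extGrade_eq_top_of_subsingleton, extGrade_eq_top_of_subsingleton]
  have : Nontrivial R := Module.nontrivial R M
  obtain ⟨d, hdim, -⟩ := h.exists_hasDepth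
  have h₁ := h.left_eq M hM hn
  have h₂ := h.right_eq M hM' hn
  let _ : Module (Subring.center R) M := Module.compHom M (algebraMap (Subring.center R) R)
  have : IsScalarTower (Subring.center R) R M := IsScalarTower.of_algebraMap_smul fun _ _ => rfl
  -- Centrality of M makes the left and right actions restrict to the same Z-action, so both Krull
  -- dimensions are the dimension of one support. It is finite and can be cancelled.
  have : IsScalarTower (Subring.center R) Rᵐᵒᵖ M :=
    IsScalarTower.of_algebraMap_smul fun z x => (hcen z z.2 x).symm
  have : Module.Finite (Subring.center R) M := Module.Finite.trans R M
  rw [kdim_eq_ringKrullDim_center, kdim_eq_supportDim (Subring.center R) R M] at h₁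
  rw [kdim_op_eq_ringKrullDim_center, kdim_eq_supportDim (Subring.center R) Rᵐᵒᵖ M, h₁] at h₂
  obtain ⟨k, hk⟩ := exists_supportDim_eq_natCast hdim (M := M)
  rw [hk] at h₂
  have h₃ : (k : ℕ∞) + leftGrade R M = k + rightGrade R M := by exact_mod_cast h₂
  exact ENat.add_right_injective_of_ne_top (ENat.natCast_ne_top k) h₃

/-- R localised at m is faithful over the localisation of Z, so both Krull dimensions in the
definition equal the height of m. -/
theorem isCenterMacaulay_iff : IsCenterMacaulay R ↔
    ∀ m : Ideal (Subring.center R), m.IsMaximal → seqGrade m R = m.height := by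
  have h₁ : ∀ (m : Ideal (Subring.center R)) [m.IsMaximal],
      Kdim (Localization.AtPrime m) (Localization.AtPrime m) = m.height := by
    intro m _
    have : IsNoetherianRing (Localization.AtPrime m) :=
      IsLocalization.isNoetherianRing m.primeCompl _ inferInstance
    rw [kdim_eq_supportDim (Localization.AtPrime m), Module.supportDim_self_eq_ringKrullDim,
      IsLocalization.AtPrime.ringKrullDim_eq_height m]
  have h₂ : ∀ (m : Ideal (Subring.center R)) [m.IsMaximal],
      Kdim (Localization.AtPrime m) (LocalizedModule m.primeCompl R) = m.height := by
    intro m _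
    have : IsNoetherianRing (Localization.AtPrime m) :=
      IsLocalization.isNoetherianRing m.primeCompl _ inferInstance
    rw [kdim_eq_supportDim (Localization.AtPrime m),
      supportDim_eq_ringKrullDim_of_annihilator_eq_bot
        (annihilator_eq_bot_of_isLocalizedModule (m := m) (Localization.AtPrime m)
          (LocalizedModule.mkLinearMap m.primeCompl R) annihilator_center_eq_bot),
      IsLocalization.AtPrime.ringKrullDim_eq_height m]
  constructor
  · intro h m hm
    have := h.maximal m
    rw [h₁] at this
    exact WithBot.coe_inj.mp this
  · intro h
    refine ⟨fun m hm => ?_, fun m hm => ?_⟩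
    · rw [h₂, h m hm]
    · rw [h₁, h m hm]

variable {m : Ideal (Subring.center R)} [m.IsMaximal]

theorem isKrullMacaulay_centralLocalization {d : ℕ} (hdim : ringKrullDim (Subring.center R) = d)
    (hd : HasDepth (Subring.center R) R d) (hl : HasEnoughHoms (Subring.center R) R R)
    (hr : HasEnoughHoms (Subring.center R) Rᵐᵒᵖ R) : IsKrullMacaulay (CentralLocalization R m) := by
  let _ := localizedAlgebra m.primeCompl R
  have : IsNoetherianRing (Localization.AtPrime m) :=
    IsLocalization.isNoetherianRing m.primeCompl _ inferInstance
  let g : R →ₗ[Subring.center R] CentralLocalization R m :=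
    (localizationAlgHom m.primeCompl R).toLinearMap
  have := isLocalizedModule_op m.primeCompl (localizationAlgHom m.primeCompl R)
  have hann : Module.annihilator (Localization.AtPrime m) (CentralLocalization R m) = ⊥ :=
    annihilator_eq_bot_of_isLocalizedModule (m := m) (Localization.AtPrime m) g
      annihilator_center_eq_bot
  have hfin : ringKrullDim (Localization.AtPrime m) < ⊤ := by
    rw [IsLocalization.AtPrime.ringKrullDim_eq_height m,
      hd.height_eq hdim annihilator_center_eq_bot]
    exact WithBot.coe_lt_coe.mpr (ENat.natCast_lt_top d)
  refine ⟨?_, ?_, ?_, ?_⟩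
  · rwa [kdim_eq_supportDim (Localization.AtPrime m),
      supportDim_eq_ringKrullDim_of_annihilator_eq_bot hann]
  · rwa [kdim_eq_supportDim (Localization.AtPrime m),
      supportDim_eq_ringKrullDim_of_annihilator_eq_bot hann]
  · exact HasGradeFormula.localization (m := m) (Z' := Localization.AtPrime m)
      (localizationAlgHom m.primeCompl R) g
      (fun a y => map_mul (localizationAlgHom m.primeCompl R) a y) hd hdim
      annihilator_center_eq_bot hl
  · exact HasGradeFormula.localization (m := m) (Z' := Localization.AtPrime m)
      (AlgHom.op (localizationAlgHom m.primeCompl R)) g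
      (fun a y => map_mul (localizationAlgHom m.primeCompl R) y a.unop) hd hdim
      annihilator_center_eq_bot hr

theorem IsKrullMacaulay.height_le_seqGrade (h : IsKrullMacaulay (CentralLocalization R m)) :
    m.height ≤ seqGrade m R := by
  let _ := localizedAlgebra m.primeCompl R
  let g : R →ₗ[Subring.center R] CentralLocalization R m :=
    (localizationAlgHom m.primeCompl R).toLinearMap
  have hl : HasGradeFormula (CentralLocalization R m) (CentralLocalization R m) := h.left_eq
  obtain ⟨n, hn⟩ := ENat.ne_top_iff_exists.mp (Ideal.height_ne_top (I := m) Ideal.IsPrime.ne_top')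
  have hbot : Module.annihilator (Subring.center R) R = ⊥ := annihilator_center_eq_bot
  rw [← hn]
  exact (natCast_le_seqGrade_iff hbot).mpr
    (hl.exists_isWeaklyRegular (m := m) (Z' := Localization.AtPrime m) g hbot hn.symm)

omit m [m.IsMaximal] in
-- Only one maximal ideal is needed for each instance: any one above the associated prime p.
theorem IsLocallyKrullMacaulay.hasEnoughHoms (h : IsLocallyKrullMacaulay R) :
    HasEnoughHoms (Subring.center R) R R ∧ HasEnoughHoms (Subring.center R) Rᵐᵒᵖ R := by
  constructor <;>
  · intro M _ _ _ _ hM rs hrM hrs p hp hMp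
    obtain ⟨m, hm, hpm⟩ := Ideal.exists_le_maximal p hp.isPrime.ne_top
    let _ := localizedAlgebra m.primeCompl R
    let g : R →ₗ[Subring.center R] CentralLocalization R m :=
      (localizationAlgHom m.primeCompl R).toLinearMap
    have := isLocalizedModule_op m.primeCompl (localizationAlgHom m.primeCompl R)
    obtain ⟨n, hn⟩ := ENat.ne_top_iff_exists.mp (Ideal.height_ne_top hm.ne_top)
    have hl : HasGradeFormula (CentralLocalization R m) (CentralLocalization R m) := (h m).left_eq
    have hr : HasGradeFormula (CentralLocalization R m)ᵐᵒᵖ (CentralLocalization R m) :=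
      (h m).right_eq
    first
    | exact hl.exists_linearMap (m := m) (Z' := Localization.AtPrime m)
        (localizationAlgHom m.primeCompl R) g
        (fun a y => map_mul (localizationAlgHom m.primeCompl R) a y) annihilator_center_eq_bot
        hn.symm hrM hrs hp hMp hpm
    | exact hr.exists_linearMap (m := m) (Z' := Localization.AtPrime m)
        (AlgHom.op (localizationAlgHom m.primeCompl R)) g
        (fun a y => map_mul (localizationAlgHom m.primeCompl R) y a.unop) annihilator_center_eq_bot
        hn.symm hrM hrs hp hMp hpm

end Noetherian

omit [Module.Finite (Subring.center R) R] in
theorem tfae_of_subsingleton [Subsingleton R] : List.TFAE [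
    IsKrullMacaulay R, IsEquicodimensional R ∧ IsLocallyKrullMacaulay R,
    IsCenterMacaulay R ∧ IsEquicodimensional R ∧ IsGradeSymmetric R,
    (∀ (m : Ideal (Subring.center R)), m.IsMaximal → (seqGrade m R : WithBot ℕ∞) = Kdim R R) ∧
      IsGradeSymmetric R] := by
  have hmax : ∀ m : Ideal (Subring.center R), ¬ m.IsMaximal := fun m hm =>
    hm.ne_top (Subsingleton.elim _ _)
  have hcoatom : ∀ P : TwoSidedIdeal R, ¬ IsCoatom P := fun P hP =>
    hP.1 ((TwoSidedIdeal.one_mem_iff P).mp (by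
      rw [Subsingleton.elim (1 : R) 0]
      exact P.zero_mem))
  have hKM : IsKrullMacaulay R := by
    have hbot : ∀ (A : Type u) [Ring A] [Module A R], Kdim A R < ⊤ := fun A _ _ => by
      have : DevLT 0 (⊥ : Submodule A R) ⊤ := Set.subsingleton_of_subsingleton
      rw [Kdim, if_pos this]
      exact WithBot.bot_lt_coe _
    refine ⟨hbot R, hbot Rᵐᵒᵖ, fun M _ _ _ hM => ?_, fun M _ _ _ hM => ?_⟩
    · exact absurd (Module.subsingleton R M) (not_subsingleton M)
    · exact absurd (Module.subsingleton Rᵐᵒᵖ M) (not_subsingleton M)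
  have hE : IsEquicodimensional R := fun M N hM hN => absurd hM (hcoatom M)
  have hL : IsLocallyKrullMacaulay R := fun m hm => absurd hm (hmax m)
  have hC : IsCenterMacaulay R := ⟨fun m hm => absurd hm (hmax m), fun m hm => absurd hm (hmax m)⟩
  have hG : IsGradeSymmetric R := fun M _ _ _ _ _ _ _ => by
    have := Module.subsingleton R M
    rw [leftGrade, rightGrade, extGrade_eq_top_of_subsingleton, extGrade_eq_top_of_subsingleton]
  exact List.tfae_of_forall True _ (by simp [hKM, hE, hL, hC, hG, hmax])

theorem tfae_isKrullMacaulay [IsNoetherianRing R] : List.TFAE [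
    IsKrullMacaulay R, IsEquicodimensional R ∧ IsLocallyKrullMacaulay R,
    IsCenterMacaulay R ∧ IsEquicodimensional R ∧ IsGradeSymmetric R,
    (∀ (m : Ideal (Subring.center R)), m.IsMaximal → (seqGrade m R : WithBot ℕ∞) = Kdim R R) ∧
      IsGradeSymmetric R] := by
  -- The zero ring has dimension -∞ rather than a natural number d; there all conditions hold
  -- vacuously.
  rcases subsingleton_or_nontrivial R with _ | _
  · exact tfae_of_subsingleton
  have hbot : Module.annihilator (Subring.center R) R = ⊥ := annihilator_center_eq_bot
  have : IsNoetherianRing (Subring.center R) := isNoetherianRing_of_annihilator_eq_bot hbot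
  tfae_have 1 → 2 := fun h => by
    obtain ⟨d, hdim, hd, hl, hr⟩ := h.exists_hasDepth
    exact ⟨hd.isEquicodimensional hdim hbot,
      fun m _ => isKrullMacaulay_centralLocalization hdim hd hl hr⟩
  tfae_have 2 → 1 := fun ⟨hE, hL⟩ => by
    obtain ⟨d, hdim, hd⟩ := hE.exists_hasDepth hbot fun m _ => (hL m).height_le_seqGrade
    exact isKrullMacaulay_of_hasDepth hdim hd hL.hasEnoughHoms.1 hL.hasEnoughHoms.2
  tfae_have 1 → 3 := fun h => by
    obtain ⟨d, hdim, hd, hl, hr⟩ := h.exists_hasDepth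
    exact ⟨isCenterMacaulay_iff.mpr fun m _ => by
      rw [hd.seqGrade_eq hdim hbot, hd.height_eq hdim hbot],
      hd.isEquicodimensional hdim hbot, h.isGradeSymmetric⟩
  tfae_have 3 → 4 := fun ⟨hC, hE, hG⟩ => by
    obtain ⟨d, hdim, hd⟩ := hE.exists_hasDepth hbot fun m hm =>
      (isCenterMacaulay_iff.mp hC m hm).ge
    refine ⟨fun m _ => ?_, hG⟩
    rw [hd.seqGrade_eq hdim hbot, kdim_eq_ringKrullDim_center, hdim]
    rfl
  tfae_have 4 → 1 := fun ⟨h, hG⟩ => by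
    rw [kdim_eq_ringKrullDim_center] at h
    obtain ⟨d, hdim, hd⟩ := exists_hasDepth_of_seqGrade_eq hbot h
    exact isKrullMacaulay_of_hasDepth hdim hd hG.tensorGradeSymmetric_left.hasEnoughHoms
      hG.tensorGradeSymmetric_right.hasEnoughHoms
  tfae_finish

end Assembly

end CentrallyMacaulay

end

theorem mainTheorem1 (R : Type*) [Ring R] [IsNoetherianRing R] [IsNoetherianRing Rᵐᵒᵖ]
    [Module.Finite (Subring.center R) R] :
    List.TFAE [
      CentrallyMacaulay.IsKrullMacaulay R,
      CentrallyMacaulay.IsEquicodimensional R ∧ CentrallyMacaulay.IsLocallyKrullMacaulay R,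
      CentrallyMacaulay.IsCenterMacaulay R ∧ CentrallyMacaulay.IsEquicodimensional R ∧
        CentrallyMacaulay.IsGradeSymmetric R,
      (∀ (m : Ideal (Subring.center R)), m.IsMaximal →
        (CentrallyMacaulay.seqGrade m R : WithBot ℕ∞) = CentrallyMacaulay.Kdim R R) ∧
        CentrallyMacaulay.IsGradeSymmetric R] := by
  exact CentrallyMacaulay.tfae_isKrullMacaulay
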